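/- Let $f:\mathbb R^n\to\mathbb R^n$ be a smooth vector field that is equivariant under the group $\mathbf Z_2^n$ of all sign changes of coordinates, and consider the dynamics of $\dot x=f(x)$ in the orthant $\mathbb R^n_+=\{x: x_k\ge 0 \text{ for all } k\}$. The flow need not be complete; a set is called invariant if through each of its points there passes a solution that is defined for all times and stays in the set. For a set $X$ let $W^u(X)$ be the set of $x\in\mathbb R^n_+$ whose backward solution exists for all negative times and has a nonempty $\alpha$-limit set contained in $X$, and let $W^s(X)$ be defined likewise with forward solutions and $\omega$-limit sets. For equilibria $p,q$ the connection from $p$ to $q$ is $[p\to q]=W^u(\{p\})\cap W^s(\{q\})$; a connecting trajectory from $p$ to $q$ is the full trajectory of one point of $[p\to q]$. The dimension of a connection is its Hausdorff dimension. A heteroclinic cycle is the union of finitely many hyperbolic equilibria $\xi_1,\dots,\xi_m\in\mathbb R^n_+$ and of nonempty connections $[\xi_j\to\xi_{j+1}]$ with $\xi_j\ne\xi_{j+1}$ (indices mod $m$). It is robust if every $[\xi_j\to\xi_{j+1}]$ is contained in a flow-invariant linear subspace $P_j\subseteq\mathbb R^n$ such that, for the system restricted to $P_j$, $\xi_j$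 is a saddle ($df(\xi_j)|_{P_j}$ has eigenvalues with positive and with negative real part) and $\xi_{j+1}$ is a sink (all eigenvalues of $df(\xi_{j+1})|_{P_j}$ have negative real part). A robust heteroclinic network is a connected union of finitely many robust heteroclinic cycles. A compact invariant set $Y$ is clean if $W^u(X)\subseteq Y$ for every invariant subset $X\subseteq Y$. An ac-network of $f$ is a robust heteroclinic network $Y\subset\mathbb R^n_+$ that is clean and such that all equilibria in $Y$ are hyperbolic and lie on coordinate axes, each axis contains at most one of them, and the unstable manifold in $\mathbb R^n$ of each of them has dimension one or two (i.e. $df$ has there one or two eigenvalues with positive real part, counted with multiplicity). A $\Delta$-clique with pairwise distinct equilibria $p,q,r$ is a set of the form $$\Delta_{pqr}=\{p,q,r\}\cup\kappa_{pq}\cup\kappa_{qr}\cup\bigcup_{\theta\in[0,1)}\kappa_{pr}(\theta),$$ where $\kappa_{pq}$, $\kappa_{qr}$ are connecting trajectories from $p$ to $q$ and from $q$ to $r$, $\kappa_{pr}(\theta)$ is the trajectory of a point $x(\theta)\in[p\to r]$ with $x:[0,1)\to\mathbb R^n$ continuous, $\kappa_{pr}(\theta_1)\neq\kappa_{pr}(\theta_2)$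 for $\theta_1\ne\theta_2$, and $\kappa_{pr}(\theta)\to\kappa_{pq}\cup\{q\}\cup\kappa_{qr}$ in the Hausdorff distance as $\theta\to1$. Let $Y$ be an ac-network. Then $Y$ is the union of its equilibria, of the one-dimensional connections $[p\to q]\subseteq Y$ between distinct equilibria $p,q$ of $Y$, and of the $\Delta$-cliques $\Delta_{pqr}\subseteq Y$ with $p,q,r$ equilibria of $Y$. In particular, if $p,r$ are equilibria of $Y$ and $[p\to r]$ is two-dimensional, then there is an equilibrium $q$ of $Y$ such that the closure of $[p\to r]$ is a $\Delta$-clique $\Delta_{pqr}$. -/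

import Mathlib

open Set Filter Topology
open scoped ContDiff

/-- Phase space `ℝⁿ` with its Euclidean metric. -/
abbrev Phase (n : ℕ) : Type := EuclideanSpace ℝ (Fin n)

/-- The closed positive orthant `ℝⁿ₊`, the state space of the networks. -/
def orthant (n : ℕ) : Set (Phase n) := {x | ∀ k, 0 ≤ x k}

/-- An element of `ℤ₂ⁿ`, given as a vector of signs, acts by changing signs of coordinates. -/
def signAct {n : ℕ} (s : Fin n → ℤˣ) (x : Phase n) : Phase n :=
  WithLp.toLp 2 fun k => ((s k : ℤ) : ℝ) * x k

/-- `ℤ₂ⁿ`-equivariance of a vector field. -/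
def IsZ2Equivariant {n : ℕ} (f : Phase n → Phase n) : Prop :=
  ∀ (s : Fin n → ℤˣ) (x : Phase n), f (signAct s x) = signAct s (f x)

/-! ### Solutions, limit sets, invariant sets

The flow of a smooth vector field need not be complete, so everything is phrased through solutions
`γ` of `γ' = f(γ)` on the interval of time that is needed. -/

/-- `γ` solves `γ' = f(γ)` on the time set `I` (one-sided derivatives at end points of `I`). -/
def IsSolutionOn {n : ℕ} (f : Phase n → Phase n) (γ : ℝ → Phase n) (I : Set ℝ) : Prop :=
  IsIntegralCurveOn γ (fun _ => f) I

/-- The `α`-limit set of a curve. -/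
def alphaLimit {n : ℕ} (γ : ℝ → Phase n) : Set (Phase n) := {y | MapClusterPt y atBot γ}

/-- The `ω`-limit set of a curve. -/
def omegaLimitSet {n : ℕ} (γ : ℝ → Phase n) : Set (Phase n) := {y | MapClusterPt y atTop γ}

/-- The full trajectory `{Φ(τ, x) : τ ∈ ℝ}` of a point whose solution exists for all times. -/
def trajectory {n : ℕ} (f : Phase n → Phase n) (x : Phase n) : Set (Phase n) :=
  {y | ∃ γ : ℝ → Phase n, IsSolutionOn f γ univ ∧ γ 0 = x ∧ y ∈ range γ}

/-- Invariance `Φ(τ, X) = X` for all `τ ∈ ℝ`: through each point of `X` there passes a solution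
defined for all times that stays in `X`. -/
def IsFlowInvariantSet {n : ℕ} (f : Phase n → Phase n) (X : Set (Phase n)) : Prop :=
  ∀ x ∈ X, ∃ γ : ℝ → Phase n, IsSolutionOn f γ univ ∧ γ 0 = x ∧ ∀ t, γ t ∈ X

/-- A flow-invariant linear subspace: solutions that meet `P` stay in `P` as long as they exist
(they may exist on a bounded time interval only). -/
def IsFlowInvariantSubspace {n : ℕ} (f : Phase n → Phase n) (P : Submodule ℝ (Phase n)) : Prop :=
  ∀ (γ : ℝ → Phase n) (a b : ℝ), IsSolutionOn f γ (Ioo a b) →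
    ∀ t₀ ∈ Ioo a b, γ t₀ ∈ P → ∀ t ∈ Ioo a b, γ t ∈ P

/-- The unstable set `W^u(X)` in `ℝⁿ₊`: the points whose backward solution exists for all negative
times and has a nonempty `α`-limit set contained in `X`. For `X = {ξ}` this reads `α(x) = {ξ}`. -/
def unstableSet {n : ℕ} (f : Phase n → Phase n) (X : Set (Phase n)) : Set (Phase n) :=
  {x | x ∈ orthant n ∧ ∃ γ : ℝ → Phase n, IsSolutionOn f γ (Iic 0) ∧ γ 0 = x ∧
    (alphaLimit γ).Nonempty ∧ alphaLimit γ ⊆ X}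

/-- The stable set `W^s(X)` in `ℝⁿ₊`. For `X = {ξ}` this reads `ω(x) = {ξ}`. -/
def stableSet {n : ℕ} (f : Phase n → Phase n) (X : Set (Phase n)) : Set (Phase n) :=
  {x | x ∈ orthant n ∧ ∃ γ : ℝ → Phase n, IsSolutionOn f γ (Ici 0) ∧ γ 0 = x ∧
    (omegaLimitSet γ).Nonempty ∧ omegaLimitSet γ ⊆ X}

/-- The connection `[p → q] = W^u(p) ∩ W^s(q)`: the full set of connecting trajectories. -/
def connection {n : ℕ} (f : Phase n → Phase n) (p q : Phase n) : Set (Phase n) :=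
  unstableSet f {p} ∩ stableSet f {q}

/-- `κ` is a single connecting trajectory from `p` to `q`. -/
def IsConnectingTrajectory {n : ℕ} (f : Phase n → Phase n) (p q : Phase n)
    (κ : Set (Phase n)) : Prop :=
  ∃ x ∈ connection f p q, κ = trajectory f x

/-! ### Linearisation at equilibria -/

/-- The complex eigenvalues of a real endomorphism, with algebraic multiplicity. -/
noncomputable def complexEigenvalues {V : Type*} [AddCommGroup V] [Module ℝ V]
    [Module.Finite ℝ V] (T : V →ₗ[ℝ] V) : Multiset ℂ :=
  T.charpoly.aroots ℂ

/-- The Jacobian `df(p)` as a linear map. -/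
noncomputable def jacobian {n : ℕ} (f : Phase n → Phase n) (p : Phase n) :
    Phase n →ₗ[ℝ] Phase n :=
  (fderiv ℝ f p : Phase n →L[ℝ] Phase n)

/-- Hyperbolic equilibrium: no eigenvalue of `df(p)` on the imaginary axis. -/
def IsHyperbolicEquilibrium {n : ℕ} (f : Phase n → Phase n) (p : Phase n) : Prop :=
  f p = 0 ∧ ∀ z ∈ complexEigenvalues (jacobian f p), z.re ≠ 0

open Classical in
/-- The dimension of the unstable manifold of a hyperbolic equilibrium in `ℝⁿ`: the number of
eigenvalues of `df(p)` with positive real part, counted with multiplicity. -/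
noncomputable def unstableDim {n : ℕ} (f : Phase n → Phase n) (p : Phase n) : ℕ :=
  ((complexEigenvalues (jacobian f p)).filter fun z => 0 < z.re).card

/-- `p` is a sink of the system restricted to the subspace `P`. -/
def IsSinkIn {n : ℕ} (f : Phase n → Phase n) (P : Submodule ℝ (Phase n)) (p : Phase n) : Prop :=
  p ∈ P ∧ ∃ h : ∀ v ∈ P, jacobian f p v ∈ P,
    ∀ z ∈ complexEigenvalues ((jacobian f p).restrict h), z.re < 0

/-- `p` is a saddle of the system restricted to the subspace `P`. -/
def IsSaddleIn {n : ℕ} (f : Phase n → Phase n) (P : Submodule ℝ (Phase n)) (p : Phase n) : Prop :=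
  p ∈ P ∧ ∃ h : ∀ v ∈ P, jacobian f p v ∈ P,
    (∃ z ∈ complexEigenvalues ((jacobian f p).restrict h), 0 < z.re) ∧
    (∃ z ∈ complexEigenvalues ((jacobian f p).restrict h), z.re < 0)

/-! ### Heteroclinic cycles and networks -/

/-- A heteroclinic cycle in `ℝⁿ₊`: hyperbolic equilibria `ξ₁, …, ξ_m` and nonempty heteroclinic
connections `[ξ_j → ξ_{j+1}]`, the index `j + 1` being taken modulo `m`. -/
structure HeteroclinicCycle {n : ℕ} (f : Phase n → Phase n) where
  /-- the number `m ≥ 1` of equilibria -/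
  length : ℕ
  [length_ne_zero : NeZero length]
  /-- the equilibria, in cyclic order -/
  node : Fin length → Phase n
  node_mem : ∀ j, node j ∈ orthant n
  hyperbolic : ∀ j, IsHyperbolicEquilibrium f (node j)
  heteroclinic : ∀ j, node j ≠ node (j + 1)
  connected : ∀ j, (connection f (node j) (node (j + 1))).Nonempty

attribute [instance] HeteroclinicCycle.length_ne_zero

/-- The cycle as a set: the union of its equilibria and connections. -/
def HeteroclinicCycle.carrier {n : ℕ} {f : Phase n → Phase n} (X : HeteroclinicCycle f) :
    Set (Phase n) :=
  range X.node ∪ ⋃ j, connection f (X.node j) (X.node (j + 1))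

/-- A cycle is robust if each of its connections lies in a flow-invariant subspace in which it is
of saddle-sink type. -/
def HeteroclinicCycle.IsRobust {n : ℕ} {f : Phase n → Phase n} (X : HeteroclinicCycle f) : Prop :=
  ∀ j, ∃ P : Submodule ℝ (Phase n), IsFlowInvariantSubspace f P ∧
    connection f (X.node j) (X.node (j + 1)) ⊆ P ∧
    IsSaddleIn f P (X.node j) ∧ IsSinkIn f P (X.node (j + 1))

/-- A robust heteroclinic network: a connected union of finitely many robust cycles. -/
def IsRobustHeteroclinicNetwork {n : ℕ} (f : Phase n → Phase n) (Y : Set (Phase n)) : Prop :=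
  IsConnected Y ∧ ∃ (N : ℕ) (X : Fin N → HeteroclinicCycle f),
    (∀ i, (X i).IsRobust) ∧ Y = ⋃ i, (X i).carrier

/-- A compact invariant set `Y` is clean if `W^u(X) ⊆ Y` for each of its invariant subsets `X`. -/
def IsClean {n : ℕ} (f : Phase n → Phase n) (Y : Set (Phase n)) : Prop :=
  IsCompact Y ∧ IsFlowInvariantSet f Y ∧
    ∀ X ⊆ Y, IsFlowInvariantSet f X → unstableSet f X ⊆ Y

/-- The equilibria that belong to `Y`. -/
def equilibriaIn {n : ℕ} (f : Phase n → Phase n) (Y : Set (Phase n)) : Set (Phase n) :=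
  {p | p ∈ Y ∧ f p = 0}

/-- The `i`-th coordinate axis. -/
def coordAxis {n : ℕ} (i : Fin n) : Set (Phase n) := {x | ∀ k, k ≠ i → x k = 0}

/-- An ac-network (axial and clean) of the vector field `f`. -/
structure IsACNetwork {n : ℕ} (f : Phase n → Phase n) (Y : Set (Phase n)) : Prop where
  smooth : ContDiff ℝ ∞ f
  equivariant : IsZ2Equivariant f
  subset_orthant : Y ⊆ orthant n
  network : IsRobustHeteroclinicNetwork f Y
  hyperbolic : ∀ p ∈ equilibriaIn f Y, IsHyperbolicEquilibrium f p
  axial : ∀ p ∈ equilibriaIn f Y, ∃ i, p ∈ coordAxis i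
  one_per_axis : ∀ i, (equilibriaIn f Y ∩ coordAxis i).Subsingleton
  unstable_dim : ∀ p ∈ equilibriaIn f Y, unstableDim f p = 1 ∨ unstableDim f p = 2
  clean : IsClean f Y

/-- `D` is a `Δ`-clique with equilibria `p` (beginning), `q` (middle), `r` (end). The limit of the
trajectories `κ_{pr}(θ)` as `θ → 1` is taken with respect to the Hausdorff distance of sets. -/
def IsDeltaClique {n : ℕ} (f : Phase n → Phase n) (p q r : Phase n) (D : Set (Phase n)) : Prop :=
  f p = 0 ∧ f q = 0 ∧ f r = 0 ∧ p ≠ q ∧ q ≠ r ∧ p ≠ r ∧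
  ∃ (κpq κqr : Set (Phase n)) (x : ℝ → Phase n),
    IsConnectingTrajectory f p q κpq ∧ IsConnectingTrajectory f q r κqr ∧
    ContinuousOn x (Ico 0 1) ∧
    (∀ θ ∈ Ico (0 : ℝ) 1, x θ ∈ connection f p r) ∧
    (∀ θ₁ ∈ Ico (0 : ℝ) 1, ∀ θ₂ ∈ Ico (0 : ℝ) 1, θ₁ ≠ θ₂ →
      trajectory f (x θ₁) ≠ trajectory f (x θ₂)) ∧
    Tendsto (fun θ => Metric.hausdorffEDist (trajectory f (x θ)) (κpq ∪ {q} ∪ κqr))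
      (𝓝[<] 1) (𝓝 0) ∧
    D = {p, q, r} ∪ κpq ∪ κqr ∪ ⋃ θ ∈ Ico (0 : ℝ) 1, trajectory f (x θ)

/-!
# Proof idea

Cutting `f` off outside a large ball gives a complete flow with the same symmetries that has the
orbits of `f` in `Y`. By equivariance it preserves all coordinate subspaces, and the Jacobian at an
equilibrium `p` on the axis `i` is diagonal, so `p` has one or two unstable coordinate directions.
Differences of points evolve by a quadratic cone estimate near `p`, which makes the local unstable
set a graph over the unstable coordinates.

Robustness turns every limit of an orbit into a sink of an invariant subspace that contains the
orbit. If `p` has one unstable direction, all orbits leaving it in `Y` coincide. If it has two, `j`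
and `k`, these orbits are parametrised by an arc whose ends lie in coordinate planes and tend to
equilibria on the axes `j` and `k`. The interior orbits tend to one of the two as well, to a sink in
the coordinates `i`, `j`, `k`. The basin of such a sink is open, so by connectedness the limit is
the same for all of them, say `r` on the axis `k`. The end of the arc that tends to the other
equilibrium, `q`, is a one-dimensional connection. As the parameter tends to this end, the orbits
follow it up to the saddle `q`, leave a neighbourhood of `q` along its unique unstable direction in
this space and then follow the connection from `q` to `r`: this is the `Δ`-clique.
-/

open scoped NNReal

/-! ### Flows of bounded Lipschitz vector fields -/

section GlobalFlow

variable {E : Type*} [NormedAddCommGroup E] [NormedSpace ℝ E]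

theorem eq_of_isIntegralCurve_of_lipschitzWith {g : E → E} {K : ℝ≥0} (hg : LipschitzWith K g)
    {γ δ : ℝ → E} (hγ : IsIntegralCurve γ fun _ => g) (hδ : IsIntegralCurve δ fun _ => g)
    {t₀ : ℝ} (h : γ t₀ = δ t₀) : γ = δ :=
  ODE_solution_unique_univ (v := fun _ => g) (s := fun _ => univ) (t₀ := t₀) (K := K)
    (fun _ => hg.lipschitzOnWith) (fun t => ⟨hγ t, trivial⟩) (fun t => ⟨hδ t, trivial⟩) h

theorem exists_isIntegralCurve_of_lipschitzWith [CompleteSpace E] {g : E → E} {K M : ℝ≥0}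
    (hg : LipschitzWith K g) (hM : ∀ x, ‖g x‖ ≤ M) (x : E) :
    ∃ γ : ℝ → E, γ 0 = x ∧ IsIntegralCurve γ fun _ => g := by
  have exists_on_Ioo : ∀ T : ℝ, 0 < T → ∃ α : ℝ → E, α 0 = x ∧
      ∀ t ∈ Ioo (-T) T, HasDerivAt α (g (α t)) t := by
    intro T hT
    have h0 : (0 : ℝ) ∈ Icc (-T) T := ⟨by linarith, hT.le⟩
    have hPL : IsPicardLindelof (fun _ => g) (⟨0, h0⟩ : Icc (-T) T) x (M * T.toNNReal) 0 M K :=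
      IsPicardLindelof.of_time_independent (fun y _ => hM y) hg.lipschitzOnWith
        (by simp [hT.le])
    obtain ⟨α, hα0, hα⟩ := hPL.exists_eq_forall_mem_Icc_hasDerivWithinAt₀
    exact ⟨α, hα0, fun t ht => (hα t (Ioo_subset_Icc_self ht)).hasDerivAt
      (Icc_mem_nhds ht.1 ht.2)⟩
  choose! α hα0 hα using exists_on_Ioo
  have eqOn_Ioo : ∀ S T : ℝ, 0 < S → S ≤ T → EqOn (α S) (α T) (Ioo (-S) S) := by
    intro S T hS hST
    refine ODE_solution_unique_of_mem_Ioo (v := fun _ => g) (s := fun _ => univ) (t₀ := 0) (K := K)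
      (fun _ _ => hg.lipschitzOnWith) ⟨by linarith, hS⟩
      (fun t ht => ⟨hα S hS t ht, trivial⟩)
      (fun t ht => ⟨hα T (by linarith) t ⟨by linarith [ht.1], by linarith [ht.2]⟩, trivial⟩) ?_
    rw [hα0 S hS, hα0 T (by linarith)]
  have mem_Ioo_abs : ∀ t : ℝ, t ∈ Ioo (-(|t| + 1)) (|t| + 1) := fun t => by
    rw [mem_Ioo, ← abs_lt]; exact lt_add_one _
  refine ⟨fun t => α (|t| + 1) t, by simpa using hα0 (|0| + 1) (by positivity), fun t => ?_⟩
  refine (hα (|t| + 1) (by positivity) t (mem_Ioo_abs t)).congr_of_eventuallyEq ?_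
  filter_upwards [Ioo_mem_nhds (mem_Ioo_abs t).1 (mem_Ioo_abs t).2] with s hs
  rcases le_total (|s| + 1) (|t| + 1) with h | h
  · exact eqOn_Ioo _ _ (by positivity) h (mem_Ioo_abs s)
  · exact (eqOn_Ioo _ _ (by positivity) h hs).symm

theorem dist_le_of_isIntegralCurve_of_nonneg {g : E → E} {K : ℝ≥0} (hg : LipschitzWith K g)
    {γ δ : ℝ → E} (hγ : IsIntegralCurve γ fun _ => g) (hδ : IsIntegralCurve δ fun _ => g)
    {t : ℝ} (ht : 0 ≤ t) : dist (γ t) (δ t) ≤ Real.exp (K * t) * dist (γ 0) (δ 0) := by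
  have := dist_le_of_trajectories_ODE (v := fun _ => g) (a := 0) (b := t) (fun _ => hg)
    hγ.continuous.continuousOn (fun s _ => (hγ s).hasDerivWithinAt)
    hδ.continuous.continuousOn (fun s _ => (hδ s).hasDerivWithinAt) le_rfl t ⟨ht, le_rfl⟩
  simpa [mul_comm] using this

theorem dist_le_of_isIntegralCurve {g : E → E} {K : ℝ≥0} (hg : LipschitzWith K g)
    {γ δ : ℝ → E} (hγ : IsIntegralCurve γ fun _ => g) (hδ : IsIntegralCurve δ fun _ => g)
    (t : ℝ) : dist (γ t) (δ t) ≤ Real.exp (K * |t|) * dist (γ 0) (δ 0) := by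
  rcases le_total 0 t with ht | ht
  · rw [abs_of_nonneg ht]; exact dist_le_of_isIntegralCurve_of_nonneg hg hγ hδ ht
  · have reverse : ∀ {γ : ℝ → E}, IsIntegralCurve γ (fun _ => g) →
        IsIntegralCurve (fun s => γ (-s)) fun _ y => -g y := by
      intro γ hγ t
      simpa [Function.comp_def] using (hγ (-t)).scomp t (hasDerivAt_neg t)
    have := dist_le_of_isIntegralCurve_of_nonneg (g := fun y => -g y) hg.neg (reverse hγ)
      (reverse hδ) (neg_nonneg.2 ht)
    simpa [abs_of_nonpos ht] using this

theorem exists_flow_of_lipschitzWith [CompleteSpace E] {g : E → E} {K M : ℝ≥0}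
    (hg : LipschitzWith K g) (hM : ∀ x, ‖g x‖ ≤ M) :
    ∃ φ : Flow ℝ E, ∀ x, IsIntegralCurve (fun t => φ t x) fun _ => g := by
  choose φ hφ0 hφ using exists_isIntegralCurve_of_lipschitzWith hg hM
  have hlip : ∀ t, LipschitzWith (Real.exp (K * |t|)).toNNReal fun x => φ x t := fun t =>
    LipschitzWith.of_dist_le_mul fun x y => by
      rw [Real.coe_toNNReal _ (Real.exp_pos _).le]
      simpa [hφ0] using dist_le_of_isIntegralCurve hg (hφ x) (hφ y) t
  have hspeed : ∀ x, LipschitzWith M (φ x) := fun x =>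
    lipschitzWith_of_nnnorm_deriv_le (fun t => (hφ x t).differentiableAt) fun t => by
      rw [(hφ x t).deriv]; exact hM _
  have hcont : Continuous (Function.uncurry fun t x => φ x t) :=
    continuous_prod_of_continuous_lipschitzWith _ M (fun t => (hlip t).continuous) hspeed
  refine ⟨⟨fun t x => φ x t, hcont, fun s t x => ?_, hφ0⟩, hφ⟩
  exact congrFun (eq_of_isIntegralCurve_of_lipschitzWith hg (hφ x |>.comp_add t)
    (hφ (φ x t)) (t₀ := 0) (by simp [hφ0])) s

end GlobalFlow

section Cutoff

variable {E : Type*} [NormedAddCommGroup E] [InnerProductSpace ℝ E] [FiniteDimensional ℝ E]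

theorem hasCompactSupport_smoothTransition_sub_norm_sq (C : ℝ) :
    HasCompactSupport fun x : E => Real.smoothTransition (C - ‖x‖ ^ 2) := by
  refine HasCompactSupport.of_support_subset_isCompact
    (isCompact_closedBall (0 : E) (Real.sqrt C)) fun x hx => ?_
  contrapose! hx
  have hlt : C < ‖x‖ ^ 2 := by
    rw [mem_closedBall_zero_iff, not_le] at hx
    exact (Real.sqrt_lt' ((Real.sqrt_nonneg _).trans_lt hx)).1 hx
  exact Function.notMem_support.2 (Real.smoothTransition.zero_of_nonpos (by linarith))

theorem exists_lipschitzWith_eqOn_ball_of_contDiff {f : E → E} (hf : ContDiff ℝ 1 f) (R : ℝ) :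
    ∃ (g : E → E) (K M : ℝ≥0), LipschitzWith K g ∧ (∀ x, ‖g x‖ ≤ M) ∧
      EqOn g f (Metric.ball 0 R) ∧
      ∀ A : E →ₗᵢ[ℝ] E, (∀ x, f (A x) = A (f x)) → ∀ x, g (A x) = A (g x) := by
  -- A cutoff depending on the norm only keeps the isometric symmetries of the field.
  set χ : E → ℝ := fun x => Real.smoothTransition (R ^ 2 + 1 - ‖x‖ ^ 2) with hχ
  have hχs : ContDiff ℝ 1 χ :=
    (Real.smoothTransition.contDiff (n := 1)).comp (contDiff_const.sub (contDiff_norm_sq ℝ))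
  have hg : ContDiff ℝ 1 fun x => χ x • f x := hχs.smul hf
  have hsupp : HasCompactSupport fun x => χ x • f x :=
    (hasCompactSupport_smoothTransition_sub_norm_sq _).smul_right
  obtain ⟨K, hK⟩ := ContDiff.lipschitzWith_of_hasCompactSupport hsupp hg one_ne_zero
  obtain ⟨M, hM⟩ := hsupp.exists_bound_of_continuous hg.continuous
  refine ⟨_, K, ⟨max M 0, le_max_right _ _⟩, hK, fun x => (hM x).trans (le_max_left _ _),
    fun x hx => ?_, fun A hfA x => ?_⟩
  · have hx' : ‖x‖ < R := mem_ball_zero_iff.1 hx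
    have : χ x = 1 := Real.smoothTransition.one_of_one_le (by nlinarith [norm_nonneg x])
    simp only [this, one_smul]
  · simp only [hχ, A.norm_map, hfA, map_smul]

end Cutoff

/-! ### Sign changes and coordinate subspaces -/

section SignChanges

variable {n : ℕ}

theorem signAct_apply (s : Fin n → ℤˣ) (x : Phase n) (k : Fin n) :
    signAct s x k = ((s k : ℤ) : ℝ) * x k := rfl

theorem intUnit_sq_real (u : ℤˣ) : ((u : ℤ) : ℝ) ^ 2 = 1 := by
  rcases Int.units_eq_one_or u with h | h <;> simp [h]

theorem signAct_signAct (s : Fin n → ℤˣ) (x : Phase n) : signAct s (signAct s x) = x := by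
  ext k
  rw [signAct_apply, signAct_apply, ← mul_assoc, ← sq, intUnit_sq_real, one_mul]

/-- A sign change as a linear isometry: the form in which it commutes with differentiation and with
radial cutoffs. -/
def signIsometry (s : Fin n → ℤˣ) : Phase n ≃ₗᵢ[ℝ] Phase n where
  toFun := signAct s
  invFun := signAct s
  left_inv := signAct_signAct s
  right_inv := signAct_signAct s
  map_add' x y := by ext k; simp [signAct_apply, mul_add]
  map_smul' c x := by ext k; simp [signAct_apply]; ring
  norm_map' x := by
    simp [EuclideanSpace.norm_eq, signAct_apply, mul_pow, intUnit_sq_real]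

/-- The element of `ℤ₂ⁿ` that reflects in the coordinate hyperplane `x l = 0`. -/
def flipSign (l : Fin n) : Fin n → ℤˣ := Function.update 1 l (-1)

theorem signAct_flipSign_self (l : Fin n) (x : Phase n) : signAct (flipSign l) x l = -x l := by
  simp [flipSign, signAct_apply]

theorem signAct_flipSign_of_ne {l k : Fin n} (h : k ≠ l) (x : Phase n) :
    signAct (flipSign l) x k = x k := by
  simp [flipSign, signAct_apply, h]

theorem signAct_flipSign_eq_self_iff {l : Fin n} {x : Phase n} :
    signAct (flipSign l) x = x ↔ x l = 0 := by
  constructor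
  · intro h
    have := congrArg (fun y : Phase n => y l) h
    simp only [signAct_flipSign_self] at this
    linarith
  · intro h
    ext k
    by_cases hk : k = l
    · subst hk; rw [signAct_flipSign_self, h, neg_zero]
    · exact signAct_flipSign_of_ne hk x

theorem IsZ2Equivariant.apply_eq_zero {f : Phase n → Phase n} (hf : IsZ2Equivariant f)
    {x : Phase n} {l : Fin n} (h : x l = 0) : f x l = 0 := by
  rw [← signAct_flipSign_eq_self_iff] at h ⊢
  rw [← hf, h]

/-- The vectors supported in `I`: the fixed point spaces of the subgroups of `ℤ₂ⁿ`. -/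
def coordSubspace (I : Finset (Fin n)) : Set (Phase n) := {x | ∀ l ∉ I, x l = 0}

theorem isClosed_coordSubspace (I : Finset (Fin n)) : IsClosed (coordSubspace I) := by
  have : coordSubspace I = ⋂ l, ⋂ (_ : l ∉ I), {x : Phase n | x l = 0} := by
    ext x; simp [coordSubspace]
  rw [this]
  exact isClosed_iInter fun l => isClosed_iInter fun _ =>
    isClosed_eq (EuclideanSpace.proj (𝕜 := ℝ) l).continuous continuous_const

end SignChanges

/-! ### The flow near a compact invariant set -/

section FlowBasics

variable {α : Type*} [TopologicalSpace α] (φ : Flow ℝ α)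

theorem flow_neg_apply_apply (t : ℝ) (x : α) : φ (-t) (φ t x) = x := by
  rw [← φ.map_add, neg_add_cancel, φ.map_zero_apply]

theorem orbit_flow_apply (t : ℝ) (x : α) : φ.orbit (φ t x) = φ.orbit x := by
  refine Subset.antisymm ?_ ?_
  · rintro _ ⟨s, rfl⟩
    exact ⟨s + t, φ.map_add s t x⟩
  · intro y hy
    obtain ⟨s, rfl⟩ := φ.mem_orbit_iff.1 hy
    exact φ.mem_orbit_iff.2 ⟨s - t, by rw [← φ.map_add, sub_add_cancel]⟩

variable {φ}

theorem tendsto_flow_apply_atBot {x a : α} (h : Tendsto (fun t => φ t x) atBot (𝓝 a)) (s : ℝ) :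
    Tendsto (fun t => φ t (φ s x)) atBot (𝓝 a) := by
  simp_rw [← φ.map_add]
  exact h.comp (tendsto_atBot_add_const_right _ s tendsto_id)

theorem tendsto_flow_apply_atTop {x a : α} (h : Tendsto (fun t => φ t x) atTop (𝓝 a)) (s : ℝ) :
    Tendsto (fun t => φ t (φ s x)) atTop (𝓝 a) := by
  simp_rw [← φ.map_add]
  exact h.comp (tendsto_atTop_add_const_right _ s tendsto_id)

end FlowBasics

section SymmetricFlow

variable {n : ℕ} {φ : Flow ℝ (Phase n)}

theorem flow_apply_coord_eq_zero_iff (hφ : ∀ t, IsZ2Equivariant (φ t)) (t : ℝ) (x : Phase n)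
    (l : Fin n) : φ t x l = 0 ↔ x l = 0 := by
  refine ⟨fun h => ?_, (hφ t).apply_eq_zero⟩
  have := (hφ (-t)).apply_eq_zero h
  rwa [flow_neg_apply_apply] at this

theorem flow_apply_mem_coordSubspace_iff (hφ : ∀ t, IsZ2Equivariant (φ t)) {t : ℝ} {x : Phase n}
    {I : Finset (Fin n)} : φ t x ∈ coordSubspace I ↔ x ∈ coordSubspace I := by
  simp only [coordSubspace, mem_ofPred_eq, flow_apply_coord_eq_zero_iff hφ]

end SymmetricFlow

theorem setOf_mapClusterPt_eq_singleton {α β : Type*} [TopologicalSpace α] [T2Space α]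
    {l : Filter β} [l.NeBot] {γ : β → α} {a : α} (h : Tendsto γ l (𝓝 a)) :
    {y | MapClusterPt y l γ} = {a} := by
  ext y
  refine ⟨fun hy => ?_, ?_⟩
  · have : ClusterPt y (𝓝 a) := ClusterPt.mono hy h
    exact eq_of_nhds_neBot this
  · rintro rfl
    exact h.mapClusterPt

theorem eqOn_Icc_of_isIntegralCurveOn_of_contDiff {E : Type*} [NormedAddCommGroup E]
    [NormedSpace ℝ E] [ProperSpace E] {f : E → E} (hf : ContDiff ℝ 1 f)
    {γ δ : ℝ → E} {a b : ℝ} (hγ : IsIntegralCurveOn γ (fun _ => f) (Icc a b))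
    (hδ : IsIntegralCurveOn δ (fun _ => f) (Icc a b)) (h : γ a = δ a ∨ γ b = δ b) :
    EqOn γ δ (Icc a b) := by
  obtain ⟨R, hR⟩ := ((isCompact_Icc.image_of_continuousOn hγ.continuousOn).union
    (isCompact_Icc.image_of_continuousOn hδ.continuousOn)).isBounded.subset_closedBall 0
  have hγR : ∀ t ∈ Icc a b, γ t ∈ Metric.closedBall 0 R :=
    fun t ht => hR (Or.inl (mem_image_of_mem _ ht))
  have hδR : ∀ t ∈ Icc a b, δ t ∈ Metric.closedBall 0 R :=
    fun t ht => hR (Or.inr (mem_image_of_mem _ ht))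
  obtain ⟨K, hK⟩ := (hf.contDiffOn (s := Metric.closedBall (0 : E) R)).exists_lipschitzOnWith
    one_ne_zero (convex_closedBall _ _) (isCompact_closedBall _ _)
  have right_deriv : ∀ {η : ℝ → E}, IsIntegralCurveOn η (fun _ => f) (Icc a b) → ∀ t ∈ Ico a b,
      HasDerivWithinAt η (f (η t)) (Ici t) t := fun hη t ht =>
    (hη t (Ico_subset_Icc_self ht)).mono_of_mem_nhdsWithin (Icc_mem_nhdsGE_of_mem ht)
  have left_deriv : ∀ {η : ℝ → E}, IsIntegralCurveOn η (fun _ => f) (Icc a b) → ∀ t ∈ Ioc a b,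
      HasDerivWithinAt η (f (η t)) (Iic t) t := fun hη t ht =>
    (hη t (Ioc_subset_Icc_self ht)).mono_of_mem_nhdsWithin (Icc_mem_nhdsLE_of_mem ht)
  rcases h with h | h
  · exact ODE_solution_unique_of_mem_Icc_right (v := fun _ => f)
      (s := fun _ => Metric.closedBall 0 R) (fun _ _ => hK)
      hγ.continuousOn (right_deriv hγ) (fun t ht => hγR t (Ico_subset_Icc_self ht))
      hδ.continuousOn (right_deriv hδ) (fun t ht => hδR t (Ico_subset_Icc_self ht)) h
  · exact ODE_solution_unique_of_mem_Icc_left (v := fun _ => f)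
      (s := fun _ => Metric.closedBall 0 R) (fun _ _ => hK)
      hγ.continuousOn (left_deriv hγ) (fun t ht => hγR t (Ioc_subset_Icc_self ht))
      hδ.continuousOn (left_deriv hδ) (fun t ht => hδR t (Ioc_subset_Icc_self ht)) h

/-- A complete flow with the symmetries of `f` that follows `f` on an open neighbourhood `dom` of
the invariant set `Y`. The flow of `f` itself need not be complete; a cutoff away from `Y` provides
this substitute. -/
structure NetworkFlow {n : ℕ} (f : Phase n → Phase n) (Y : Set (Phase n)) where
  φ : Flow ℝ (Phase n)
  dom : Set (Phase n)
  isOpen_dom : IsOpen dom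
  subset_dom : Y ⊆ dom
  hasDerivAt : ∀ x t, φ t x ∈ dom → HasDerivAt (fun s => φ s x) (f (φ t x)) t
  equivariant : ∀ t, IsZ2Equivariant (φ t)
  invariant : ∀ x ∈ Y, ∀ t, φ t x ∈ Y

theorem nonempty_networkFlow {n : ℕ} {f : Phase n → Phase n} {Y : Set (Phase n)}
    (hf : ContDiff ℝ 1 f) (hfs : IsZ2Equivariant f) (hb : Bornology.IsBounded Y)
    (hinv : IsFlowInvariantSet f Y) : Nonempty (NetworkFlow f Y) := by
  obtain ⟨R, hR⟩ := hb.subset_ball 0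
  obtain ⟨g, K, M, hK, hM, hgf, hgs⟩ := exists_lipschitzWith_eqOn_ball_of_contDiff hf R
  obtain ⟨φ, hφ⟩ := exists_flow_of_lipschitzWith hK hM
  have flow_eq : ∀ {γ : ℝ → Phase n}, IsIntegralCurve γ (fun _ => g) → ∀ t, φ t (γ 0) = γ t :=
    fun hγ t => congrFun (eq_of_isIntegralCurve_of_lipschitzWith hK (hφ _) hγ
      (φ.map_zero_apply _)) t
  refine ⟨⟨φ, Metric.ball 0 R, Metric.isOpen_ball, hR, fun x t hx => ?_, fun t s x => ?_,
    fun x hx t => ?_⟩⟩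
  · rw [← hgf hx]; exact hφ x t
  · have hs : IsIntegralCurve (fun r => signAct s (φ r x)) fun _ => g := fun r => by
      have hg : g (signAct s (φ r x)) = signAct s (g (φ r x)) :=
        hgs (signIsometry s).toLinearIsometry (hfs s) _
      change HasDerivAt _ (g (signAct s (φ r x))) r
      rw [hg]
      exact (signIsometry s).toContinuousLinearEquiv.hasFDerivAt.comp_hasDerivAt r (hφ x r)
    simpa only [φ.map_zero_apply] using flow_eq hs t
  · obtain ⟨γ, hγ, rfl, hγY⟩ := hinv x hx
    have hγg : IsIntegralCurve γ fun _ => g := fun r => by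
      simpa only [hgf (hR (hγY r))] using isIntegralCurveOn_univ.1 hγ r
    rw [flow_eq hγg t]
    exact hγY t

namespace NetworkFlow

variable {n : ℕ} {f : Phase n → Phase n} {Y : Set (Phase n)} (F : NetworkFlow f Y)

theorem map_mem_dom {x : Phase n} (hx : x ∈ Y) (t : ℝ) : F.φ t x ∈ F.dom :=
  F.subset_dom (F.invariant x hx t)

theorem isSolutionOn {x : Phase n} {I : Set ℝ} (h : ∀ t ∈ I, F.φ t x ∈ F.dom) :
    IsSolutionOn f (fun t => F.φ t x) I :=
  fun t ht => (F.hasDerivAt x t (h t ht)).hasDerivWithinAt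

theorem eq_of_isSolutionOn_Iic (hf : ContDiff ℝ 1 f) {γ : ℝ → Phase n}
    (hγ : IsSolutionOn f γ (Iic 0)) (h0 : γ 0 ∈ Y) {t : ℝ} (ht : t ≤ 0) : γ t = F.φ t (γ 0) :=
  eqOn_Icc_of_isIntegralCurveOn_of_contDiff hf (hγ.mono Icc_subset_Iic_self)
    (F.isSolutionOn fun s _ => F.map_mem_dom h0 s) (Or.inr (F.φ.map_zero_apply _).symm)
    (left_mem_Icc.2 ht)

theorem eq_of_isSolutionOn_Ici (hf : ContDiff ℝ 1 f) {γ : ℝ → Phase n}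
    (hγ : IsSolutionOn f γ (Ici 0)) (h0 : γ 0 ∈ Y) {t : ℝ} (ht : 0 ≤ t) : γ t = F.φ t (γ 0) :=
  eqOn_Icc_of_isIntegralCurveOn_of_contDiff hf (hγ.mono Icc_subset_Ici_self)
    (F.isSolutionOn fun s _ => F.map_mem_dom h0 s) (Or.inl (F.φ.map_zero_apply _).symm)
    (right_mem_Icc.2 ht)

theorem eq_of_isSolutionOn_univ (hf : ContDiff ℝ 1 f) {γ : ℝ → Phase n}
    (hγ : IsSolutionOn f γ univ) (h0 : γ 0 ∈ Y) (t : ℝ) : γ t = F.φ t (γ 0) := by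
  rcases le_total t 0 with ht | ht
  · exact F.eq_of_isSolutionOn_Iic hf (hγ.mono (subset_univ _)) h0 ht
  · exact F.eq_of_isSolutionOn_Ici hf (hγ.mono (subset_univ _)) h0 ht

theorem map_equilibrium (hf : ContDiff ℝ 1 f) {p : Phase n} (hp : p ∈ equilibriaIn f Y) (t : ℝ) :
    F.φ t p = p :=
  have hconst : IsSolutionOn f (fun _ => p) univ := fun t _ => by
    simpa only [hp.2] using hasDerivWithinAt_const t univ p
  (F.eq_of_isSolutionOn_univ hf hconst hp.1 t).symm

theorem trajectory_eq_orbit (hf : ContDiff ℝ 1 f) {x : Phase n} (hx : x ∈ Y) :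
    trajectory f x = F.φ.orbit x := by
  ext y
  constructor
  · rintro ⟨γ, hγ, rfl, t, rfl⟩
    exact ⟨t, (F.eq_of_isSolutionOn_univ hf hγ hx t).symm⟩
  · intro hy
    exact ⟨_, F.isSolutionOn fun s _ => F.map_mem_dom hx s, F.φ.map_zero_apply x, hy⟩

theorem tendsto_atBot_of_mem_unstableSet (hf : ContDiff ℝ 1 f) (hY : IsCompact Y)
    {x a : Phase n} (hx : x ∈ Y) (h : x ∈ unstableSet f {a}) :
    Tendsto (fun t => F.φ t x) atBot (𝓝 a) := by
  obtain ⟨-, γ, hγ, rfl, -, hα⟩ := h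
  have hγφ : γ =ᶠ[atBot] fun t => F.φ t (γ 0) := by
    filter_upwards [eventually_le_atBot 0] with t ht using F.eq_of_isSolutionOn_Iic hf hγ hx ht
  refine (hY.tendsto_nhds_of_unique_mapClusterPt ?_ fun y _ hy => hα hy).congr' hγφ
  filter_upwards [hγφ] with t ht using ht ▸ F.invariant _ hx t

theorem tendsto_atTop_of_mem_stableSet (hf : ContDiff ℝ 1 f) (hY : IsCompact Y)
    {x a : Phase n} (hx : x ∈ Y) (h : x ∈ stableSet f {a}) :
    Tendsto (fun t => F.φ t x) atTop (𝓝 a) := by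
  obtain ⟨-, γ, hγ, rfl, -, hω⟩ := h
  have hγφ : γ =ᶠ[atTop] fun t => F.φ t (γ 0) := by
    filter_upwards [eventually_ge_atTop 0] with t ht using F.eq_of_isSolutionOn_Ici hf hγ hx ht
  refine (hY.tendsto_nhds_of_unique_mapClusterPt ?_ fun y _ hy => hω hy).congr' hγφ
  filter_upwards [hγφ] with t ht using ht ▸ F.invariant _ hx t

theorem mem_unstableSet_of_tendsto {x a : Phase n} (hx : x ∈ orthant n)
    (hd : ∀ t ≤ 0, F.φ t x ∈ F.dom) (h : Tendsto (fun t => F.φ t x) atBot (𝓝 a)) :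
    x ∈ unstableSet f {a} := by
  have hα : alphaLimit (fun t => F.φ t x) = {a} := setOf_mapClusterPt_eq_singleton h
  exact ⟨hx, _, F.isSolutionOn hd, F.φ.map_zero_apply x, hα ▸ singleton_nonempty a, hα.subset⟩

theorem mem_stableSet_of_tendsto {x a : Phase n} (hx : x ∈ orthant n)
    (hd : ∀ t ≥ 0, F.φ t x ∈ F.dom) (h : Tendsto (fun t => F.φ t x) atTop (𝓝 a)) :
    x ∈ stableSet f {a} := by
  have hω : omegaLimitSet (fun t => F.φ t x) = {a} := setOf_mapClusterPt_eq_singleton h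
  exact ⟨hx, _, F.isSolutionOn hd, F.φ.map_zero_apply x, hω ▸ singleton_nonempty a, hω.subset⟩

theorem mem_connection_iff (hf : ContDiff ℝ 1 f) (hY : IsCompact Y) (hor : Y ⊆ orthant n)
    {x a b : Phase n} (hx : x ∈ Y) :
    x ∈ connection f a b ↔ Tendsto (fun t => F.φ t x) atBot (𝓝 a) ∧
      Tendsto (fun t => F.φ t x) atTop (𝓝 b) :=
  ⟨fun h => ⟨F.tendsto_atBot_of_mem_unstableSet hf hY hx h.1,
      F.tendsto_atTop_of_mem_stableSet hf hY hx h.2⟩,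
    fun h => ⟨F.mem_unstableSet_of_tendsto (hor hx) (fun t _ => F.map_mem_dom hx t) h.1,
      F.mem_stableSet_of_tendsto (hor hx) (fun t _ => F.map_mem_dom hx t) h.2⟩⟩

end NetworkFlow

/-! ### Linearisation at an equilibrium on a coordinate axis -/

section Linearisation

variable {n : ℕ} {f : Phase n → Phase n} {p : Phase n} {i : Fin n}

/-- The diagonal entries of the Jacobian; at points of a coordinate axis they are the eigenvalues,
by symmetry. -/
noncomputable def rate (f : Phase n → Phase n) (p : Phase n) (l : Fin n) : ℝ :=
  fderiv ℝ f p (EuclideanSpace.single l 1) l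

theorem fderiv_signAct (hfs : IsZ2Equivariant f) {s : Fin n → ℤˣ} (hp : signAct s p = p)
    (v : Phase n) : fderiv ℝ f p (signAct s v) = signAct s (fderiv ℝ f p v) := by
  set S := (signIsometry s).toContinuousLinearEquiv
  have hcomm : f ∘ S = S ∘ f := funext (hfs s)
  have hder := S.comp_right_fderiv (f := f) (x := p)
  rw [hcomm, S.comp_fderiv, show S p = p from hp] at hder
  exact (DFunLike.congr_fun hder v).symm

theorem fderiv_single_apply_of_ne (hfs : IsZ2Equivariant f) (hp : p ∈ coordAxis i) {l m : Fin n}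
    (hml : m ≠ l) : fderiv ℝ f p (EuclideanSpace.single m 1) l = 0 := by
  have hflip : ∀ k ≠ i, ∀ v,
      fderiv ℝ f p (signAct (flipSign k) v) = signAct (flipSign k) (fderiv ℝ f p v) :=
    fun k hk v => fderiv_signAct hfs (signAct_flipSign_eq_self_iff.2 (hp k hk)) v
  by_cases hl : l = i
  · have hneg : signAct (flipSign m) (EuclideanSpace.single m (1 : ℝ)) =
        -EuclideanSpace.single m (1 : ℝ) := by
      ext k
      by_cases hk : k = m
      · subst hk; rw [signAct_flipSign_self]; rfl
      · rw [signAct_flipSign_of_ne hk]; simp [hk]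
    have := congrArg (fun y : Phase n => y l)
      (hflip m (fun h => hml (h.trans hl.symm)) (EuclideanSpace.single m 1))
    simp only [hneg, map_neg, signAct_flipSign_of_ne hml.symm, PiLp.neg_apply] at this
    linarith
  · have hfix : signAct (flipSign l) (EuclideanSpace.single m (1 : ℝ)) =
        EuclideanSpace.single m (1 : ℝ) := by
      rw [signAct_flipSign_eq_self_iff]; simp [hml.symm]
    have := congrArg (fun y : Phase n => y l) (hflip l hl (EuclideanSpace.single m 1))
    simp only [hfix, signAct_flipSign_self] at this
    linarith

theorem fderiv_apply_eq_rate_mul (hfs : IsZ2Equivariant f) (hp : p ∈ coordAxis i) (v : Phase n)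
    (l : Fin n) : fderiv ℝ f p v l = rate f p l * v l := by
  have hv : v = ∑ m, v m • EuclideanSpace.single m (1 : ℝ) := by
    ext k
    simp [Finset.sum_apply, Pi.single_apply]
  conv_lhs => rw [hv, map_sum]
  simp only [map_smul, WithLp.ofLp_sum, Finset.sum_apply, PiLp.smul_apply, smul_eq_mul]
  rw [Finset.sum_eq_single l
    (fun m _ hm => by rw [fderiv_single_apply_of_ne hfs hp hm, mul_zero]) (by simp), rate, mul_comm]

theorem complexEigenvalues_jacobian (hfs : IsZ2Equivariant f) (hp : p ∈ coordAxis i) :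
    complexEigenvalues (jacobian f p) = Finset.univ.val.map fun l => ((rate f p l : ℝ) : ℂ) := by
  set b := (EuclideanSpace.basisFun (Fin n) ℝ).toBasis with hb
  have hmat : LinearMap.toMatrix b b (jacobian f p) = Matrix.diagonal (rate f p) := by
    ext k l
    rw [LinearMap.toMatrix_apply]
    simp only [hb, OrthonormalBasis.coe_toBasis, EuclideanSpace.basisFun_apply,
      OrthonormalBasis.coe_toBasis_repr_apply, EuclideanSpace.basisFun_repr, jacobian,
      ContinuousLinearMap.coe_coe]
    rw [fderiv_apply_eq_rate_mul hfs hp]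
    by_cases hkl : k = l
    · subst hkl; simp
    · simp [hkl]
  rw [complexEigenvalues, ← LinearMap.charpoly_toMatrix _ b, hmat, Matrix.charpoly_diagonal,
    Polynomial.aroots_def, Polynomial.map_prod]
  simp only [Polynomial.map_sub, Polynomial.map_X, Polynomial.map_C]
  have := Polynomial.roots_multiset_prod_X_sub_C
    (Finset.univ.val.map fun l => ((rate f p l : ℝ) : ℂ))
  rwa [Multiset.map_map] at this

theorem rate_ne_zero (hfs : IsZ2Equivariant f) (hp : p ∈ coordAxis i)
    (hh : IsHyperbolicEquilibrium f p) (l : Fin n) : rate f p l ≠ 0 := by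
  have := hh.2 (rate f p l) (by rw [complexEigenvalues_jacobian hfs hp]; simp)
  simpa using this

/-- The unstable coordinate directions of an equilibrium on a coordinate axis. -/
noncomputable def unstableIdx (f : Phase n → Phase n) (p : Phase n) : Finset (Fin n) :=
  Finset.univ.filter fun l => 0 < rate f p l

theorem mem_unstableIdx {l : Fin n} : l ∈ unstableIdx f p ↔ 0 < rate f p l := by
  simp [unstableIdx]

theorem card_unstableIdx (hfs : IsZ2Equivariant f) (hp : p ∈ coordAxis i) :
    (unstableIdx f p).card = unstableDim f p := by
  rw [unstableDim, complexEigenvalues_jacobian hfs hp, Multiset.filter_map, Multiset.card_map]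
  simp only [Function.comp_def, Complex.ofReal_re]
  rw [unstableIdx, Finset.card_def, Finset.filter_val]

theorem mem_complexEigenvalues_of_hasEigenvector {V : Type*} [AddCommGroup V] [Module ℝ V]
    [Module.Finite ℝ V] {T : V →ₗ[ℝ] V} {c : ℝ} {v : V} (h : Module.End.HasEigenvector T c v) :
    (c : ℂ) ∈ complexEigenvalues T := by
  have hroot := (Module.End.hasEigenvalue_iff_isRoot_charpoly _ _).1
    (Module.End.hasEigenvalue_of_hasEigenvector h)
  rw [complexEigenvalues, Polynomial.mem_aroots]
  refine ⟨(LinearMap.charpoly_monic _).ne_zero, ?_⟩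
  rw [show (c : ℂ) = algebraMap ℝ ℂ c from rfl,
    Polynomial.aeval_algebraMap_apply, Polynomial.coe_aeval_eq_eval, hroot.eq_zero, map_zero]

theorem rate_neg_of_isSinkIn (hfs : IsZ2Equivariant f) (hp : p ∈ coordAxis i)
    {P : Submodule ℝ (Phase n)} (hP : IsSinkIn f P p) {l : Fin n}
    (hl : EuclideanSpace.single l (1 : ℝ) ∈ P) : rate f p l < 0 := by
  obtain ⟨-, h, hneg⟩ := hP
  set v : P := ⟨EuclideanSpace.single l 1, hl⟩ with hv
  have hev : Module.End.HasEigenvector ((jacobian f p).restrict h) (rate f p l) v := by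
    rw [Module.End.hasEigenvector_iff, Module.End.mem_eigenspace_iff]
    refine ⟨Subtype.ext (PiLp.ext fun k => ?_), fun h0 => ?_⟩
    · change fderiv ℝ f p (EuclideanSpace.single l 1) k =
        (rate f p l • EuclideanSpace.single l (1 : ℝ) : Phase n) k
      rw [fderiv_apply_eq_rate_mul hfs hp]
      by_cases hk : k = l
      · subst hk; simp
      · simp [hk]
    · have := congrArg (fun y : P => (y : Phase n) l) h0
      simp [hv] at this
  simpa using hneg _ (mem_complexEigenvalues_of_hasEigenvector hev)

end Linearisation

/-! ### Cone estimates near a hyperbolic equilibrium -/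

section QuadraticForms

variable {ι : Type*}

/-- The part of the Euclidean inner product that comes from the coordinates in `I`. -/
def innerOn (I : Finset ι) (v w : EuclideanSpace ℝ ι) : ℝ := ∑ l ∈ I, v l * w l

/-- The squared length of the projection to the coordinates in `I`. -/
def sqSum (I : Finset ι) (v : EuclideanSpace ℝ ι) : ℝ := ∑ l ∈ I, v l ^ 2

theorem sqSum_nonneg (I : Finset ι) (v : EuclideanSpace ℝ ι) : 0 ≤ sqSum I v :=
  Finset.sum_nonneg fun _ _ => sq_nonneg _

theorem sqSum_eq_zero_of_forall {I : Finset ι} {v : EuclideanSpace ℝ ι} (h : ∀ l ∈ I, v l = 0) :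
    sqSum I v = 0 :=
  Finset.sum_eq_zero fun l hl => by rw [h l hl, zero_pow two_ne_zero]

theorem continuous_sqSum (I : Finset ι) : Continuous (sqSum I) := by
  unfold sqSum
  fun_prop

theorem innerOn_neg_right (I : Finset ι) (v w : EuclideanSpace ℝ ι) :
    innerOn I v (-w) = -innerOn I v w := by
  simp only [innerOn, PiLp.neg_apply, mul_neg, Finset.sum_neg_distrib]

theorem sqSum_pair [DecidableEq ι] {j k : ι} (hjk : j ≠ k) (v : EuclideanSpace ℝ ι) :
    sqSum {j, k} v = v j ^ 2 + v k ^ 2 := Finset.sum_pair hjk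

variable [Fintype ι]

theorem sqSum_univ (v : EuclideanSpace ℝ ι) : sqSum Finset.univ v = ‖v‖ ^ 2 :=
  (EuclideanSpace.real_norm_sq_eq v).symm

theorem sqSum_le_norm_sq (I : Finset ι) (v : EuclideanSpace ℝ ι) : sqSum I v ≤ ‖v‖ ^ 2 := by
  rw [← sqSum_univ]
  exact Finset.sum_le_sum_of_subset_of_nonneg (Finset.subset_univ _) fun _ _ _ => sq_nonneg _

theorem neg_norm_mul_norm_le_innerOn (I : Finset ι) (v w : EuclideanSpace ℝ ι) :
    -(‖v‖ * ‖w‖) ≤ innerOn I v w := by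
  refine (abs_le_of_sq_le_sq' ?_ (by positivity)).1
  calc innerOn I v w ^ 2 ≤ sqSum I v * sqSum I w := Finset.sum_mul_sq_le_sq_mul_sq _ _ _
    _ ≤ ‖v‖ ^ 2 * ‖w‖ ^ 2 :=
      mul_le_mul (sqSum_le_norm_sq I v) (sqSum_le_norm_sq I w) (sqSum_nonneg I w) (sq_nonneg _)
    _ = (‖v‖ * ‖w‖) ^ 2 := (mul_pow _ _ _).symm

theorem le_innerOn_of_eq_mul_add {I : Finset ι} {c : ι → ℝ} {m : ℝ} {v w r : EuclideanSpace ℝ ι}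
    (hc : ∀ l ∈ I, m ≤ c l) (hw : ∀ l ∈ I, w l = c l * v l + r l) :
    m * sqSum I v - ‖v‖ * ‖r‖ ≤ innerOn I v w := by
  have hsplit : innerOn I v w = ∑ l ∈ I, c l * v l ^ 2 + innerOn I v r := by
    rw [innerOn, innerOn, ← Finset.sum_add_distrib]
    exact Finset.sum_congr rfl fun l hl => by rw [hw l hl]; ring
  have hdiag : m * sqSum I v ≤ ∑ l ∈ I, c l * v l ^ 2 := by
    rw [sqSum, Finset.mul_sum]
    exact Finset.sum_le_sum fun l hl => mul_le_mul_of_nonneg_right (hc l hl) (sq_nonneg _)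
  linarith [neg_norm_mul_norm_le_innerOn I v r]

theorem hasDerivAt_sqSum {z : ℝ → EuclideanSpace ℝ ι} {z' : EuclideanSpace ℝ ι} {t : ℝ}
    (h : HasDerivAt z z' t) (I : Finset ι) :
    HasDerivAt (fun s => sqSum I (z s)) (2 * innerOn I (z t) z') t := by
  rw [innerOn, Finset.mul_sum]
  refine HasDerivAt.fun_sum fun l _ => ?_
  refine (((EuclideanSpace.proj (𝕜 := ℝ) l).hasFDerivAt.comp_hasDerivAt t h).fun_pow 2).congr_deriv
    ?_
  change (2 : ℕ) * z t l ^ 1 * z' l = 2 * (z t l * z' l)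
  push_cast
  ring

variable [DecidableEq ι]

theorem sqSum_add_sqSum_compl (I : Finset ι) (v : EuclideanSpace ℝ ι) :
    sqSum I v + sqSum Iᶜ v = ‖v‖ ^ 2 := by
  rw [← sqSum_univ]
  exact Finset.sum_add_sum_compl I _

/-- The indefinite form `|v_I|² - |v_{Iᶜ}|²`. -/
def coneForm (I : Finset ι) (v : EuclideanSpace ℝ ι) : ℝ := sqSum I v - sqSum Iᶜ v

theorem neg_norm_sq_le_coneForm (I : Finset ι) (v : EuclideanSpace ℝ ι) :
    -‖v‖ ^ 2 ≤ coneForm I v := by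
  rw [coneForm]
  linarith [sqSum_nonneg I v, sqSum_le_norm_sq Iᶜ v]

theorem norm_sq_le_of_coneForm_nonneg {I : Finset ι} {v : EuclideanSpace ℝ ι}
    (h : 0 ≤ coneForm I v) : ‖v‖ ^ 2 ≤ 2 * sqSum I v := by
  rw [coneForm] at h
  linarith [sqSum_add_sqSum_compl I v]

theorem continuous_coneForm (I : Finset ι) : Continuous (coneForm I) :=
  (continuous_sqSum I).sub (continuous_sqSum Iᶜ)

end QuadraticForms

theorem monotoneOn_exp_mul {D : Set ℝ} (hD : Convex ℝ D) {q q' : ℝ → ℝ} {c : ℝ}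
    (hq : ∀ t ∈ D, HasDerivAt q (q' t) t) (h : ∀ t ∈ D, 0 ≤ c * q t + q' t) :
    MonotoneOn (fun t => Real.exp (c * t) * q t) D := by
  have hder : ∀ t ∈ D, HasDerivAt (fun t => Real.exp (c * t) * q t)
      (Real.exp (c * t) * (c * q t + q' t)) t := fun t ht => by
    refine ((((hasDerivAt_id' t).const_mul c).exp).mul (hq t ht)).congr_deriv ?_
    ring
  exact monotoneOn_of_hasDerivWithinAt_nonneg hD
    (fun t ht => (hder t ht).continuousAt.continuousWithinAt)
    (fun t ht => (hder t (interior_subset ht)).hasDerivWithinAt)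
    fun t ht => mul_nonneg (Real.exp_pos _).le (h t (interior_subset ht))

section LocalUnstableSet

variable {α : Type*} [PseudoMetricSpace α] {φ : Flow ℝ α} {p x : α} {ρ : ℝ}

/-- The points whose backward orbits stay in a closed ball around `p`. -/
def localUnstableSet (φ : Flow ℝ α) (p : α) (ρ : ℝ) : Set α :=
  {x | ∀ t ≤ 0, φ t x ∈ Metric.closedBall p ρ}

theorem localUnstableSet_subset_closedBall : localUnstableSet φ p ρ ⊆ Metric.closedBall p ρ :=
  fun x hx => by simpa only [φ.map_zero_apply] using hx 0 le_rfl

theorem flow_apply_mem_localUnstableSet (hx : x ∈ localUnstableSet φ p ρ) {s : ℝ} (hs : s ≤ 0) :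
    φ s x ∈ localUnstableSet φ p ρ := fun t ht => by
  rw [← φ.map_add]
  exact hx _ (add_nonpos ht hs)

theorem exists_forall_flow_apply_mem_localUnstableSet (hρ : 0 < ρ)
    (hx : Tendsto (fun t => φ t x) atBot (𝓝 p)) :
    ∃ T ≤ 0, ∀ t ≤ T, φ t x ∈ localUnstableSet φ p ρ := by
  obtain ⟨T, hT⟩ := eventually_atBot.1 (hx.eventually (Metric.closedBall_mem_nhds p hρ))
  refine ⟨min T 0, min_le_right _ _, fun t ht s hs => ?_⟩
  rw [← φ.map_add]
  exact hT _ (by linarith [min_le_left T 0])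

end LocalUnstableSet

section HyperbolicBall

variable {n : ℕ} {f : Phase n → Phase n} {φ : Flow ℝ (Phase n)} {U : Finset (Fin n)}
  {p : Phase n} {ρ μ : ℝ}

/-- A closed ball around a fixed point in which `f`, the generator of the flow there, is close to a
hyperbolic linear field that expands the directions in `U` and contracts the others: the form
`coneForm U` grows along differences of solutions (`cone`), and the component in the directions
`U` grows inside the cone `0 ≤ coneForm U` (`expand`). -/
structure IsHyperbolicBall (φ : Flow ℝ (Phase n)) (f : Phase n → Phase n) (U : Finset (Fin n))
    (p : Phase n) (ρ μ : ℝ) : Prop where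
  radius_pos : 0 < ρ
  rate_pos : 0 < μ
  fixed : ∀ t, φ t p = p
  hasDerivAt : ∀ x t, φ t x ∈ Metric.closedBall p ρ →
    HasDerivAt (fun s => φ s x) (f (φ t x)) t
  cone : ∀ x ∈ Metric.closedBall p ρ, ∀ y ∈ Metric.closedBall p ρ,
    μ * ‖x - y‖ ^ 2 ≤ innerOn U (x - y) (f x - f y) - innerOn Uᶜ (x - y) (f x - f y)
  expand : ∀ x ∈ Metric.closedBall p ρ, 0 ≤ coneForm U (x - p) →
    μ * sqSum U (x - p) ≤ 2 * innerOn U (x - p) (f x - f p)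

theorem exists_pos_forall_le_abs_rate {i : Fin n} (hfs : IsZ2Equivariant f) (hpi : p ∈ coordAxis i)
    (hh : IsHyperbolicEquilibrium f p) : ∃ m > 0, ∀ l, m ≤ |rate f p l| :=
  have : Nonempty (Fin n) := ⟨i⟩
  have ⟨l, hl⟩ := Finite.exists_min fun l => |rate f p l|
  ⟨_, abs_pos.2 (rate_ne_zero hfs hpi hh l), hl⟩

theorem exists_isHyperbolicBall {i : Fin n} {s : Set (Phase n)} (hf : ContDiffAt ℝ 1 f p)
    (hfs : IsZ2Equivariant f) (hpi : p ∈ coordAxis i) (hh : IsHyperbolicEquilibrium f p)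
    (hp : ∀ t, φ t p = p) (hs : s ∈ 𝓝 p)
    (hφ : ∀ x t, φ t x ∈ s → HasDerivAt (fun s => φ s x) (f (φ t x)) t) :
    ∃ ρ μ, IsHyperbolicBall φ f (unstableIdx f p) p ρ μ := by
  obtain ⟨m, hm0, hm⟩ := exists_pos_forall_le_abs_rate hfs hpi hh
  obtain ⟨V, hV, hfV⟩ := (hf.hasStrictFDerivAt one_ne_zero).approximates_deriv_on_nhds
    (c := ⟨m / 4, by positivity⟩) (Or.inr (show (0 : ℝ) < m / 4 by positivity))
  obtain ⟨ρ, hρ0, hρ⟩ := Metric.nhds_basis_closedBall.mem_iff.1 (inter_mem hV hs)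
  set U := unstableIdx f p
  have hU : ∀ l ∈ U, m ≤ rate f p l := fun l hl => by
    rw [← abs_of_pos (mem_unstableIdx.1 hl)]; exact hm l
  have hUc : ∀ l ∈ Uᶜ, m ≤ -rate f p l := fun l hl => by
    rw [Finset.mem_compl, mem_unstableIdx, not_lt] at hl
    rw [← abs_of_nonpos hl]; exact hm l
  set r : Phase n → Phase n → Phase n := fun x y => f x - f y - fderiv ℝ f p (x - y) with hr
  have hfr : ∀ x y l, (f x - f y) l = rate f p l * (x - y) l + r x y l := fun x y l => by
    rw [← fderiv_apply_eq_rate_mul hfs hpi, ← PiLp.add_apply, hr, add_sub_cancel]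
  have hr_le : ∀ x ∈ Metric.closedBall p ρ, ∀ y ∈ Metric.closedBall p ρ,
      ‖x - y‖ * ‖r x y‖ ≤ m / 4 * ‖x - y‖ ^ 2 := fun x hx y hy => by
    have := mul_le_mul_of_nonneg_left (hfV x (hρ hx).1 y (hρ hy).1) (norm_nonneg (x - y))
    calc _ ≤ ‖x - y‖ * (m / 4 * ‖x - y‖) := this
      _ = _ := by ring
  have hinner : ∀ x y,
      m * sqSum U (x - y) - ‖x - y‖ * ‖r x y‖ ≤ innerOn U (x - y) (f x - f y) := fun x y =>
    le_innerOn_of_eq_mul_add hU fun l _ => hfr x y l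
  refine ⟨ρ, m / 2, hρ0, by positivity, hp, fun x t hx => hφ x t (hρ hx).2,
    fun x hx y hy => ?_, fun x hx hcone => ?_⟩
  · have hinner_compl := le_innerOn_of_eq_mul_add (v := x - y) (w := -(f x - f y)) (r := -r x y)
      hUc fun l _ => by rw [PiLp.neg_apply, PiLp.neg_apply, hfr]; ring
    rw [innerOn_neg_right, norm_neg] at hinner_compl
    have hsum := congrArg (m * ·) (sqSum_add_sqSum_compl U (x - y))
    simp only [mul_add] at hsum
    linarith [hinner x y, hr_le x hx y hy]
  · have hnorm := mul_le_mul_of_nonneg_left (norm_sq_le_of_coneForm_nonneg hcone) hm0.le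
    have hpos := mul_nonneg hm0.le (sqSum_nonneg U (x - p))
    linarith [hinner x p, hr_le x hx p (Metric.mem_closedBall_self hρ0.le)]

namespace IsHyperbolicBall

theorem mono {ρ' : ℝ} (h : IsHyperbolicBall φ f U p ρ μ) (h0 : 0 < ρ') (hle : ρ' ≤ ρ) :
    IsHyperbolicBall φ f U p ρ' μ :=
  have hs := Metric.closedBall_subset_closedBall (x := p) hle
  ⟨h0, h.rate_pos, h.fixed, fun x t hx => h.hasDerivAt x t (hs hx),
    fun x hx y hy => h.cone x (hs hx) y (hs hy), fun x hx => h.expand x (hs hx)⟩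

theorem mem_localUnstableSet (h : IsHyperbolicBall φ f U p ρ μ) : p ∈ localUnstableSet φ p ρ :=
  fun t _ => by rw [h.fixed]; exact Metric.mem_closedBall_self h.radius_pos.le

theorem hasDerivAt_sqSum_map_sub (h : IsHyperbolicBall φ f U p ρ μ) {x y : Phase n} {t : ℝ}
    (hx : φ t x ∈ Metric.closedBall p ρ) (hy : φ t y ∈ Metric.closedBall p ρ)
    (I : Finset (Fin n)) :
    HasDerivAt (fun s => sqSum I (φ s x - φ s y))
      (2 * innerOn I (φ t x - φ t y) (f (φ t x) - f (φ t y))) t :=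
  hasDerivAt_sqSum ((h.hasDerivAt x t hx).sub (h.hasDerivAt y t hy)) I

theorem monotoneOn_exp_mul_coneForm (h : IsHyperbolicBall φ f U p ρ μ) {D : Set ℝ}
    (hD : Convex ℝ D) {x y : Phase n} (hx : ∀ t ∈ D, φ t x ∈ Metric.closedBall p ρ)
    (hy : ∀ t ∈ D, φ t y ∈ Metric.closedBall p ρ) {c : ℝ} (hc0 : 0 ≤ c) (hc : c ≤ μ) :
    MonotoneOn (fun t => Real.exp (c * t) * coneForm U (φ t x - φ t y)) D := by
  refine monotoneOn_exp_mul hD (fun t ht => (h.hasDerivAt_sqSum_map_sub (hx t ht) (hy t ht) U).sub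
    (h.hasDerivAt_sqSum_map_sub (hx t ht) (hy t ht) Uᶜ)) fun t ht => ?_
  have hform := mul_le_mul_of_nonneg_left (neg_norm_sq_le_coneForm U (φ t x - φ t y)) hc0
  have hrate := mul_le_mul_of_nonneg_right hc (sq_nonneg ‖φ t x - φ t y‖)
  have hcone := h.cone _ (hx t ht) _ (hy t ht)
  have hnonneg := mul_nonneg hc0 (sq_nonneg ‖φ t x - φ t y‖)
  linarith

theorem monotoneOn_coneForm (h : IsHyperbolicBall φ f U p ρ μ) {D : Set ℝ} (hD : Convex ℝ D)
    {x : Phase n} (hx : ∀ t ∈ D, φ t x ∈ Metric.closedBall p ρ) :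
    MonotoneOn (fun t => coneForm U (φ t x - p)) D := by
  have := h.monotoneOn_exp_mul_coneForm hD hx (y := p)
    (fun t _ => by rw [h.fixed]; exact Metric.mem_closedBall_self h.radius_pos.le) le_rfl
    h.rate_pos.le
  simpa only [zero_mul, Real.exp_zero, one_mul, h.fixed] using this

-- Along the backward orbits the form grows like `exp (-μ t)` in absolute value if it is negative.
theorem coneForm_sub_nonneg (h : IsHyperbolicBall φ f U p ρ μ) {x y : Phase n}
    (hx : x ∈ localUnstableSet φ p ρ) (hy : y ∈ localUnstableSet φ p ρ) :
    0 ≤ coneForm U (x - y) := by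
  have hmono := h.monotoneOn_exp_mul_coneForm (convex_Iic 0) hx hy h.rate_pos.le le_rfl
  have hbound : ∀ t ≤ 0, -(2 * ρ) ^ 2 ≤ coneForm U (φ t x - φ t y) := fun t ht => by
    have hxy : ‖φ t x - φ t y‖ ≤ 2 * ρ := by
      rw [← dist_eq_norm, two_mul]
      exact (dist_triangle_right _ _ p).trans (add_le_add (hx t ht) (hy t ht))
    linarith [neg_norm_sq_le_coneForm U (φ t x - φ t y),
      pow_le_pow_left₀ (norm_nonneg _) hxy 2]
  have hlim : Tendsto (fun t => Real.exp (μ * t) * -(2 * ρ) ^ 2) atBot (𝓝 0) := by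
    simpa using (Real.tendsto_exp_atBot.comp (tendsto_id.const_mul_atBot h.rate_pos)).mul_const
      (-(2 * ρ) ^ 2)
  refine le_of_tendsto hlim ?_
  filter_upwards [eventually_le_atBot 0] with t ht
  have h0 := hmono ht (mem_Iic.2 le_rfl) ht
  simp only [mul_zero, Real.exp_zero, one_mul, φ.map_zero_apply] at h0
  exact (mul_le_mul_of_nonneg_left (hbound t ht) (Real.exp_pos _).le).trans h0

theorem sqSum_map_sub_le (h : IsHyperbolicBall φ f U p ρ μ) {x : Phase n} {T : ℝ} (hT : T ≤ 0)
    (hx : ∀ t ∈ Icc T 0, φ t x ∈ Metric.closedBall p ρ)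
    (hcone : ∀ t ∈ Icc T 0, 0 ≤ coneForm U (φ t x - p)) :
    sqSum U (φ T x - p) ≤ Real.exp (μ * T) * sqSum U (x - p) := by
  have hmono : MonotoneOn (fun t => Real.exp (-μ * t) * sqSum U (φ t x - φ t p)) (Icc T 0) :=
    monotoneOn_exp_mul (convex_Icc T 0) (fun t ht => h.hasDerivAt_sqSum_map_sub (hx t ht)
      (h.mem_localUnstableSet t ht.2) U) fun t ht => by
        rw [h.fixed]
        linarith [h.expand _ (hx t ht) (hcone t ht)]
  have h0 := hmono (left_mem_Icc.2 hT) (right_mem_Icc.2 hT) hT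
  simp only [h.fixed, φ.map_zero_apply, mul_zero, Real.exp_zero, one_mul] at h0
  calc sqSum U (φ T x - p) = Real.exp (μ * T) * (Real.exp (-μ * T) * sqSum U (φ T x - p)) := by
        rw [← mul_assoc, ← Real.exp_add, neg_mul, add_neg_cancel, Real.exp_zero, one_mul]
    _ ≤ _ := mul_le_mul_of_nonneg_left h0 (Real.exp_pos _).le

theorem norm_sub_sq_le (h : IsHyperbolicBall φ f U p ρ μ) {x y : Phase n}
    (hx : x ∈ localUnstableSet φ p ρ) (hy : y ∈ localUnstableSet φ p ρ) :
    ‖x - y‖ ^ 2 ≤ 2 * sqSum U (x - y) :=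
  norm_sq_le_of_coneForm_nonneg (h.coneForm_sub_nonneg hx hy)

theorem eq_of_mem_localUnstableSet (h : IsHyperbolicBall φ f U p ρ μ) {x y : Phase n}
    (hx : x ∈ localUnstableSet φ p ρ) (hy : y ∈ localUnstableSet φ p ρ)
    (hxy : ∀ l ∈ U, x l = y l) : x = y := by
  have hnorm := h.norm_sub_sq_le hx hy
  rw [sqSum_eq_zero_of_forall fun l hl => by rw [PiLp.sub_apply, hxy l hl, sub_self],
    mul_zero] at hnorm
  exact sub_eq_zero.1 (norm_eq_zero.1 (pow_eq_zero_iff two_ne_zero |>.1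
    (le_antisymm hnorm (sq_nonneg _))))

theorem dist_map_sq_le (h : IsHyperbolicBall φ f U p ρ μ) {x : Phase n}
    (hx : x ∈ localUnstableSet φ p ρ) {t : ℝ} (ht : t ≤ 0) :
    dist (φ t x) p ^ 2 ≤ 2 * ρ ^ 2 * Real.exp (μ * t) := by
  have hU : sqSum U (x - p) ≤ ρ ^ 2 := by
    refine (sqSum_le_norm_sq U _).trans (pow_le_pow_left₀ (norm_nonneg _) ?_ 2)
    rw [← dist_eq_norm]
    exact localUnstableSet_subset_closedBall hx
  calc dist (φ t x) p ^ 2 = ‖φ t x - p‖ ^ 2 := by rw [dist_eq_norm]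
    _ ≤ 2 * sqSum U (φ t x - p) :=
      h.norm_sub_sq_le (flow_apply_mem_localUnstableSet hx ht) h.mem_localUnstableSet
    _ ≤ 2 * (Real.exp (μ * t) * sqSum U (x - p)) := by
      gcongr
      exact h.sqSum_map_sub_le ht (fun s hs => hx s hs.2) fun s hs =>
        h.coneForm_sub_nonneg (flow_apply_mem_localUnstableSet hx hs.2) h.mem_localUnstableSet
    _ ≤ 2 * (Real.exp (μ * t) * ρ ^ 2) := by gcongr
    _ = _ := by ring

theorem tendsto_exp_bound (h : IsHyperbolicBall φ f U p ρ μ) :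
    Tendsto (fun t => 2 * ρ ^ 2 * Real.exp (μ * t)) atBot (𝓝 0) := by
  simpa using (Real.tendsto_exp_atBot.comp (tendsto_id.const_mul_atBot h.rate_pos)).const_mul
    (2 * ρ ^ 2)

theorem tendsto_atBot_of_mem_localUnstableSet (h : IsHyperbolicBall φ f U p ρ μ) {x : Phase n}
    (hx : x ∈ localUnstableSet φ p ρ) : Tendsto (fun t => φ t x) atBot (𝓝 p) := by
  rw [tendsto_iff_dist_tendsto_zero]
  have hsq : Tendsto (fun t => dist (φ t x) p ^ 2) atBot (𝓝 0) := by
    refine squeeze_zero' (Eventually.of_forall fun t => sq_nonneg _) ?_ h.tendsto_exp_bound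
    filter_upwards [eventually_le_atBot 0] with t ht using h.dist_map_sq_le hx ht
  simpa [Real.sqrt_sq dist_nonneg] using hsq.sqrt

end IsHyperbolicBall

end HyperbolicBall

/-! ### Local unstable sets -/

theorem exists_first_eq {u : ℝ → ℝ} (hu : Continuous u) {a b c : ℝ} (hab : a ≤ b) (ha : u a < c)
    (hb : c ≤ u b) : ∃ t ∈ Ioc a b, u t = c ∧ ∀ s ∈ Ico a t, u s < c := by
  have hcomp : IsCompact (Icc a b ∩ {s | c ≤ u s}) :=
    isCompact_Icc.inter_right (isClosed_le continuous_const hu)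
  obtain ⟨t, ⟨ht, htc⟩, hmin⟩ := hcomp.exists_isLeast ⟨b, ⟨hab, le_rfl⟩, hb⟩
  have hlt : ∀ s ∈ Ico a t, u s < c := fun s hs => by
    by_contra hcon
    exact absurd (hmin ⟨⟨hs.1, hs.2.le.trans ht.2⟩, not_lt.1 hcon⟩) (not_le.2 hs.2)
  have hat : a < t := lt_of_le_of_ne ht.1 fun h => absurd htc (not_le.2 (h ▸ ha))
  refine ⟨t, ⟨hat, ht.2⟩, le_antisymm ?_ htc, hlt⟩
  obtain ⟨s, hs, hsc⟩ := intermediate_value_Icc ht.1 hu.continuousOn ⟨ha.le, htc⟩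
  rcases hs.2.lt_or_eq with h | rfl
  · exact absurd hsc (hlt s ⟨hs.1, h⟩).ne
  · exact hsc.le

section FlowCoordinates

variable {n : ℕ} {φ : Flow ℝ (Phase n)}

theorem continuous_flow_apply_coord (φ : Flow ℝ (Phase n)) (x : Phase n) (l : Fin n) :
    Continuous fun t => φ t x l := by
  have := φ.continuous continuous_id (continuous_const (y := x))
  fun_prop

theorem flow_apply_coord_pos (hφ : ∀ t, IsZ2Equivariant (φ t)) {x : Phase n} {l : Fin n}
    (h : 0 < x l) (t : ℝ) : 0 < φ t x l := by
  by_contra hcon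
  have h0 : (0 : ℝ) ∈ uIcc (φ 0 x l) (φ t x l) := by
    rw [φ.map_zero_apply, mem_uIcc]
    exact Or.inr ⟨not_lt.1 hcon, h.le⟩
  obtain ⟨s, -, hs⟩ :=
    intermediate_value_uIcc (continuous_flow_apply_coord φ x l).continuousOn h0
  exact h.ne' ((flow_apply_coord_eq_zero_iff hφ s x l).1 hs)

end FlowCoordinates

namespace IsHyperbolicBall

variable {n : ℕ} {f : Phase n → Phase n} {φ : Flow ℝ (Phase n)} {U : Finset (Fin n)}
  {p x y : Phase n} {ρ μ : ℝ}

section Sink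

variable {I : Finset (Fin n)}

theorem dist_map_le_of_forall_mem_closedBall (h : IsHyperbolicBall φ f U p ρ μ)
    (hφ : ∀ t, IsZ2Equivariant (φ t)) (hI : Disjoint I U) (hpI : p ∈ coordSubspace I)
    (hxI : x ∈ coordSubspace I) {T : ℝ} (hT : 0 ≤ T)
    (hx : ∀ t ∈ Icc 0 T, φ t x ∈ Metric.closedBall p ρ) : dist (φ T x) p ≤ dist x p := by
  have hform : ∀ t, coneForm U (φ t x - p) = -‖φ t x - p‖ ^ 2 := fun t => by
    have h0 : sqSum U (φ t x - p) = 0 := sqSum_eq_zero_of_forall fun l hl => by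
      have hlI : l ∉ I := fun hl' => Finset.disjoint_left.1 hI hl' hl
      rw [PiLp.sub_apply, (flow_apply_mem_coordSubspace_iff hφ).2 hxI l hlI, hpI l hlI, sub_zero]
    rw [coneForm, ← sqSum_add_sqSum_compl U, h0]
    ring
  have hmono := h.monotoneOn_coneForm (convex_Icc 0 T) hx (left_mem_Icc.2 hT) (right_mem_Icc.2 hT)
    hT
  simp only [hform] at hmono
  rw [φ.map_zero_apply] at hmono
  rw [dist_eq_norm, dist_eq_norm]
  exact le_of_sq_le_sq (neg_le_neg_iff.1 hmono) (norm_nonneg _)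

theorem dist_map_le (h : IsHyperbolicBall φ f U p ρ μ) (hφ : ∀ t, IsZ2Equivariant (φ t))
    (hI : Disjoint I U) (hpI : p ∈ coordSubspace I) (hxI : x ∈ coordSubspace I)
    (hx : dist x p < ρ) {t : ℝ} (ht : 0 ≤ t) : dist (φ t x) p ≤ dist x p := by
  refine h.dist_map_le_of_forall_mem_closedBall hφ hI hpI hxI ht ?_
  by_contra! hcon
  obtain ⟨s, hs, hsρ⟩ := hcon
  have hdist : Continuous fun s => dist (φ s x) p :=
    (φ.continuous continuous_id continuous_const).dist continuous_const
  obtain ⟨τ, hτ, hτρ, hlt⟩ := exists_first_eq hdist hs.1 (by rwa [φ.map_zero_apply])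
    (not_le.1 hsρ).le
  have hle := h.dist_map_le_of_forall_mem_closedBall hφ hI hpI hxI hτ.1.le fun r hr => by
    rcases hr.2.lt_or_eq with hrτ | rfl
    · exact (hlt r ⟨hr.1, hrτ⟩).le
    · exact hτρ.le
  linarith

end Sink

section Uniqueness

variable {l k : Fin n}

theorem coord_eq_zero_of_mem_localUnstableSet (h : IsHyperbolicBall φ f U p ρ μ)
    (hφ : ∀ t, IsZ2Equivariant (φ t)) (hpl : p l = 0) (hl : l ∉ U)
    (hx : x ∈ localUnstableSet φ p ρ) : x l = 0 := by
  rw [← signAct_flipSign_eq_self_iff] at hpl ⊢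
  have hflip : signAct (flipSign l) x ∈ localUnstableSet φ p ρ := fun t ht => by
    have hiso := (signIsometry (flipSign l)).dist_map (φ t x) p
    change dist (signAct _ (φ t x)) (signAct _ p) = _ at hiso
    rw [hpl] at hiso
    rw [hφ t, Metric.mem_closedBall, hiso]
    exact hx t ht
  refine h.eq_of_mem_localUnstableSet hflip hx fun m hm => signAct_flipSign_of_ne ?_ x
  rintro rfl
  exact hl hm

theorem coord_eq_zero_of_tendsto (h : IsHyperbolicBall φ f U p ρ μ)
    (hφ : ∀ t, IsZ2Equivariant (φ t)) (hpl : p l = 0) (hl : l ∉ U)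
    (hx : Tendsto (fun t => φ t x) atBot (𝓝 p)) : x l = 0 := by
  obtain ⟨T, -, hT⟩ := exists_forall_flow_apply_mem_localUnstableSet h.radius_pos hx
  exact (flow_apply_coord_eq_zero_iff hφ T x l).1
    (h.coord_eq_zero_of_mem_localUnstableSet hφ hpl hl (hT T le_rfl))

theorem eq_of_tendsto (h : IsHyperbolicBall φ f U p ρ μ) (hφ : ∀ t, IsZ2Equivariant (φ t))
    (hpU : ∀ l ∈ U, p l = 0) (hx : Tendsto (fun t => φ t x) atBot (𝓝 p))
    (hxU : ∀ l ∈ U, x l = 0) : x = p := by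
  obtain ⟨T, -, hT⟩ := exists_forall_flow_apply_mem_localUnstableSet h.radius_pos hx
  have hTx : φ T x = p := h.eq_of_mem_localUnstableSet (hT T le_rfl) h.mem_localUnstableSet
    fun l hl => by rw [hpU l hl, flow_apply_coord_eq_zero_iff hφ, hxU l hl]
  rw [← flow_neg_apply_apply φ T x, hTx, h.fixed]

theorem exists_map_eq_of_coord_le (h : IsHyperbolicBall φ f U p ρ μ)
    (hφ : ∀ t, IsZ2Equivariant (φ t)) (hpk : p k = 0)
    (hx : x ∈ localUnstableSet φ p ρ) (hy : y ∈ localUnstableSet φ p ρ)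
    (hxU : ∀ l ∈ U, l ≠ k → x l = 0) (hyU : ∀ l ∈ U, l ≠ k → y l = 0)
    (hyk : 0 < y k) (hyx : y k ≤ x k) : ∃ t, φ t x = y := by
  have hlim : Tendsto (fun t => φ t x k) atBot (𝓝 0) := by
    rw [← hpk]
    exact ((EuclideanSpace.proj (𝕜 := ℝ) k).continuous.tendsto p).comp
      (h.tendsto_atBot_of_mem_localUnstableSet hx)
  obtain ⟨T, hT0, hT⟩ := ((eventually_le_atBot 0).and (hlim.eventually (gt_mem_nhds hyk))).exists
  obtain ⟨t, ht, hty⟩ := intermediate_value_Icc hT0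
    (continuous_flow_apply_coord φ x k).continuousOn ⟨hT.le, by rwa [φ.map_zero_apply]⟩
  refine ⟨t, h.eq_of_mem_localUnstableSet (flow_apply_mem_localUnstableSet hx ht.2) hy
    fun l hl => ?_⟩
  by_cases hlk : l = k
  · rw [hlk]; exact hty
  · rw [hyU l hl hlk, flow_apply_coord_eq_zero_iff hφ, hxU l hl hlk]

theorem exists_map_eq_of_tendsto (h : IsHyperbolicBall φ f U p ρ μ)
    (hφ : ∀ t, IsZ2Equivariant (φ t)) (hpk : p k = 0)
    (hx : Tendsto (fun t => φ t x) atBot (𝓝 p)) (hy : Tendsto (fun t => φ t y) atBot (𝓝 p))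
    (hxU : ∀ l ∈ U, l ≠ k → x l = 0) (hyU : ∀ l ∈ U, l ≠ k → y l = 0)
    (hxk : 0 < x k) (hyk : 0 < y k) : ∃ t, φ t x = y := by
  obtain ⟨T₁, -, hT₁⟩ := exists_forall_flow_apply_mem_localUnstableSet h.radius_pos hx
  obtain ⟨T₂, -, hT₂⟩ := exists_forall_flow_apply_mem_localUnstableSet h.radius_pos hy
  have hxU' : ∀ l ∈ U, l ≠ k → φ T₁ x l = 0 :=
    fun l hl hlk => (flow_apply_coord_eq_zero_iff hφ _ _ _).2 (hxU l hl hlk)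
  have hyU' : ∀ l ∈ U, l ≠ k → φ T₂ y l = 0 :=
    fun l hl hlk => (flow_apply_coord_eq_zero_iff hφ _ _ _).2 (hyU l hl hlk)
  obtain ⟨t, ht⟩ : ∃ t, φ t (φ T₁ x) = φ T₂ y := by
    rcases le_total (φ T₂ y k) (φ T₁ x k) with hle | hle
    · exact h.exists_map_eq_of_coord_le hφ hpk (hT₁ T₁ le_rfl) (hT₂ T₂ le_rfl) hxU' hyU'
        (flow_apply_coord_pos hφ hyk _) hle
    · obtain ⟨t, ht⟩ := h.exists_map_eq_of_coord_le hφ hpk (hT₂ T₂ le_rfl) (hT₁ T₁ le_rfl) hyU'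
        hxU' (flow_apply_coord_pos hφ hxk _) hle
      exact ⟨-t, by rw [← ht, flow_neg_apply_apply]⟩
  exact ⟨-T₂ + (t + T₁), by rw [φ.map_add, φ.map_add, ht, flow_neg_apply_apply]⟩

end Uniqueness

section Existence

variable {i : Fin n}

/-- The points whose backward orbit leaves the cone `0 ≤ coneForm U` while it is still near `p`,
on the side of `p` along the `i`-th axis given by the sign of `σ`. -/
def coneExitSet (φ : Flow ℝ (Phase n)) (U : Finset (Fin n)) (p : Phase n) (ρ : ℝ) (i : Fin n)
    (σ : ℝ) : Set (Phase n) :=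
  {x | ∃ t ≤ 0, (∀ r ∈ Icc t 0, φ r x ∈ Metric.ball p ρ) ∧ coneForm U (φ t x - p) < 0 ∧
    0 < σ * (φ t x - p) i}

theorem mem_coneExitSet_of_coneForm_neg {σ : ℝ} (hxp : dist x p < ρ)
    (hcone : coneForm U (x - p) < 0) (hside : 0 < σ * (x - p) i) : x ∈ coneExitSet φ U p ρ i σ := by
  refine ⟨0, le_rfl, fun r hr => ?_, ?_, ?_⟩
  · rwa [le_antisymm hr.2 hr.1, φ.map_zero_apply]
  all_goals rwa [φ.map_zero_apply]

theorem isOpen_coneExitSet (φ : Flow ℝ (Phase n)) (U : Finset (Fin n)) (p : Phase n) (ρ : ℝ)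
    (i : Fin n) (σ : ℝ) : IsOpen (coneExitSet φ U p ρ i σ) := by
  rw [isOpen_iff_mem_nhds]
  rintro x ⟨t, ht, hball, hcone, hside⟩
  have hsub : Continuous fun y => φ t y - p := by fun_prop
  have hball' : ∀ᶠ y in 𝓝 x, ∀ r ∈ Icc t 0, φ r y ∈ Metric.ball p ρ := by
    refine isCompact_Icc.eventually_forall_of_forall_eventually fun r hr => ?_
    exact (φ.continuous continuous_snd continuous_fst).continuousAt.eventually
      (Metric.isOpen_ball.mem_nhds (hball r hr))
  have hcone' : ∀ᶠ y in 𝓝 x, coneForm U (φ t y - p) < 0 :=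
    (isOpen_lt ((continuous_coneForm U).comp hsub) continuous_const).mem_nhds hcone
  have hside' : ∀ᶠ y in 𝓝 x, 0 < σ * (φ t y - p) i :=
    (isOpen_lt continuous_const (by fun_prop)).mem_nhds hside
  filter_upwards [hball', hcone', hside'] with y h1 h2 h3 using ⟨t, ht, h1, h2, h3⟩

theorem coneForm_sub_eq (hpi : p ∈ coordAxis i) (hi : i ∉ U)
    (hx : x ∈ coordSubspace (insert i U)) :
    coneForm U (x - p) = sqSum U (x - p) - (x - p) i ^ 2 := by
  rw [coneForm, sub_right_inj]
  refine Finset.sum_eq_single_of_mem i (Finset.mem_compl.2 hi) fun l hl hli => ?_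
  have hl' : l ∉ insert i U := by
    rw [Finset.mem_insert, not_or]
    exact ⟨hli, Finset.mem_compl.1 hl⟩
  rw [PiLp.sub_apply, hx l hl', hpi l hli, sub_zero, zero_pow two_ne_zero]

theorem side_pos_of_le (h : IsHyperbolicBall φ f U p ρ μ) (hφ : ∀ t, IsZ2Equivariant (φ t))
    (hpi : p ∈ coordAxis i) (hi : i ∉ U) (hx : x ∈ coordSubspace (insert i U)) {σ s t : ℝ}
    (hst : s ≤ t) (hball : ∀ r ∈ Icc s t, φ r x ∈ Metric.closedBall p ρ)
    (hcone : coneForm U (φ t x - p) < 0) (hside : 0 < σ * (φ t x - p) i) :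
    0 < σ * (φ s x - p) i := by
  by_contra hneg
  have hcont : Continuous fun r => σ * (φ r x - p) i := by
    have := continuous_flow_apply_coord φ x i
    simp only [PiLp.sub_apply]
    fun_prop
  obtain ⟨r, hr, hr0⟩ := intermediate_value_Icc hst hcont.continuousOn ⟨not_lt.1 hneg, hside.le⟩
  have hri : (φ r x - p) i = 0 := (mul_eq_zero.1 hr0).resolve_left (left_ne_zero_of_mul hside.ne')
  have hle := h.monotoneOn_coneForm (convex_Icc s t) hball hr (right_mem_Icc.2 hst) hr.2
  simp only [coneForm_sub_eq hpi hi ((flow_apply_mem_coordSubspace_iff hφ (t := r)).2 hx), hri]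
    at hle
  linarith [sqSum_nonneg U (φ r x - p)]

theorem notMem_coneExitSet_neg (h : IsHyperbolicBall φ f U p ρ μ)
    (hφ : ∀ t, IsZ2Equivariant (φ t)) (hpi : p ∈ coordAxis i) (hi : i ∉ U)
    (hx : x ∈ coordSubspace (insert i U)) {σ : ℝ} (hσ : x ∈ coneExitSet φ U p ρ i σ) :
    x ∉ coneExitSet φ U p ρ i (-σ) := by
  rintro ⟨t, ht, hball_t, hcone_t, hside_t⟩
  obtain ⟨s, hs, hball_s, hcone_s, hside_s⟩ := hσ
  rcases le_total s t with hst | hts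
  · have := h.side_pos_of_le hφ hpi hi hx hst
      (fun r hr => Metric.ball_subset_closedBall (hball_s r ⟨hr.1, hr.2.trans ht⟩)) hcone_t hside_t
    linarith
  · have := h.side_pos_of_le hφ hpi hi hx hts
      (fun r hr => Metric.ball_subset_closedBall (hball_t r ⟨hr.1, hr.2.trans hs⟩)) hcone_s hside_s
    linarith

theorem coneForm_nonneg_of_notMem_coneExitSet (hφ : ∀ t, IsZ2Equivariant (φ t))
    (hpi : p ∈ coordAxis i) (hi : i ∉ U) (hx : x ∈ coordSubspace (insert i U))
    (hpos : x ∉ coneExitSet φ U p ρ i 1) (hneg : x ∉ coneExitSet φ U p ρ i (-1)) {t : ℝ}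
    (ht : t ≤ 0) (hball : ∀ r ∈ Icc t 0, φ r x ∈ Metric.ball p ρ) :
    0 ≤ coneForm U (φ t x - p) := by
  by_contra! hcone
  rcases lt_trichotomy ((φ t x - p) i) 0 with hside | hside | hside
  · exact hneg ⟨t, ht, hball, hcone, by linarith⟩
  · rw [coneForm_sub_eq hpi hi ((flow_apply_mem_coordSubspace_iff hφ).2 hx), hside] at hcone
    linarith [sqSum_nonneg U (φ t x - p)]
  · exact hpos ⟨t, ht, hball, hcone, by linarith⟩

-- Inside the cone the component along `U` decays backwards and controls the distance to `p`.
theorem mem_localUnstableSet_of_notMem_coneExitSet (h : IsHyperbolicBall φ f U p ρ μ)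
    (hφ : ∀ t, IsZ2Equivariant (φ t)) (hpi : p ∈ coordAxis i) (hi : i ∉ U)
    (hx : x ∈ coordSubspace (insert i U)) (hxp : dist x p < ρ)
    (hxU : 2 * sqSum U (x - p) < ρ ^ 2)
    (hpos : x ∉ coneExitSet φ U p ρ i 1) (hneg : x ∉ coneExitSet φ U p ρ i (-1)) :
    x ∈ localUnstableSet φ p ρ := by
  by_contra hcon
  simp only [localUnstableSet, mem_ofPred_eq, not_forall] at hcon
  obtain ⟨b, hb, hbρ⟩ := hcon
  have hsub : Continuous fun t => φ t x - p :=
    (φ.continuous continuous_id continuous_const).sub continuous_const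
  obtain ⟨τ, hτ, hτρ, hlt⟩ := exists_first_eq (u := fun τ => dist (φ (-τ) x) p) (a := 0) (b := -b)
    (by simp only [dist_eq_norm]; fun_prop) (neg_nonneg.2 hb)
    (by rwa [neg_zero, φ.map_zero_apply]) (by rw [neg_neg]; exact (not_le.1 hbρ).le)
  have hball : ∀ t ∈ Ioc (-τ) 0, φ t x ∈ Metric.ball p ρ := fun t ht => by
    simpa using hlt (-t) ⟨neg_nonneg.2 ht.2, neg_lt.1 ht.1⟩
  have hcone : Icc (-τ) 0 ⊆ {t | 0 ≤ coneForm U (φ t x - p)} := by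
    rw [← closure_Ioc (neg_lt_zero.2 hτ.1).ne]
    refine closure_minimal (fun t ht => ?_)
      (isClosed_le continuous_const ((continuous_coneForm U).comp hsub))
    exact coneForm_nonneg_of_notMem_coneExitSet hφ hpi hi hx hpos hneg ht.2
      fun r hr => hball r ⟨ht.1.trans_le hr.1, hr.2⟩
  have hclosed : ∀ t ∈ Icc (-τ) 0, φ t x ∈ Metric.closedBall p ρ := fun t ht => by
    rcases ht.1.lt_or_eq with hτt | rfl
    · exact Metric.ball_subset_closedBall (hball t ⟨hτt, ht.2⟩)
    · exact hτρ.le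
  have hdecay := h.sqSum_map_sub_le (neg_nonpos.2 hτ.1.le) hclosed hcone
  have hexp : Real.exp (μ * -τ) * sqSum U (x - p) ≤ sqSum U (x - p) :=
    mul_le_of_le_one_left (sqSum_nonneg U _)
      (Real.exp_le_one_iff.2 (mul_nonpos_of_nonneg_of_nonpos h.rate_pos.le
        (neg_nonpos.2 hτ.1.le)))
  have hρ_le := norm_sq_le_of_coneForm_nonneg (hcone (left_mem_Icc.2 (neg_nonpos.2 hτ.1.le)))
  rw [← dist_eq_norm, hτρ] at hρ_le
  linarith

theorem exists_notMem_coneExitSet (h : IsHyperbolicBall φ f U p ρ μ)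
    (hφ : ∀ t, IsZ2Equivariant (φ t)) (hpi : p ∈ coordAxis i) (hi : i ∉ U) {X : ℝ → Phase n}
    (hX : Continuous X) (hXI : ∀ s, X s ∈ coordSubspace (insert i U)) {a b : ℝ} (hab : a ≤ b)
    (ha : X a ∈ coneExitSet φ U p ρ i (-1)) (hb : X b ∈ coneExitSet φ U p ρ i 1) :
    ∃ s ∈ Icc a b, X s ∉ coneExitSet φ U p ρ i 1 ∧ X s ∉ coneExitSet φ U p ρ i (-1) := by
  by_contra! hcon
  obtain ⟨s, -, hs1, hs2⟩ := isPreconnected_Icc (a := a) (b := b) _ _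
    ((isOpen_coneExitSet φ U p ρ i 1).preimage hX)
    ((isOpen_coneExitSet φ U p ρ i (-1)).preimage hX)
    (fun s hs => or_iff_not_imp_left.2 (hcon s hs))
    ⟨b, right_mem_Icc.2 hab, hb⟩ ⟨a, left_mem_Icc.2 hab, ha⟩
  exact h.notMem_coneExitSet_neg hφ hpi hi (hXI s) hs1 hs2

-- Moving `p + w` along the axis of `p` by `±ρ / 2` leads out of the cone on either side.
theorem exists_add_single_add_mem_localUnstableSet (h : IsHyperbolicBall φ f U p ρ μ)
    (hφ : ∀ t, IsZ2Equivariant (φ t)) (hpi : p ∈ coordAxis i) (hi : i ∉ U) {w : Phase n}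
    (hw : w ∈ coordSubspace U) (hwρ : ‖w‖ ≤ ρ / 4) :
    ∃ s : ℝ, p + (EuclideanSpace.single i s + w) ∈ localUnstableSet φ p ρ := by
  have hρ := h.radius_pos
  set X : ℝ → Phase n := fun s => p + (EuclideanSpace.single i s + w) with hX
  have hXsub : ∀ s, X s - p = EuclideanSpace.single i s + w := fun s => add_sub_cancel_left _ _
  have hXc : Continuous X := by
    have : Continuous fun s : ℝ => (EuclideanSpace.single i s : Phase n) :=
      (PiLp.continuous_toLp 2 _).comp (continuous_single (A := fun _ : Fin n => ℝ) i)
    fun_prop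
  have hXI : ∀ s, X s ∈ coordSubspace (insert i U) := fun s l hl => by
    rw [Finset.mem_insert, not_or] at hl
    simp [hX, hpi l hl.1, hw l hl.2, hl.1]
  have hXi : ∀ s, (X s - p) i = s := fun s => by simp [hXsub, hw i hi]
  have hXU : ∀ s, sqSum U (X s - p) ≤ (ρ / 4) ^ 2 := fun s => by
    have : sqSum U (X s - p) = sqSum U w := Finset.sum_congr rfl fun l hl => by
      simp [hXsub, ne_of_mem_of_not_mem hl hi]
    rw [this]
    exact (sqSum_le_norm_sq U w).trans (pow_le_pow_left₀ (norm_nonneg _) hwρ 2)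
  have hXball : ∀ s, |s| ≤ ρ / 2 → dist (X s) p < ρ := fun s hs => by
    rw [dist_eq_norm, hXsub]
    refine (norm_add_le _ _).trans_lt ?_
    rw [PiLp.norm_single, Real.norm_eq_abs]
    linarith
  have hexit : ∀ s σ, |s| = ρ / 2 → 0 < σ * s → X s ∈ coneExitSet φ U p ρ i σ :=
    fun s σ hs hσ => by
      refine mem_coneExitSet_of_coneForm_neg (hXball s hs.le) ?_ (by rwa [hXi])
      rw [coneForm_sub_eq hpi hi (hXI s), hXi, ← sq_abs, hs]
      nlinarith [hXU s]
  obtain ⟨s, hs, hpos, hneg⟩ := h.exists_notMem_coneExitSet hφ hpi hi hXc hXI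
    (by linarith : -(ρ / 2) ≤ ρ / 2) (hexit _ _ (by rw [abs_neg, abs_of_pos (half_pos hρ)])
      (by linarith)) (hexit _ _ (abs_of_pos (half_pos hρ)) (by linarith))
  exact ⟨s, h.mem_localUnstableSet_of_notMem_coneExitSet hφ hpi hi (hXI s) (hXball s (abs_le.2 hs))
    (by nlinarith [hXU s]) hpos hneg⟩

end Existence

end IsHyperbolicBall

/-! ### Limits and connections in an ac-network -/

theorem one_le_dimH_of_isPreconnected {X : Type*} [MetricSpace X] {s : Set X}
    (hs : IsPreconnected s) (hs' : s.Nontrivial) : 1 ≤ dimH s := by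
  obtain ⟨x, hx, y, hy, hxy⟩ := hs'
  have hint : (interior ((fun z => dist z x) '' s)).Nonempty := by
    have hIcc : Icc (dist x x) (dist y x) ⊆ (fun z => dist z x) '' s :=
      hs.intermediate_value hx hy (f := fun z => dist z x) (by fun_prop)
    refine Nonempty.mono (interior_mono hIcc) ?_
    rw [interior_Icc, dist_self, nonempty_Ioo]
    exact dist_pos.2 hxy.symm
  calc (1 : ENNReal) = dimH ((fun z => dist z x) '' s) := by
        rw [Real.dimH_of_nonempty_interior hint, Module.finrank_self, Nat.cast_one]
    _ ≤ dimH s := (LipschitzWith.dist_left x).dimH_image_le s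

theorem single_mem_of_mem_coordAxis {n : ℕ} {i : Fin n} {p : Phase n} (hi : p ∈ coordAxis i)
    (hpi : p i ≠ 0) {P : Submodule ℝ (Phase n)} (hp : p ∈ P) :
    EuclideanSpace.single i (1 : ℝ) ∈ P := by
  have hsingle : EuclideanSpace.single i (1 : ℝ) = (p i)⁻¹ • p := by
    ext k
    by_cases hk : k = i
    · subst hk; simp [hpi]
    · simp [hk, hi k hk]
  rw [hsingle]
  exact P.smul_mem _ hp

theorem mem_coordSubspace_of_tendsto_flow {n : ℕ} {φ : Flow ℝ (Phase n)}
    (hφ : ∀ t, IsZ2Equivariant (φ t)) {x b : Phase n} {l : Filter ℝ} [l.NeBot]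
    (hb : Tendsto (fun t => φ t x) l (𝓝 b)) {I : Finset (Fin n)} (hx : x ∈ coordSubspace I) :
    b ∈ coordSubspace I :=
  (isClosed_coordSubspace I).mem_of_tendsto hb
    (Eventually.of_forall fun _ => (flow_apply_mem_coordSubspace_iff hφ).2 hx)

theorem IsHyperbolicBall.eq_of_apply_eq_zero {n : ℕ} {f : Phase n → Phase n}
    {φ : Flow ℝ (Phase n)} {U : Finset (Fin n)} {p q : Phase n} {ρ μ : ℝ}
    (h : IsHyperbolicBall φ f U p ρ μ) (hp : f p = 0) (hq : f q = 0)
    (hqb : q ∈ Metric.closedBall p ρ) : q = p := by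
  have hcone := h.cone q hqb p (Metric.mem_closedBall_self h.radius_pos.le)
  simp only [innerOn, hp, hq, sub_zero, PiLp.zero_apply, mul_zero, Finset.sum_const_zero] at hcone
  have hsq : ‖q - p‖ ^ 2 ≤ 0 := nonpos_of_mul_nonpos_right hcone h.rate_pos
  exact sub_eq_zero.1 (norm_eq_zero.1
    (pow_eq_zero_iff two_ne_zero |>.1 (le_antisymm hsq (sq_nonneg _))))

theorem NetworkFlow.dimH_orbit {n : ℕ} {f : Phase n → Phase n} {Y : Set (Phase n)}
    (F : NetworkFlow f Y) (hf : Continuous f) {x : Phase n} (hx : x ∈ Y) {t : ℝ}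
    (ht : F.φ t x ≠ x) : dimH (F.φ.orbit x) = 1 := by
  have hder : ∀ s, HasDerivAt (fun s => F.φ s x) (f (F.φ s x)) s :=
    fun s => F.hasDerivAt x s (F.map_mem_dom hx s)
  have hcont : Continuous fun s => F.φ s x := F.φ.continuous continuous_id continuous_const
  refine le_antisymm ?_ (one_le_dimH_of_isPreconnected (isPreconnected_range hcont)
    ⟨_, F.φ.mem_orbit x t, _, F.φ.mem_orbit_self x, ht⟩)
  have hC1 : ContDiff ℝ 1 fun s => F.φ s x := by
    rw [contDiff_one_iff_deriv, deriv_eq hder]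
    exact ⟨fun s => (hder s).differentiableAt, hf.comp hcont⟩
  exact hC1.dimH_range_le.trans_eq (by rw [Module.finrank_self, Nat.cast_one])

namespace IsACNetwork

variable {n : ℕ} {f : Phase n → Phase n} {Y : Set (Phase n)} {x y a p q : Phase n}

theorem contDiff_one (hY : IsACNetwork f Y) : ContDiff ℝ 1 f := hY.smooth.of_le (by simp)

theorem isCompact (hY : IsACNetwork f Y) : IsCompact Y := hY.clean.1

theorem nonempty_networkFlow (hY : IsACNetwork f Y) : Nonempty (NetworkFlow f Y) :=
  _root_.nonempty_networkFlow hY.contDiff_one hY.equivariant hY.isCompact.isBounded hY.clean.2.1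

theorem unstableSet_subset (hY : IsACNetwork f Y) (hp : p ∈ equilibriaIn f Y) :
    unstableSet f {p} ⊆ Y := by
  refine hY.clean.2.2 {p} (singleton_subset_iff.2 hp.1) ?_
  rintro x rfl
  exact ⟨fun _ => x, fun t _ => by simpa [hp.2] using hasDerivWithinAt_const t univ x, rfl,
    fun _ => rfl⟩

theorem map_equilibrium (hY : IsACNetwork f Y) (F : NetworkFlow f Y) (hp : p ∈ equilibriaIn f Y)
    (t : ℝ) : F.φ t p = p :=
  F.map_equilibrium hY.contDiff_one hp t

theorem mem_connection_iff (hY : IsACNetwork f Y) (F : NetworkFlow f Y) {b : Phase n}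
    (hx : x ∈ Y) : x ∈ connection f a b ↔ Tendsto (fun t => F.φ t x) atBot (𝓝 a) ∧
      Tendsto (fun t => F.φ t x) atTop (𝓝 b) :=
  F.mem_connection_iff hY.contDiff_one hY.isCompact hY.subset_orthant hx

theorem node_mem_equilibriaIn {N : ℕ} {X : Fin N → HeteroclinicCycle f}
    (hX : Y = ⋃ i, (X i).carrier) (c : Fin N) (j : Fin (X c).length) :
    (X c).node j ∈ equilibriaIn f Y :=
  ⟨by rw [hX]; exact mem_iUnion.2 ⟨c, Or.inl ⟨j, rfl⟩⟩, ((X c).hyperbolic j).1⟩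

theorem exists_mem_connection (hY : IsACNetwork f Y) (hx : x ∈ Y) (hfx : f x ≠ 0) :
    ∃ a ∈ equilibriaIn f Y, ∃ b ∈ equilibriaIn f Y, a ≠ b ∧ x ∈ connection f a b ∧
      ∃ P : Submodule ℝ (Phase n), connection f a b ⊆ P ∧ a ∈ P ∧ IsSinkIn f P b := by
  obtain ⟨-, N, X, hrobust, hX⟩ := hY.network
  rw [hX] at hx
  obtain ⟨c, hc⟩ := mem_iUnion.1 hx
  rcases hc with ⟨j, rfl⟩ | hc
  · exact absurd ((X c).hyperbolic j).1 hfx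
  · obtain ⟨j, hj⟩ := mem_iUnion.1 hc
    obtain ⟨P, -, hP, hsaddle, hsink⟩ := hrobust c j
    exact ⟨_, node_mem_equilibriaIn hX c j, _, node_mem_equilibriaIn hX c (j + 1),
      (X c).heteroclinic j, hj, P, hP, hsaddle.1, hsink⟩

theorem exists_isSinkIn (hY : IsACNetwork f Y) (hp : p ∈ equilibriaIn f Y) :
    ∃ P : Submodule ℝ (Phase n), IsSinkIn f P p := by
  obtain ⟨F⟩ := hY.nonempty_networkFlow
  obtain ⟨-, N, X, hrobust, hX⟩ := hY.network
  have hpY := hp.1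
  rw [hX] at hpY
  obtain ⟨c, hc⟩ := mem_iUnion.1 hpY
  rcases hc with ⟨j, rfl⟩ | hc
  · obtain ⟨P, -, -, -, hsink⟩ := hrobust c (j - 1)
    rw [sub_add_cancel] at hsink
    exact ⟨P, hsink⟩
  · obtain ⟨j, hj⟩ := mem_iUnion.1 hc
    obtain ⟨hbot, htop⟩ := (hY.mem_connection_iff F hp.1).1 hj
    simp only [hY.map_equilibrium F hp, tendsto_const_nhds_iff] at hbot htop
    exact absurd (hbot.symm.trans htop) ((X c).heteroclinic j)

theorem equilibrium_ne_zero (hY : IsACNetwork f Y) (hp : p ∈ equilibriaIn f Y) : p ≠ 0 := by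
  rintro rfl
  have hall : ∀ q ∈ equilibriaIn f Y, q = 0 := fun q hq => by
    obtain ⟨i, hi⟩ := hY.axial q hq
    exact hY.one_per_axis i ⟨hq, hi⟩ ⟨hp, fun k _ => rfl⟩
  obtain ⟨-, N, X, -, hX⟩ := hY.network
  have hpY := hp.1
  rw [hX] at hpY
  obtain ⟨c, -⟩ := mem_iUnion.1 hpY
  exact (X c).heteroclinic 0 ((hall _ (node_mem_equilibriaIn hX c 0)).trans
    (hall _ (node_mem_equilibriaIn hX c _)).symm)

theorem exists_mem_coordAxis (hY : IsACNetwork f Y) (hp : p ∈ equilibriaIn f Y) :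
    ∃ i, p ∈ coordAxis i ∧ 0 < p i := by
  obtain ⟨i, hi⟩ := hY.axial p hp
  refine ⟨i, hi, lt_of_le_of_ne (hY.subset_orthant hp.1 i) fun h0 => hY.equilibrium_ne_zero hp ?_⟩
  ext k
  by_cases hk : k = i
  · rw [hk, ← h0]; rfl
  · exact hi k hk

theorem eq_of_mem_coordAxis (hY : IsACNetwork f Y) (hp : p ∈ equilibriaIn f Y)
    (hq : q ∈ equilibriaIn f Y) {i : Fin n} (hpi : p ∈ coordAxis i) (hqi : q ∈ coordAxis i) :
    p = q := hY.one_per_axis i ⟨hp, hpi⟩ ⟨hq, hqi⟩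

-- `p` is a sink of the system restricted to one of the invariant subspaces of the network, and
-- this subspace contains `p`, hence the axis.
theorem rate_axis_neg (hY : IsACNetwork f Y) (hp : p ∈ equilibriaIn f Y) {i : Fin n}
    (hi : p ∈ coordAxis i) (hpi : 0 < p i) : rate f p i < 0 := by
  obtain ⟨P, hP⟩ := hY.exists_isSinkIn hp
  exact rate_neg_of_isSinkIn hY.equivariant hi hP (single_mem_of_mem_coordAxis hi hpi.ne' hP.1)

theorem coord_eq_zero_of_mem_unstableIdx (hY : IsACNetwork f Y) (hp : p ∈ equilibriaIn f Y)
    {l : Fin n} (hl : l ∈ unstableIdx f p) : p l = 0 := by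
  obtain ⟨i, hi, hpi⟩ := hY.exists_mem_coordAxis hp
  refine hi l ?_
  rintro rfl
  exact absurd (mem_unstableIdx.1 hl) (hY.rate_axis_neg hp hi hpi).not_gt

theorem exists_isHyperbolicBall (hY : IsACNetwork f Y) (F : NetworkFlow f Y)
    (hp : p ∈ equilibriaIn f Y) : ∃ ρ μ, IsHyperbolicBall F.φ f (unstableIdx f p) p ρ μ ∧
      Metric.closedBall p ρ ⊆ F.dom := by
  obtain ⟨i, hi⟩ := hY.axial p hp
  have hdom : F.dom ∈ 𝓝 p := F.isOpen_dom.mem_nhds (F.subset_dom hp.1)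
  obtain ⟨ρ, μ, h⟩ := _root_.exists_isHyperbolicBall hY.contDiff_one.contDiffAt hY.equivariant hi
    (hY.hyperbolic p hp) (hY.map_equilibrium F hp) hdom F.hasDerivAt
  obtain ⟨δ, hδ, hsub⟩ := Metric.nhds_basis_closedBall.mem_iff.1 hdom
  exact ⟨min ρ δ, μ, h.mono (lt_min h.radius_pos hδ) (min_le_left ρ δ),
    (Metric.closedBall_subset_closedBall (min_le_right ρ δ)).trans hsub⟩

theorem exists_tendsto (hY : IsACNetwork f Y) (F : NetworkFlow f Y) (hx : x ∈ Y) (hfx : f x ≠ 0) :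
    ∃ a ∈ equilibriaIn f Y, ∃ b ∈ equilibriaIn f Y, a ≠ b ∧
      Tendsto (fun t => F.φ t x) atBot (𝓝 a) ∧ Tendsto (fun t => F.φ t x) atTop (𝓝 b) ∧
      ∃ P : Submodule ℝ (Phase n), connection f a b ⊆ P ∧ a ∈ P ∧ IsSinkIn f P b := by
  obtain ⟨a, ha, b, hb, hab, hxc, hP⟩ := hY.exists_mem_connection hx hfx
  obtain ⟨hbot, htop⟩ := (hY.mem_connection_iff F hx).1 hxc
  exact ⟨a, ha, b, hb, hab, hbot, htop, hP⟩

theorem apply_ne_zero_of_tendsto_atBot (hY : IsACNetwork f Y) (F : NetworkFlow f Y) (hx : x ∈ Y)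
    (ha : Tendsto (fun t => F.φ t x) atBot (𝓝 a)) (hxa : x ≠ a) : f x ≠ 0 := by
  intro h0
  simp only [hY.map_equilibrium F ⟨hx, h0⟩] at ha
  exact hxa (tendsto_nhds_unique tendsto_const_nhds ha)

theorem exists_tendsto_atTop (hY : IsACNetwork f Y) (F : NetworkFlow f Y) (hx : x ∈ Y)
    (ha : Tendsto (fun t => F.φ t x) atBot (𝓝 a)) (hxa : x ≠ a) :
    ∃ b ∈ equilibriaIn f Y, a ≠ b ∧ Tendsto (fun t => F.φ t x) atTop (𝓝 b) ∧
      ∃ P : Submodule ℝ (Phase n), connection f a b ⊆ P ∧ a ∈ P ∧ IsSinkIn f P b := by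
  obtain ⟨a', -, b, hb, hab, hbot, htop, hP⟩ :=
    hY.exists_tendsto F hx (hY.apply_ne_zero_of_tendsto_atBot F hx ha hxa)
  obtain rfl := tendsto_nhds_unique hbot ha
  exact ⟨b, hb, hab, htop, hP⟩

theorem eventually_tendsto_atTop_of_disjoint (hY : IsACNetwork f Y) (F : NetworkFlow f Y)
    {b : Phase n} (hb : b ∈ equilibriaIn f Y) {I : Finset (Fin n)}
    (hI : Disjoint I (unstableIdx f b)) (hbI : b ∈ coordSubspace I)
    (hx : Tendsto (fun t => F.φ t x) atTop (𝓝 b)) :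
    ∀ᶠ y in 𝓝 x, y ∈ Y → y ∈ coordSubspace I → Tendsto (fun t => F.φ t y) atTop (𝓝 b) := by
  obtain ⟨ρ, μ, h, -⟩ := hY.exists_isHyperbolicBall F hb
  obtain ⟨T, hT⟩ := (hx.eventually (Metric.ball_mem_nhds b h.radius_pos)).exists
  have hcont : Continuous (F.φ T) := by fun_prop
  filter_upwards [hcont.continuousAt.eventually (Metric.isOpen_ball.mem_nhds hT)]
    with y hy hyY hyI
  have hin : ∀ t ≥ T, F.φ t y ∈ Metric.closedBall b ρ := by
    intro t ht
    have hle := h.dist_map_le F.equivariant hI hbI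
      ((flow_apply_mem_coordSubspace_iff F.equivariant).2 hyI) hy (sub_nonneg.2 ht)
    rw [← F.φ.map_add, sub_add_cancel] at hle
    exact hle.trans (le_of_lt hy)
  by_cases hfy : f y = 0
  · have hyb := hin T le_rfl
    rw [hY.map_equilibrium F ⟨hyY, hfy⟩] at hyb
    rw [h.eq_of_apply_eq_zero hb.2 hfy hyb]
    simp only [h.fixed, tendsto_const_nhds]
  · obtain ⟨a, -, b', hb', -, -, htop, -⟩ := hY.exists_tendsto F hyY hfy
    have hb'b : b' ∈ Metric.closedBall b ρ := Metric.isClosed_closedBall.mem_of_tendsto htop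
      ((eventually_ge_atTop T).mono hin)
    rwa [h.eq_of_apply_eq_zero hb.2 hb'.2 hb'b] at htop

theorem eq_of_tendsto_atBot_of_disjoint (hY : IsACNetwork f Y) (F : NetworkFlow f Y)
    {b : Phase n} (hb : b ∈ equilibriaIn f Y) {I : Finset (Fin n)}
    (hI : Disjoint I (unstableIdx f b)) (hxI : x ∈ coordSubspace I)
    (hx : Tendsto (fun t => F.φ t x) atBot (𝓝 b)) : x = b := by
  obtain ⟨ρ, μ, h, -⟩ := hY.exists_isHyperbolicBall F hb
  exact h.eq_of_tendsto F.equivariant (fun l hl => hY.coord_eq_zero_of_mem_unstableIdx hb hl) hx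
    fun l hl => hxI l fun hl' => Finset.disjoint_left.1 hI hl' hl

theorem mem_coordSubspace_of_tendsto_atBot (hY : IsACNetwork f Y) (F : NetworkFlow f Y)
    (hp : p ∈ equilibriaIn f Y) {i : Fin n} (hi : p ∈ coordAxis i)
    (hx : Tendsto (fun t => F.φ t x) atBot (𝓝 p)) :
    x ∈ coordSubspace (insert i (unstableIdx f p)) := by
  obtain ⟨ρ, μ, h, -⟩ := hY.exists_isHyperbolicBall F hp
  intro l hl
  rw [Finset.mem_insert, not_or] at hl
  exact h.coord_eq_zero_of_tendsto F.equivariant (hi l hl.1) hl.2 hx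

theorem exists_map_eq_of_tendsto_atBot (hY : IsACNetwork f Y) (F : NetworkFlow f Y)
    (hp : p ∈ equilibriaIn f Y) {k : Fin n} (hk : k ∈ unstableIdx f p)
    (hxY : x ∈ Y) (hyY : y ∈ Y) (hxp : x ≠ p) (hyp : y ≠ p)
    (hx : Tendsto (fun t => F.φ t x) atBot (𝓝 p)) (hy : Tendsto (fun t => F.φ t y) atBot (𝓝 p))
    (hxU : ∀ l ∈ unstableIdx f p, l ≠ k → x l = 0)
    (hyU : ∀ l ∈ unstableIdx f p, l ≠ k → y l = 0) : ∃ t, F.φ t x = y := by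
  obtain ⟨ρ, μ, h, -⟩ := hY.exists_isHyperbolicBall F hp
  have hpU : ∀ l ∈ unstableIdx f p, p l = 0 := fun _ => hY.coord_eq_zero_of_mem_unstableIdx hp
  have hpos : ∀ z ∈ Y, z ≠ p → Tendsto (fun t => F.φ t z) atBot (𝓝 p) →
      (∀ l ∈ unstableIdx f p, l ≠ k → z l = 0) → 0 < z k := by
    intro z hzY hzp hz hzU
    refine lt_of_le_of_ne (hY.subset_orthant hzY k) fun h0 => hzp ?_
    refine h.eq_of_tendsto F.equivariant hpU hz fun l hl => ?_
    by_cases hlk : l = k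
    · rw [hlk, ← h0]
    · exact hzU l hl hlk
  exact h.exists_map_eq_of_tendsto F.equivariant (hpU k hk) hx hy hxU hyU (hpos x hxY hxp hx hxU)
    (hpos y hyY hyp hy hyU)

end IsACNetwork

/-! ### A cross section of a two-dimensional unstable set -/

theorem exists_eq_mul_sqrt {a b c : ℝ} (ha : 0 ≤ a) (hb : 0 ≤ b) (hc : 0 < c)
    (h : a ^ 2 + b ^ 2 = c ^ 2) : ∃ θ ∈ Icc (0 : ℝ) 1, a = c * √θ ∧ b = c * √(1 - θ) := by
  have hsub : 1 - (a / c) ^ 2 = (b / c) ^ 2 := by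
    rw [div_pow, div_pow]
    field_simp
    linarith
  refine ⟨(a / c) ^ 2, ⟨by positivity, by linarith [sq_nonneg (b / c)]⟩, ?_, ?_⟩
  · rw [Real.sqrt_sq (by positivity)]
    field_simp
  · rw [hsub, Real.sqrt_sq (by positivity)]
    field_simp

theorem exists_flow_apply_mem_localUnstableSet_dist_eq {α : Type*} [PseudoMetricSpace α]
    {φ : Flow ℝ α} {p x : α} {ρ : ℝ} (hρ : 0 < ρ) (hx : Tendsto (fun t => φ t x) atBot (𝓝 p))
    {s : ℝ} (hs : φ s x ∉ Metric.closedBall p ρ) :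
    ∃ t, φ t x ∈ localUnstableSet φ p ρ ∧ dist (φ t x) p = ρ := by
  obtain ⟨T, hT⟩ := eventually_atBot.1 (hx.eventually (Metric.ball_mem_nhds p hρ))
  have hcont : Continuous fun t => dist (φ t x) p :=
    (φ.continuous continuous_id continuous_const).dist continuous_const
  obtain ⟨t, -, htρ, hlt⟩ := exists_first_eq hcont (min_le_right T s) (hT _ (min_le_left T s))
    (not_le.1 hs).le
  refine ⟨t, fun r hr => ?_, htρ⟩
  rw [← φ.map_add]
  rcases le_total (r + t) (min T s) with hle | hle
  · exact (hT _ (hle.trans (min_le_left T s))).le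
  · rcases hr.lt_or_eq with hr | rfl
    · exact (hlt _ ⟨hle, by linarith⟩).le
    · rw [zero_add]
      exact htρ.le

namespace IsHyperbolicBall

variable {n : ℕ} {f : Phase n → Phase n} {φ : Flow ℝ (Phase n)} {U : Finset (Fin n)}
  {p x y : Phase n} {ρ μ : ℝ}

theorem continuousOn_of_mem_localUnstableSet {X : Type*} [TopologicalSpace X] {s : Set X}
    {g : X → Phase n} (h : IsHyperbolicBall φ f U p ρ μ)
    (hg : ∀ z ∈ s, g z ∈ localUnstableSet φ p ρ) (hgU : ∀ l ∈ U, ContinuousOn (fun z => g z l) s) :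
    ContinuousOn g s := by
  intro z hz
  have hbound : ContinuousOn (fun w => √(2 * sqSum U (g w - g z))) s :=
    ((continuousOn_finsetSum U fun l hl =>
      ((hgU l hl).sub continuousOn_const).pow 2).const_mul 2).sqrt
  have hlim := hbound z hz
  rw [ContinuousWithinAt, sub_self, sqSum_eq_zero_of_forall fun _ _ => rfl, mul_zero,
    Real.sqrt_zero] at hlim
  rw [ContinuousWithinAt, tendsto_iff_dist_tendsto_zero]
  refine squeeze_zero' (Eventually.of_forall fun _ => dist_nonneg) ?_ hlim
  filter_upwards [self_mem_nhdsWithin] with w hw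
  rw [dist_eq_norm]
  exact Real.le_sqrt_of_sq_le (h.norm_sub_sq_le (hg w hw) (hg z hz))

theorem sqSum_map_sub_le_of_mem_localUnstableSet (h : IsHyperbolicBall φ f U p ρ μ)
    (hx : x ∈ localUnstableSet φ p ρ) {t : ℝ} (ht : t ≤ 0) :
    sqSum U (φ t x - p) ≤ Real.exp (μ * t) * sqSum U (x - p) :=
  h.sqSum_map_sub_le ht (fun _ hs => hx _ hs.2) fun _ hs =>
    h.coneForm_sub_nonneg (flow_apply_mem_localUnstableSet hx hs.2) h.mem_localUnstableSet

theorem eq_of_flow_apply_eq_of_nonpos (h : IsHyperbolicBall φ f U p ρ μ)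
    (hx : x ∈ localUnstableSet φ p ρ) (hxy : sqSum U (x - p) = sqSum U (y - p)) {t : ℝ}
    (ht0 : t ≤ 0) (ht : φ t x = y) : x = y := by
  rcases ht0.lt_or_eq with ht0 | rfl
  · have hle := h.sqSum_map_sub_le_of_mem_localUnstableSet hx ht0.le
    rw [ht, ← hxy] at hle
    have hexp : Real.exp (μ * t) < 1 :=
      Real.exp_lt_one_iff.2 (mul_neg_of_pos_of_neg h.rate_pos ht0)
    have hsq := h.norm_sub_sq_le hx h.mem_localUnstableSet
    have hzero : ‖x - p‖ ^ 2 ≤ 0 := by nlinarith [sqSum_nonneg U (x - p)]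
    obtain rfl : x = p := sub_eq_zero.1 (norm_eq_zero.1
      (pow_eq_zero_iff two_ne_zero |>.1 (le_antisymm hzero (sq_nonneg _))))
    rw [← ht, h.fixed]
  · rwa [φ.map_zero_apply] at ht

theorem eq_of_flow_apply_eq (h : IsHyperbolicBall φ f U p ρ μ) (hx : x ∈ localUnstableSet φ p ρ)
    (hy : y ∈ localUnstableSet φ p ρ) (hxy : sqSum U (x - p) = sqSum U (y - p)) {t : ℝ}
    (ht : φ t x = y) : x = y := by
  rcases le_total t 0 with ht0 | ht0
  · exact h.eq_of_flow_apply_eq_of_nonpos hx hxy ht0 ht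
  · refine (h.eq_of_flow_apply_eq_of_nonpos hy hxy.symm (neg_nonpos.2 ht0) ?_).symm
    rw [← ht, flow_neg_apply_apply]

theorem exists_nonpos_sqSum_eq (h : IsHyperbolicBall φ f U p ρ μ)
    (hx : x ∈ localUnstableSet φ p ρ) {c : ℝ} (hc : 0 < c) (hcx : c ≤ sqSum U (x - p)) :
    ∃ t ≤ 0, sqSum U (φ t x - p) = c := by
  have hcont : Continuous fun t => sqSum U (φ t x - p) := (continuous_sqSum U).comp
    ((φ.continuous continuous_id continuous_const).sub continuous_const)
  have hlim : Tendsto (fun t => sqSum U (φ t x - p)) atBot (𝓝 0) := by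
    have hsub := (h.tendsto_atBot_of_mem_localUnstableSet hx).sub_const p
    have hsq := ((continuous_sqSum U).tendsto _).comp hsub
    rwa [sub_self, sqSum_eq_zero_of_forall fun _ _ => rfl] at hsq
  obtain ⟨s, hs0, hsc⟩ := ((eventually_le_atBot 0).and (hlim.eventually (gt_mem_nhds hc))).exists
  obtain ⟨t, ht, htc⟩ := intermediate_value_Icc hs0 hcont.continuousOn
    ⟨hsc.le, by rwa [φ.map_zero_apply]⟩
  exact ⟨t, ht.2, htc⟩

theorem exists_flow_apply_sqSum_eq (h : IsHyperbolicBall φ f U p ρ μ)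
    (hx : Tendsto (fun t => φ t x) atBot (𝓝 p)) {s : ℝ} (hs : φ s x ∉ Metric.closedBall p ρ)
    {c : ℝ} (hc : 0 < c) (hcρ : 2 * c ≤ ρ ^ 2) :
    ∃ t, φ t x ∈ localUnstableSet φ p ρ ∧ sqSum U (φ t x - p) = c := by
  obtain ⟨t, ht, htρ⟩ := exists_flow_apply_mem_localUnstableSet_dist_eq h.radius_pos hx hs
  have hnorm := h.norm_sub_sq_le ht h.mem_localUnstableSet
  rw [← dist_eq_norm, htρ] at hnorm
  obtain ⟨r, hr, hrc⟩ := h.exists_nonpos_sqSum_eq ht hc (by linarith)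
  refine ⟨r + t, ?_, ?_⟩ <;> rw [φ.map_add]
  exacts [flow_apply_mem_localUnstableSet ht hr, hrc]

theorem exists_mem_localUnstableSet_coord_eq {i j k : Fin n}
    (h : IsHyperbolicBall φ f {j, k} p ρ μ) (hφ : ∀ t, IsZ2Equivariant (φ t))
    (hpi : p ∈ coordAxis i) (hi : i ∉ ({j, k} : Finset (Fin n))) (hjk : j ≠ k) {a b : ℝ}
    (hab : a ^ 2 + b ^ 2 ≤ (ρ / 4) ^ 2) :
    ∃ x ∈ localUnstableSet φ p ρ, x j = a ∧ x k = b := by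
  obtain ⟨hij, hik⟩ : i ≠ j ∧ i ≠ k := by simpa only [Finset.mem_insert, Finset.mem_singleton,
    not_or] using hi
  set w : Phase n := EuclideanSpace.single j a + EuclideanSpace.single k b with hw
  have hwU : w ∈ coordSubspace {j, k} := by
    intro l hl
    rw [Finset.mem_insert, Finset.mem_singleton, not_or] at hl
    simp [hw, hl.1, hl.2]
  have hwj : w j = a := by simp [hw, hjk]
  have hwk : w k = b := by simp [hw, hjk.symm]
  have hwρ : ‖w‖ ≤ ρ / 4 := by
    refine le_of_sq_le_sq ?_ (by linarith [h.radius_pos])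
    have hcompl : sqSum {j, k}ᶜ w = 0 :=
      sqSum_eq_zero_of_forall fun l hl => hwU l (Finset.mem_compl.1 hl)
    rwa [← sqSum_add_sqSum_compl {j, k} w, hcompl, sqSum_pair hjk, hwj, hwk, add_zero]
  obtain ⟨s, hs⟩ := h.exists_add_single_add_mem_localUnstableSet hφ hpi hi hwU hwρ
  refine ⟨_, hs, ?_, ?_⟩
  · simp [hpi j hij.symm, hwj, hij.symm]
  · simp [hpi k hik.symm, hwk, hik.symm]

end IsHyperbolicBall

variable {n : ℕ} {f : Phase n → Phase n} {Y : Set (Phase n)} {F : NetworkFlow f Y} {p : Phase n}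
  {j k : Fin n} {ρ μ : ℝ} {x : ℝ → Phase n}

/-- `x` parametrises by `[0, 1]` a curve in the local unstable set of `p`, lying over a quarter of a
circle in the plane of the two unstable coordinates `j`, `k`: these are proportional to `√θ` and
`√(1 - θ)` at `x θ`. It meets each trajectory of the unstable set, except `p`, exactly once. -/
structure IsCrossSection (F : NetworkFlow f Y) (p : Phase n) (j k : Fin n) (ρ μ : ℝ)
    (x : ℝ → Phase n) : Prop where
  ball : IsHyperbolicBall F.φ f {j, k} p ρ μ
  ne : j ≠ k
  apply_fst : p j = 0
  apply_snd : p k = 0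
  mem_localUnstableSet : ∀ θ ∈ Icc (0 : ℝ) 1, x θ ∈ localUnstableSet F.φ p ρ
  mem : ∀ θ ∈ Icc (0 : ℝ) 1, x θ ∈ Y
  coord_fst : ∀ θ ∈ Icc (0 : ℝ) 1, x θ j = ρ / 4 * √θ
  coord_snd : ∀ θ ∈ Icc (0 : ℝ) 1, x θ k = ρ / 4 * √(1 - θ)

namespace IsCrossSection

theorem swap (h : IsCrossSection F p j k ρ μ x) :
    IsCrossSection F p k j ρ μ fun θ => x (1 - θ) := by
  have hmem : ∀ θ ∈ Icc (0 : ℝ) 1, 1 - θ ∈ Icc (0 : ℝ) 1 :=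
    fun θ hθ => ⟨by linarith [hθ.2], by linarith [hθ.1]⟩
  refine ⟨Finset.pair_comm j k ▸ h.ball, h.ne.symm, h.apply_snd, h.apply_fst,
    fun θ hθ => h.mem_localUnstableSet _ (hmem θ hθ), fun θ hθ => h.mem _ (hmem θ hθ),
    fun θ hθ => ?_, fun θ hθ => h.coord_fst _ (hmem θ hθ)⟩
  rw [h.coord_snd _ (hmem θ hθ), sub_sub_cancel]

theorem tendsto_atBot (h : IsCrossSection F p j k ρ μ x) {θ : ℝ} (hθ : θ ∈ Icc (0 : ℝ) 1) :
    Tendsto (fun t => F.φ t (x θ)) atBot (𝓝 p) :=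
  h.ball.tendsto_atBot_of_mem_localUnstableSet (h.mem_localUnstableSet θ hθ)

theorem continuousOn (h : IsCrossSection F p j k ρ μ x) : ContinuousOn x (Icc 0 1) := by
  refine h.ball.continuousOn_of_mem_localUnstableSet h.mem_localUnstableSet fun l hl => ?_
  rw [Finset.mem_insert, Finset.mem_singleton] at hl
  rcases hl with rfl | rfl
  · exact ContinuousOn.congr (by fun_prop) h.coord_fst
  · exact ContinuousOn.congr (by fun_prop) h.coord_snd

theorem sqSum_sub (h : IsCrossSection F p j k ρ μ x) (y : Phase n) :
    sqSum {j, k} (y - p) = y j ^ 2 + y k ^ 2 := by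
  rw [sqSum_pair h.ne, PiLp.sub_apply, PiLp.sub_apply, h.apply_fst, h.apply_snd, sub_zero, sub_zero]

theorem sqSum_apply_sub (h : IsCrossSection F p j k ρ μ x) {θ : ℝ} (hθ : θ ∈ Icc (0 : ℝ) 1) :
    sqSum {j, k} (x θ - p) = (ρ / 4) ^ 2 := by
  rw [h.sqSum_sub, h.coord_fst θ hθ, h.coord_snd θ hθ, mul_pow, mul_pow, Real.sq_sqrt hθ.1,
    Real.sq_sqrt (sub_nonneg.2 hθ.2)]
  ring

theorem eq_of_flow_apply_eq (h : IsCrossSection F p j k ρ μ x) {θ₁ θ₂ : ℝ}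
    (h₁ : θ₁ ∈ Icc (0 : ℝ) 1) (h₂ : θ₂ ∈ Icc (0 : ℝ) 1) {t : ℝ} (ht : F.φ t (x θ₁) = x θ₂) :
    θ₁ = θ₂ := by
  have hx := h.ball.eq_of_flow_apply_eq (h.mem_localUnstableSet θ₁ h₁)
    (h.mem_localUnstableSet θ₂ h₂) ((h.sqSum_apply_sub h₁).trans (h.sqSum_apply_sub h₂).symm) ht
  have hcoord := h.coord_fst θ₁ h₁
  rw [hx, h.coord_fst θ₂ h₂] at hcoord
  have hsqrt := mul_left_cancel₀ (by linarith [h.ball.radius_pos] : ρ / 4 ≠ 0) hcoord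
  exact ((Real.sqrt_inj h₂.1 h₁.1).1 hsqrt).symm

theorem exists_flow_apply_eq (h : IsCrossSection F p j k ρ μ x) (hY : IsACNetwork f Y)
    (hp : p ∈ equilibriaIn f Y) {y : Phase n} (hy : y ∈ Y) (hyp : y ≠ p)
    (hyt : Tendsto (fun t => F.φ t y) atBot (𝓝 p)) :
    ∃ θ ∈ Icc (0 : ℝ) 1, ∃ t, F.φ t (x θ) = y := by
  have hρ := h.ball.radius_pos
  obtain ⟨b, hb, hpb, hyb, -⟩ := hY.exists_tendsto_atTop F hy hyt hyp
  have hbout : b ∉ Metric.closedBall p ρ :=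
    fun hmem => hpb (h.ball.eq_of_apply_eq_zero hp.2 hb.2 hmem).symm
  obtain ⟨s, hs⟩ := (hyb.eventually (Metric.isClosed_closedBall.isOpen_compl.mem_nhds hbout)).exists
  obtain ⟨t, ht, htρ⟩ := h.ball.exists_flow_apply_sqSum_eq hyt hs
    (by positivity : 0 < (ρ / 4) ^ 2) (by nlinarith)
  have htY := hY.subset_orthant (F.invariant y hy t)
  rw [h.sqSum_sub] at htρ
  obtain ⟨θ, hθ, hθj, hθk⟩ := exists_eq_mul_sqrt (htY j) (htY k) (by positivity) htρ
  have hxy : x θ = F.φ t y := by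
    refine h.ball.eq_of_mem_localUnstableSet (h.mem_localUnstableSet θ hθ) ht fun l hl => ?_
    rw [Finset.mem_insert, Finset.mem_singleton] at hl
    rcases hl with rfl | rfl
    · rw [h.coord_fst θ hθ, hθj]
    · rw [h.coord_snd θ hθ, hθk]
  exact ⟨θ, hθ, -t, by rw [hxy, flow_neg_apply_apply]⟩

end IsCrossSection

namespace IsACNetwork

theorem mem_of_mem_localUnstableSet (hY : IsACNetwork f Y) (hp : p ∈ equilibriaIn f Y)
    (h : IsHyperbolicBall F.φ f (unstableIdx f p) p ρ μ) (hdom : Metric.closedBall p ρ ⊆ F.dom)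
    {i : Fin n} (hi : p ∈ coordAxis i) (hρ : ρ ≤ p i) {y : Phase n}
    (hy : y ∈ localUnstableSet F.φ p ρ) (hyU : ∀ l ∈ unstableIdx f p, 0 ≤ y l) : y ∈ Y := by
  refine hY.unstableSet_subset hp (F.mem_unstableSet_of_tendsto (fun l => ?_)
    (fun t ht => hdom (hy t ht)) (h.tendsto_atBot_of_mem_localUnstableSet hy))
  by_cases hlU : l ∈ unstableIdx f p
  · exact hyU l hlU
  · by_cases hli : l = i
    · have hcoord : |(y - p) i| ≤ ρ := (PiLp.norm_apply_le (y - p) i).trans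
        ((dist_eq_norm y p).symm.trans_le (localUnstableSet_subset_closedBall hy))
      rw [PiLp.sub_apply] at hcoord
      rw [hli]
      linarith [(abs_le.1 hcoord).1]
    · exact (h.coord_eq_zero_of_mem_localUnstableSet F.equivariant (hi l hli) hlU hy).ge

theorem exists_isCrossSection (hY : IsACNetwork f Y) (F : NetworkFlow f Y)
    (hp : p ∈ equilibriaIn f Y) (hjk : j ≠ k) (hU : unstableIdx f p = {j, k}) :
    ∃ ρ μ x, IsCrossSection F p j k ρ μ x := by
  obtain ⟨i, hi, hpi⟩ := hY.exists_mem_coordAxis hp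
  obtain ⟨ρ₀, μ, h₀, hdom⟩ := hY.exists_isHyperbolicBall F hp
  set ρ := min ρ₀ (p i)
  have h := h₀.mono (lt_min h₀.radius_pos hpi) (min_le_left ρ₀ (p i))
  have hρ : 0 < ρ := h.radius_pos
  have hiU : i ∉ unstableIdx f p := fun hmem =>
    absurd (mem_unstableIdx.1 hmem) (hY.rate_axis_neg hp hi hpi).not_gt
  have hpU : ∀ l ∈ unstableIdx f p, p l = 0 := fun _ => hY.coord_eq_zero_of_mem_unstableIdx hp
  have hmemY : ∀ y ∈ localUnstableSet F.φ p ρ, (∀ l ∈ unstableIdx f p, 0 ≤ y l) → y ∈ Y :=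
    fun y => hY.mem_of_mem_localUnstableSet hp h
      ((Metric.closedBall_subset_closedBall (min_le_left _ _)).trans hdom) hi (min_le_right _ _)
  rw [hU] at h hiU hpU hmemY
  have harc : ∀ θ, ∃ y, θ ∈ Icc (0 : ℝ) 1 → y ∈ localUnstableSet F.φ p ρ ∧ y j = ρ / 4 * √θ ∧
      y k = ρ / 4 * √(1 - θ) := by
    intro θ
    by_cases hθ : θ ∈ Icc (0 : ℝ) 1
    · obtain ⟨y, hy⟩ := h.exists_mem_localUnstableSet_coord_eq F.equivariant hi hiU hjk
        (a := ρ / 4 * √θ) (b := ρ / 4 * √(1 - θ)) (by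
          rw [mul_pow, mul_pow, Real.sq_sqrt hθ.1, Real.sq_sqrt (sub_nonneg.2 hθ.2)]
          exact le_of_eq (by ring))
      exact ⟨y, fun _ => hy⟩
    · exact ⟨0, fun hθ' => absurd hθ' hθ⟩
  choose x hx using harc
  refine ⟨ρ, μ, x, h, hjk, hpU j (by simp), hpU k (by simp), fun θ hθ => (hx θ hθ).1,
    fun θ hθ => hmemY _ (hx θ hθ).1 fun l hl => ?_, fun θ hθ => (hx θ hθ).2.1,
    fun θ hθ => (hx θ hθ).2.2⟩
  rw [Finset.mem_insert, Finset.mem_singleton] at hl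
  rcases hl with rfl | rfl
  · rw [(hx θ hθ).2.1]; positivity
  · rw [(hx θ hθ).2.2]; positivity

end IsACNetwork

/-! ### Orbits close to a broken orbit -/

section BrokenOrbit

variable {α : Type*} [PseudoMetricSpace α] {φ : Flow ℝ α}

theorem eventually_forall_mem_Icc_dist_lt (φ : Flow ℝ α) (x : α) (a b : ℝ) {ε : ℝ} (hε : 0 < ε) :
    ∀ᶠ y in 𝓝 x, ∀ t ∈ Icc a b, dist (φ t y) (φ t x) < ε := by
  refine isCompact_Icc.eventually_forall_of_forall_eventually fun t _ => ?_
  have hcont : Continuous fun z : α × ℝ => dist (φ z.2 z.1) (φ z.2 x) :=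
    (φ.continuous continuous_snd continuous_fst).dist (φ.continuous continuous_snd continuous_const)
  exact hcont.continuousAt.eventually (gt_mem_nhds (by simpa only [dist_self] using hε))

theorem eventually_forall_mem_Icc_flow_mem {O : Set α} (hO : IsOpen O) {x : α} {a b : ℝ}
    (hx : ∀ t ∈ Icc a b, φ t x ∈ O) : ∀ᶠ y in 𝓝 x, ∀ t ∈ Icc a b, φ t y ∈ O := by
  refine isCompact_Icc.eventually_forall_of_forall_eventually fun t ht => ?_
  have hcont : Continuous fun z : α × ℝ => φ z.2 z.1 := φ.continuous continuous_snd continuous_fst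
  exact hcont.continuousAt.eventually (hO.mem_nhds (hx t ht))

theorem exists_exit_times {q x : α} {d τ : ℝ} {u : ℕ → α} (hu : Tendsto u atTop (𝓝 x))
    (hx : ∀ t ≥ τ, φ t x ∈ Metric.ball q d) (hout : ∀ m, ∃ t ≥ τ, φ t (u m) ∉ Metric.ball q d) :
    ∃ σ : ℕ → ℝ, Tendsto σ atTop atTop ∧ ∀ᶠ m in atTop, τ ≤ σ m ∧ dist (φ (σ m) (u m)) q = d ∧
      ∀ t ∈ Icc τ (σ m), φ t (u m) ∈ Metric.closedBall q d := by
  have hnear : ∀ b, ∀ᶠ m in atTop, ∀ t ∈ Icc τ b, φ t (u m) ∈ Metric.ball q d := fun b =>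
    hu.eventually (eventually_forall_mem_Icc_flow_mem Metric.isOpen_ball fun t ht => hx t ht.1)
  have hexit : ∀ᶠ m in atTop, ∃ s, τ ≤ s ∧ dist (φ s (u m)) q = d ∧
      ∀ t ∈ Icc τ s, φ t (u m) ∈ Metric.closedBall q d := by
    filter_upwards [hnear τ] with m hm
    obtain ⟨t, ht, htd⟩ := hout m
    obtain ⟨s, hs, hsd, hlt⟩ := exists_first_eq
      ((φ.continuous continuous_id continuous_const).dist continuous_const) ht
      (hm τ (left_mem_Icc.2 le_rfl)) (not_lt.1 htd)
    refine ⟨s, hs.1.le, hsd, fun t ht => ?_⟩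
    rcases ht.2.lt_or_eq with hts | rfl
    exacts [(hlt t ⟨ht.1, hts⟩).le, hsd.le]
  obtain ⟨σ, hσ⟩ := hexit.choice
  refine ⟨σ, tendsto_atTop.2 fun b => ?_, hσ⟩
  filter_upwards [hσ, hnear b] with m ⟨hτσ, hdist, _⟩ hb
  exact le_of_not_ge fun hσb => (hb (σ m) ⟨hτσ, hσb⟩).ne hdist

theorem mem_localUnstableSet_of_tendsto_exit {q e : α} {d τ : ℝ} {u : ℕ → α} {σ : ℕ → ℝ}
    (hσ : Tendsto σ atTop atTop)
    (hu : ∀ᶠ m in atTop, ∀ t ∈ Icc τ (σ m), φ t (u m) ∈ Metric.closedBall q d)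
    (he : Tendsto (fun m => φ (σ m) (u m)) atTop (𝓝 e)) : e ∈ localUnstableSet φ q d := by
  intro t ht
  have hlim : Tendsto (fun m => φ t (φ (σ m) (u m))) atTop (𝓝 (φ t e)) :=
    ((φ.continuous continuous_const continuous_id).tendsto e).comp he
  refine Metric.isClosed_closedBall.mem_of_tendsto hlim ?_
  filter_upwards [hu, hσ.eventually_ge_atTop (τ - t)] with m hm hτ
  rw [← φ.map_add]
  exact hm _ ⟨by linarith, by linarith⟩

theorem exists_exit_point {K : Set α} (hK : IsCompact K) {q x : α} {d τ : ℝ} {u : ℕ → α}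
    (hu : Tendsto u atTop (𝓝 x)) (huK : ∀ t m, φ t (u m) ∈ K)
    (hx : ∀ t ≥ τ, φ t x ∈ Metric.ball q d) (hout : ∀ m, ∃ t ≥ τ, φ t (u m) ∉ Metric.ball q d) :
    ∃ e ∈ K, e ∈ localUnstableSet φ q d ∧ dist e q = d ∧
      ∃ (s : ℕ → ℕ) (σ : ℕ → ℝ), Tendsto s atTop atTop ∧
        Tendsto (fun m => φ (σ m) (u (s m))) atTop (𝓝 e) ∧
        ∀ᶠ m in atTop, τ ≤ σ m ∧ ∀ t ∈ Icc τ (σ m), φ t (u (s m)) ∈ Metric.closedBall q d := by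
  obtain ⟨σ, hσ, hexit⟩ := exists_exit_times hu hx hout
  obtain ⟨e, heK, s, hs, hse⟩ := hK.tendsto_subseq (x := fun m => φ (σ m) (u m))
    fun m => huK _ m
  have hexit' := hs.tendsto_atTop.eventually hexit
  refine ⟨e, heK, ?_, ?_, s, σ ∘ s, hs.tendsto_atTop, hse, hexit'.mono fun m hm => ⟨hm.1, hm.2.2⟩⟩
  · exact mem_localUnstableSet_of_tendsto_exit (hσ.comp hs.tendsto_atTop)
      (hexit'.mono fun m hm => hm.2.2) hse
  · refine tendsto_nhds_unique (hse.dist tendsto_const_nhds) (tendsto_const_nhds.congr' ?_)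
    exact hexit'.mono fun m hm => hm.2.1.symm

theorem hausdorffEDist_le_ofReal {s t : Set α} {ε : ℝ} (hst : ∀ x ∈ s, ∃ y ∈ t, dist x y ≤ ε)
    (hts : ∀ y ∈ t, ∃ x ∈ s, dist y x ≤ ε) :
    Metric.hausdorffEDist s t ≤ ENNReal.ofReal ε := by
  refine Metric.hausdorffEDist_le_of_mem_edist (fun x hx => ?_) fun y hy => ?_
  · obtain ⟨y, hy, hxy⟩ := hst x hx
    exact ⟨y, hy, edist_dist x y ▸ ENNReal.ofReal_le_ofReal hxy⟩
  · obtain ⟨x, hx, hyx⟩ := hts y hy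
    exact ⟨x, hx, edist_dist y x ▸ ENNReal.ofReal_le_ofReal hyx⟩

theorem hausdorffEDist_orbit_le {q x y e : α} {τ σ ε : ℝ} (hτσ : τ ≤ σ)
    (hyx : ∀ t ≤ τ, dist (φ t y) (φ t x) ≤ ε) (hyq : ∀ t ∈ Icc τ σ, dist (φ t y) q ≤ ε / 2)
    (hye : ∀ t ≥ 0, dist (φ t (φ σ y)) (φ t e) ≤ ε) (hxq : ∀ t ≥ τ, dist (φ t x) q ≤ ε / 2)
    (heq : ∀ t ≤ 0, dist (φ t e) q ≤ ε / 2) :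
    Metric.hausdorffEDist (φ.orbit y) (φ.orbit x ∪ {q} ∪ φ.orbit e) ≤ ENNReal.ofReal ε := by
  have hball : ∀ z, dist z q ≤ ε / 2 → dist z (φ τ y) ≤ ε := fun z hz => by
    linarith [dist_triangle_right z (φ τ y) q, hyq τ ⟨le_rfl, hτσ⟩]
  have hε : 0 ≤ ε / 2 := dist_nonneg.trans (hxq τ le_rfl)
  refine hausdorffEDist_le_ofReal ?_ ?_
  · rintro _ ⟨t, rfl⟩
    rcases le_total t τ with ht | ht
    · exact ⟨_, Or.inl (Or.inl (φ.mem_orbit x t)), hyx t ht⟩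
    rcases le_total t σ with htσ | htσ
    · exact ⟨q, Or.inl (Or.inr rfl), (hyq t ⟨ht, htσ⟩).trans (by linarith)⟩
    · refine ⟨_, Or.inr (φ.mem_orbit e (t - σ)), ?_⟩
      have hdist := hye (t - σ) (sub_nonneg.2 htσ)
      rwa [← φ.map_add, sub_add_cancel] at hdist
  · rintro z ((⟨t, rfl⟩ | rfl) | ⟨t, rfl⟩)
    · rcases le_total t τ with ht | ht
      · exact ⟨_, φ.mem_orbit y t, dist_comm (φ t y) (φ t x) ▸ hyx t ht⟩
      · exact ⟨_, φ.mem_orbit y τ, hball _ (hxq t ht)⟩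
    · exact ⟨_, φ.mem_orbit y τ, hball z (by rwa [dist_self])⟩
    · rcases le_total t 0 with ht | ht
      · exact ⟨_, φ.mem_orbit y τ, hball _ (heq t ht)⟩
      · refine ⟨_, φ.mem_orbit y (t + σ), ?_⟩
        rw [φ.map_add, dist_comm]
        exact hye t ht

end BrokenOrbit

variable {n : ℕ} {f : Phase n → Phase n} {Y : Set (Phase n)} {F : NetworkFlow f Y}

theorem IsCrossSection.eventually_forall_le_dist_le {p : Phase n} {j k : Fin n} {ρ μ : ℝ}
    {x : ℝ → Phase n} (h : IsCrossSection F p j k ρ μ x) {θ₀ : ℝ} (hθ₀ : θ₀ ∈ Icc (0 : ℝ) 1)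
    (τ : ℝ) {ε : ℝ} (hε : 0 < ε) :
    ∀ᶠ θ in 𝓝[Icc 0 1] θ₀, ∀ t ≤ τ, dist (F.φ t (x θ)) (F.φ t (x θ₀)) ≤ ε := by
  obtain ⟨T, hT⟩ := eventually_atBot.1 ((eventually_le_atBot 0).and
    (h.ball.tendsto_exp_bound.eventually (gt_mem_nhds (by positivity : 0 < (ε / 2) ^ 2))))
  have hback : ∀ θ ∈ Icc (0 : ℝ) 1, ∀ t ≤ T, dist (F.φ t (x θ)) p ≤ ε / 2 := fun θ hθ t ht =>
    le_of_sq_le_sq ((h.ball.dist_map_sq_le (h.mem_localUnstableSet θ hθ) (hT t ht).1).trans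
      (hT t ht).2.le) (by positivity)
  filter_upwards [self_mem_nhdsWithin,
    (h.continuousOn θ₀ hθ₀).eventually (eventually_forall_mem_Icc_dist_lt F.φ (x θ₀) T τ hε)]
    with θ hθ hnear t ht
  rcases le_total t T with htT | htT
  · linarith [dist_triangle_right (F.φ t (x θ)) (F.φ t (x θ₀)) p, hback θ hθ t htT,
      hback θ₀ hθ₀ t htT]
  · exact (hnear t ⟨htT, ht⟩).le

theorem IsACNetwork.eventually_forall_ge_dist_le (hY : IsACNetwork f Y) (F : NetworkFlow f Y)
    {r e : Phase n} (hr : r ∈ equilibriaIn f Y) {I : Finset (Fin n)}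
    (hI : Disjoint I (unstableIdx f r)) (hrI : r ∈ coordSubspace I)
    (her : Tendsto (fun t => F.φ t e) atTop (𝓝 r)) {ε : ℝ} (hε : 0 < ε) :
    ∀ᶠ y in 𝓝[coordSubspace I] e, ∀ t ≥ 0, dist (F.φ t y) (F.φ t e) ≤ ε := by
  obtain ⟨ρ, μ, h, -⟩ := hY.exists_isHyperbolicBall F hr
  set η := min ρ (ε / 2)
  have hη : 0 < η := lt_min h.radius_pos (half_pos hε)
  obtain ⟨T, hT⟩ := eventually_atTop.1 (her.eventually (Metric.ball_mem_nhds r hη))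
  have hball : ∀ᶠ y in 𝓝 e, F.φ T y ∈ Metric.ball r η :=
    (F.φ.continuous continuous_const continuous_id).continuousAt.eventually
      (Metric.isOpen_ball.mem_nhds (hT T le_rfl))
  filter_upwards [self_mem_nhdsWithin, nhdsWithin_le_nhds hball, nhdsWithin_le_nhds
    (eventually_forall_mem_Icc_dist_lt F.φ e 0 T hε)] with y hyI hy hnear t ht
  rcases le_total t T with htT | htT
  · exact (hnear t ⟨ht, htT⟩).le
  · have htrap := (h.mono hη (min_le_left _ _)).dist_map_le F.equivariant hI hrI
      ((flow_apply_mem_coordSubspace_iff F.equivariant).2 hyI) hy (sub_nonneg.2 htT)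
    rw [← F.φ.map_add, sub_add_cancel] at htrap
    have hyη : dist (F.φ T y) r < η := hy
    have heη : dist (F.φ t e) r < η := hT t htT
    linarith [dist_triangle_right (F.φ t y) (F.φ t e) r, min_le_right ρ (ε / 2)]

/-! ### Cliques -/

theorem IsACNetwork.exists_mem_coordAxis_of_mem_coordSubspace {n : ℕ} {f : Phase n → Phase n}
    {Y : Set (Phase n)} (hY : IsACNetwork f Y) {b : Phase n} (hb : b ∈ equilibriaIn f Y)
    {I : Finset (Fin n)} (hbI : b ∈ coordSubspace I) : ∃ m ∈ I, b ∈ coordAxis m ∧ 0 < b m := by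
  obtain ⟨m, hm, hbm⟩ := hY.exists_mem_coordAxis hb
  exact ⟨m, not_not.1 fun hmI => hbm.ne' (hbI m hmI), hm, hbm⟩

/-- A cross section `x` of the unstable set of the equilibrium `p` on the `i`-th axis such that the
orbit of its edge `x 1` tends to the equilibrium `q` on the `j`-th axis, which has the unstable
direction `k` inside the space of the coordinates `i`, `j`, `k`, whereas all other orbits tend to
the equilibrium `r` on the `k`-th axis, which is a sink in that space. The orbits of `x` and of `q`
then make up a `Δ`-clique. -/
structure IsCliqueConfiguration {n : ℕ} {f : Phase n → Phase n} {Y : Set (Phase n)}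
    (F : NetworkFlow f Y) (p q r : Phase n) (i j k : Fin n) (ρ μ : ℝ) (x : ℝ → Phase n) :
    Prop where
  cross : IsCrossSection F p j k ρ μ x
  fst_mem : p ∈ equilibriaIn f Y
  snd_mem : q ∈ equilibriaIn f Y
  trd_mem : r ∈ equilibriaIn f Y
  fst_axis : p ∈ coordAxis i
  snd_axis : q ∈ coordAxis j
  trd_axis : r ∈ coordAxis k
  snd_pos : 0 < q j
  trd_pos : 0 < r k
  fst_unstable : unstableIdx f p = {j, k}
  snd_unstable : ∀ l ∈ ({i, j, k} : Finset (Fin n)), l ∈ unstableIdx f q ↔ l = k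
  trd_stable : Disjoint {i, j, k} (unstableIdx f r)
  tendsto_snd : Tendsto (fun t => F.φ t (x 1)) atTop (𝓝 q)
  tendsto_trd : ∀ θ ∈ Ico (0 : ℝ) 1, Tendsto (fun t => F.φ t (x θ)) atTop (𝓝 r)

namespace IsCliqueConfiguration

variable {n : ℕ} {f : Phase n → Phase n} {Y : Set (Phase n)} {F : NetworkFlow f Y}
  {p q r e e' y : Phase n} {i j k : Fin n} {ρ μ : ℝ} {x : ℝ → Phase n}

theorem fst_ne_snd (C : IsCliqueConfiguration F p q r i j k ρ μ x) : p ≠ q := by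
  rintro rfl
  exact C.snd_pos.ne' C.cross.apply_fst

theorem snd_ne_trd (C : IsCliqueConfiguration F p q r i j k ρ μ x) : q ≠ r := by
  rintro rfl
  exact C.trd_pos.ne' (C.snd_axis k C.cross.ne.symm)

theorem fst_ne_trd (C : IsCliqueConfiguration F p q r i j k ρ μ x) : p ≠ r := by
  rintro rfl
  exact C.trd_pos.ne' C.cross.apply_snd

theorem trd_mem_coordSubspace (C : IsCliqueConfiguration F p q r i j k ρ μ x) :
    r ∈ coordSubspace {i, j, k} :=
  fun l hl => C.trd_axis l fun hlk => hl (by simp [hlk])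

theorem mem_coordSubspace (C : IsCliqueConfiguration F p q r i j k ρ μ x) (hY : IsACNetwork f Y)
    (hy : Tendsto (fun t => F.φ t y) atBot (𝓝 p)) : y ∈ coordSubspace {i, j, k} := by
  have hmem := hY.mem_coordSubspace_of_tendsto_atBot F C.fst_mem C.fst_axis hy
  rwa [C.fst_unstable] at hmem

theorem apply_mem (C : IsCliqueConfiguration F p q r i j k ρ μ x) (hY : IsACNetwork f Y) {θ : ℝ}
    (hθ : θ ∈ Icc (0 : ℝ) 1) : x θ ∈ Y ∩ coordSubspace {i, j, k} :=
  ⟨C.cross.mem θ hθ, C.mem_coordSubspace hY (C.cross.tendsto_atBot hθ)⟩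

theorem mem_connection (C : IsCliqueConfiguration F p q r i j k ρ μ x) (hY : IsACNetwork f Y)
    {θ : ℝ} (hθ : θ ∈ Ico (0 : ℝ) 1) (t : ℝ) : F.φ t (x θ) ∈ connection f p r :=
  have hθ' := Ico_subset_Icc_self hθ
  (hY.mem_connection_iff F (F.invariant _ (C.cross.mem θ hθ') t)).2
    ⟨tendsto_flow_apply_atBot (C.cross.tendsto_atBot hθ') t,
      tendsto_flow_apply_atTop (C.tendsto_trd θ hθ) t⟩

theorem eq_or_eq_or_eq (C : IsCliqueConfiguration F p q r i j k ρ μ x) (hY : IsACNetwork f Y)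
    {b : Phase n} (hb : b ∈ equilibriaIn f Y) (hbI : b ∈ coordSubspace {i, j, k}) :
    b = p ∨ b = q ∨ b = r := by
  obtain ⟨m, hm, hbm, -⟩ := hY.exists_mem_coordAxis_of_mem_coordSubspace hb hbI
  simp only [Finset.mem_insert, Finset.mem_singleton] at hm
  rcases hm with rfl | rfl | rfl
  · exact Or.inl (hY.eq_of_mem_coordAxis hb C.fst_mem hbm C.fst_axis)
  · exact Or.inr (Or.inl (hY.eq_of_mem_coordAxis hb C.snd_mem hbm C.snd_axis))
  · exact Or.inr (Or.inr (hY.eq_of_mem_coordAxis hb C.trd_mem hbm C.trd_axis))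

theorem tendsto_trd_of_tendsto_snd (C : IsCliqueConfiguration F p q r i j k ρ μ x)
    (hY : IsACNetwork f Y) (he : e ∈ Y ∩ coordSubspace {i, j, k}) (heq : e ≠ q)
    (het : Tendsto (fun t => F.φ t e) atBot (𝓝 q)) : Tendsto (fun t => F.φ t e) atTop (𝓝 r) := by
  obtain ⟨b, hb, hqb, hbt, -⟩ := hY.exists_tendsto_atTop F he.1 het heq
  have hejk : e ∈ coordSubspace {j, k} := by
    intro l hl
    simp only [Finset.mem_insert, Finset.mem_singleton, not_or] at hl
    by_cases hlI : l ∈ ({i, j, k} : Finset (Fin n))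
    · refine hY.mem_coordSubspace_of_tendsto_atBot F C.snd_mem C.snd_axis het l ?_
      rw [Finset.mem_insert, C.snd_unstable l hlI, not_or]
      exact hl
    · exact he.2 l hlI
  obtain ⟨m, hm, hbm, -⟩ := hY.exists_mem_coordAxis_of_mem_coordSubspace hb
    (mem_coordSubspace_of_tendsto_flow F.equivariant hbt hejk)
  rw [Finset.mem_insert, Finset.mem_singleton] at hm
  rcases hm with rfl | rfl
  · exact absurd (hY.eq_of_mem_coordAxis C.snd_mem hb C.snd_axis hbm) hqb
  · rwa [hY.eq_of_mem_coordAxis hb C.trd_mem hbm C.trd_axis] at hbt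

theorem exists_map_eq_of_tendsto_snd (C : IsCliqueConfiguration F p q r i j k ρ μ x)
    (hY : IsACNetwork f Y) (he : e ∈ Y ∩ coordSubspace {i, j, k}) (heq : e ≠ q)
    (het : Tendsto (fun t => F.φ t e) atBot (𝓝 q)) (he' : e' ∈ Y ∩ coordSubspace {i, j, k})
    (heq' : e' ≠ q) (het' : Tendsto (fun t => F.φ t e') atBot (𝓝 q)) : ∃ t, F.φ t e = e' := by
  have hzero : ∀ z ∈ coordSubspace {i, j, k}, ∀ l ∈ unstableIdx f q, l ≠ k → z l = 0 :=
    fun z hz l hl hlk => hz l fun hmem => hlk ((C.snd_unstable l hmem).1 hl)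
  exact hY.exists_map_eq_of_tendsto_atBot F C.snd_mem ((C.snd_unstable k (by simp)).2 rfl)
    he.1 he'.1 heq heq' het het' (hzero e he.2) (hzero e' he'.2)

theorem exists_exit_point (C : IsCliqueConfiguration F p q r i j k ρ μ x) (hY : IsACNetwork f Y)
    {U : Finset (Fin n)} {d ν : ℝ} (hd : IsHyperbolicBall F.φ f U q d ν) {θ : ℕ → ℝ}
    (hθ : ∀ m, θ m ∈ Ico (0 : ℝ) 1) (hθ1 : Tendsto θ atTop (𝓝 1)) :
    ∃ τ, (∀ t ≥ τ, F.φ t (x 1) ∈ Metric.ball q d) ∧ ∃ e ∈ Y ∩ coordSubspace {i, j, k},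
      e ∈ localUnstableSet F.φ q d ∧ e ≠ q ∧
      ∃ (s : ℕ → ℕ) (σ : ℕ → ℝ), Tendsto s atTop atTop ∧
        Tendsto (fun m => F.φ (σ m) (x (θ (s m)))) atTop (𝓝 e) ∧
        ∀ᶠ m in atTop, τ ≤ σ m ∧
          ∀ t ∈ Icc τ (σ m), F.φ t (x (θ (s m))) ∈ Metric.closedBall q d := by
  have hθ' : ∀ m, θ m ∈ Icc (0 : ℝ) 1 := fun m => Ico_subset_Icc_self (hθ m)
  have hxlim : Tendsto (fun m => x (θ m)) atTop (𝓝 (x 1)) :=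
    (C.cross.continuousOn 1 (right_mem_Icc.2 zero_le_one)).tendsto.comp
      (tendsto_nhdsWithin_iff.2 ⟨hθ1, Eventually.of_forall hθ'⟩)
  obtain ⟨τ, hτ⟩ := eventually_atTop.1
    (C.tendsto_snd.eventually (Metric.ball_mem_nhds q hd.radius_pos))
  have hr : (Metric.closedBall q d)ᶜ ∈ 𝓝 r := Metric.isClosed_closedBall.isOpen_compl.mem_nhds
    fun hmem => C.snd_ne_trd (hd.eq_of_apply_eq_zero C.snd_mem.2 C.trd_mem.2 hmem).symm
  have hout : ∀ m, ∃ t ≥ τ, F.φ t (x (θ m)) ∉ Metric.ball q d := by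
    intro m
    obtain ⟨t, ht, htd⟩ :=
      ((eventually_ge_atTop τ).and ((C.tendsto_trd _ (hθ m)).eventually hr)).exists
    exact ⟨t, ht, fun hmem => htd (Metric.ball_subset_closedBall hmem)⟩
  obtain ⟨e, heK, hloc, hdist, hexit⟩ := _root_.exists_exit_point
    (hY.isCompact.inter_right (isClosed_coordSubspace _)) hxlim
    (fun t m => ⟨F.invariant _ (C.apply_mem hY (hθ' m)).1 t,
      (flow_apply_mem_coordSubspace_iff F.equivariant).2 (C.apply_mem hY (hθ' m)).2⟩) hτ hout
  exact ⟨τ, hτ, e, heK, hloc, dist_pos.1 (hdist.symm ▸ hd.radius_pos), hexit⟩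

theorem exists_tendsto_snd_atBot (C : IsCliqueConfiguration F p q r i j k ρ μ x)
    (hY : IsACNetwork f Y) :
    ∃ e ∈ Y ∩ coordSubspace {i, j, k}, e ≠ q ∧ Tendsto (fun t => F.φ t e) atBot (𝓝 q) := by
  obtain ⟨d, ν, hd, -⟩ := hY.exists_isHyperbolicBall F C.snd_mem
  obtain ⟨θ, -, hθ, hθ1⟩ := exists_seq_strictMono_tendsto' (zero_lt_one (α := ℝ))
  obtain ⟨-, -, e, he, hloc, heq, -⟩ :=
    C.exists_exit_point hY hd (fun m => Ioo_subset_Ico_self (hθ m)) hθ1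
  exact ⟨e, he, heq, hd.tendsto_atBot_of_mem_localUnstableSet hloc⟩

theorem exists_hausdorffEDist_orbit_le (C : IsCliqueConfiguration F p q r i j k ρ μ x)
    (hY : IsACNetwork f Y) (he : e ∈ Y ∩ coordSubspace {i, j, k}) (heq : e ≠ q)
    (het : Tendsto (fun t => F.φ t e) atBot (𝓝 q)) {θ : ℕ → ℝ}
    (hθ : ∀ m, θ m ∈ Ico (0 : ℝ) 1) (hθ1 : Tendsto θ atTop (𝓝 1)) {ε : ℝ} (hε : 0 < ε) :
    ∃ m, Metric.hausdorffEDist (F.φ.orbit (x (θ m))) (F.φ.orbit (x 1) ∪ {q} ∪ F.φ.orbit e) ≤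
      ENNReal.ofReal ε := by
  obtain ⟨ρq, ν, hq, -⟩ := hY.exists_isHyperbolicBall F C.snd_mem
  set d := min ρq (ε / 2)
  have hdε : d ≤ ε / 2 := min_le_right _ _
  have hd := hq.mono (lt_min hq.radius_pos (half_pos hε)) (min_le_left ρq (ε / 2))
  obtain ⟨τ, hτ, e', he', hloc, heq', s, σ, hs, hse, hexit⟩ := C.exists_exit_point hY hd hθ hθ1
  have het' := hd.tendsto_atBot_of_mem_localUnstableSet hloc
  obtain ⟨t₀, rfl⟩ := C.exists_map_eq_of_tendsto_snd hY he heq het he' heq' het'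
  have her := C.tendsto_trd_of_tendsto_snd hY he' heq' het'
  have hmem : ∀ m, θ m ∈ Icc (0 : ℝ) 1 := fun m => Ico_subset_Icc_self (hθ m)
  have hfirst := (tendsto_nhdsWithin_iff.2 ⟨hθ1.comp hs, Eventually.of_forall fun m =>
    hmem (s m)⟩).eventually
    (C.cross.eventually_forall_le_dist_le (right_mem_Icc.2 zero_le_one) τ hε)
  have hlast := (tendsto_nhdsWithin_iff.2 ⟨hse, Eventually.of_forall fun m =>
    (flow_apply_mem_coordSubspace_iff F.equivariant).2 (C.apply_mem hY (hmem (s m))).2⟩).eventually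
    (hY.eventually_forall_ge_dist_le F C.trd_mem C.trd_stable C.trd_mem_coordSubspace her hε)
  obtain ⟨m, hfirst, hlast, hτσ, hmid⟩ := (hfirst.and (hlast.and hexit)).exists
  refine ⟨s m, ?_⟩
  rw [← orbit_flow_apply F.φ t₀ e]
  exact hausdorffEDist_orbit_le hτσ hfirst (fun t ht => (hmid t ht).trans hdε) hlast
    (fun t ht => (hτ t ht).le.trans hdε) fun t ht => (hloc t ht).trans hdε

theorem tendsto_hausdorffEDist (C : IsCliqueConfiguration F p q r i j k ρ μ x)
    (hY : IsACNetwork f Y) (he : e ∈ Y ∩ coordSubspace {i, j, k}) (heq : e ≠ q)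
    (het : Tendsto (fun t => F.φ t e) atBot (𝓝 q)) :
    Tendsto (fun θ => Metric.hausdorffEDist (F.φ.orbit (x θ))
      (F.φ.orbit (x 1) ∪ {q} ∪ F.φ.orbit e)) (𝓝[<] 1) (𝓝 0) := by
  rw [ENNReal.tendsto_nhds_zero]
  intro ε hε
  obtain ⟨δ, hδ0, hδε⟩ := ENNReal.lt_iff_exists_nnreal_btwn.1 hε
  by_contra hcon
  have hfreq := (not_eventually.1 hcon).and_eventually (Ico_mem_nhdsLT (zero_lt_one (α := ℝ)))
  obtain ⟨θ, hθ, hθp⟩ := exists_seq_forall_of_frequently hfreq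
  obtain ⟨m, hm⟩ := C.exists_hausdorffEDist_orbit_le hY he heq het (fun m => (hθp m).2)
    (hθ.mono_right nhdsWithin_le_nhds) (NNReal.coe_pos.2 (ENNReal.coe_pos.1 hδ0))
  rw [ENNReal.ofReal_coe_nnreal] at hm
  exact (hθp m).1 (hm.trans hδε.le)

theorem broken_orbit_subset_closure (C : IsCliqueConfiguration F p q r i j k ρ μ x)
    (hY : IsACNetwork f Y) (he : e ∈ Y ∩ coordSubspace {i, j, k}) (heq : e ≠ q)
    (het : Tendsto (fun t => F.φ t e) atBot (𝓝 q)) :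
    F.φ.orbit (x 1) ∪ {q} ∪ F.φ.orbit e ⊆ closure (connection f p r) := by
  intro z hz
  rw [EMetric.mem_closure_iff]
  intro ε hε
  obtain ⟨θ, hdist, hθ⟩ := (((C.tendsto_hausdorffEDist hY he heq het).eventually
    (gt_mem_nhds hε)).and (Ico_mem_nhdsLT (zero_lt_one (α := ℝ)))).exists
  rw [Metric.hausdorffEDist_comm] at hdist
  obtain ⟨_, ⟨t, rfl⟩, hd⟩ := Metric.exists_edist_lt_of_hausdorffEDist_lt hz hdist
  exact ⟨_, C.mem_connection hY hθ t, hd⟩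

theorem closure_connection_subset (C : IsCliqueConfiguration F p q r i j k ρ μ x)
    (hY : IsACNetwork f Y) :
    closure (connection f p r) ⊆ Y ∩ coordSubspace {i, j, k} := by
  refine closure_minimal (fun y hy => ?_) (hY.isCompact.isClosed.inter (isClosed_coordSubspace _))
  have hyY := hY.unstableSet_subset C.fst_mem hy.1
  exact ⟨hyY, C.mem_coordSubspace hY ((hY.mem_connection_iff F hyY).1 hy).1⟩

theorem inter_coordSubspace_subset (C : IsCliqueConfiguration F p q r i j k ρ μ x)
    (hY : IsACNetwork f Y) (he : e ∈ Y ∩ coordSubspace {i, j, k}) (heq : e ≠ q)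
    (het : Tendsto (fun t => F.φ t e) atBot (𝓝 q)) :
    Y ∩ coordSubspace {i, j, k} ⊆ {p, q, r} ∪ F.φ.orbit (x 1) ∪ F.φ.orbit e ∪
      ⋃ θ ∈ Ico (0 : ℝ) 1, F.φ.orbit (x θ) := by
  rintro z ⟨hzY, hzI⟩
  by_cases hfz : f z = 0
  · exact Or.inl (Or.inl (Or.inl (C.eq_or_eq_or_eq hY ⟨hzY, hfz⟩ hzI)))
  obtain ⟨a, ha, -, -, -, hza, -⟩ := hY.exists_tendsto F hzY hfz
  have hz_ne : z ≠ a := fun h => hfz (h ▸ ha.2)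
  rcases C.eq_or_eq_or_eq hY ha (mem_coordSubspace_of_tendsto_flow F.equivariant hza hzI) with
    rfl | rfl | rfl
  · obtain ⟨θ, hθ, t, rfl⟩ := C.cross.exists_flow_apply_eq hY C.fst_mem hzY hz_ne hza
    rcases hθ.2.lt_or_eq with hθ1 | rfl
    · exact Or.inr (mem_iUnion₂.2 ⟨θ, ⟨hθ.1, hθ1⟩, F.φ.mem_orbit _ t⟩)
    · exact Or.inl (Or.inl (Or.inr (F.φ.mem_orbit _ t)))
  · obtain ⟨t, rfl⟩ := C.exists_map_eq_of_tendsto_snd hY he heq het ⟨hzY, hzI⟩ hz_ne hza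
    exact Or.inl (Or.inr (F.φ.mem_orbit e t))
  · exact absurd (hY.eq_of_tendsto_atBot_of_disjoint F ha C.trd_stable hzI hza) hz_ne

theorem closure_connection_eq (C : IsCliqueConfiguration F p q r i j k ρ μ x)
    (hY : IsACNetwork f Y) (he : e ∈ Y ∩ coordSubspace {i, j, k}) (heq : e ≠ q)
    (het : Tendsto (fun t => F.φ t e) atBot (𝓝 q)) :
    closure (connection f p r) = {p, q, r} ∪ F.φ.orbit (x 1) ∪ F.φ.orbit e ∪
      ⋃ θ ∈ Ico (0 : ℝ) 1, F.φ.orbit (x θ) := by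
  refine ((C.closure_connection_subset hY).trans
    (C.inter_coordSubspace_subset hY he heq het)).antisymm ?_
  have h0 : (0 : ℝ) ∈ Ico (0 : ℝ) 1 := ⟨le_rfl, zero_lt_one⟩
  have hbroken := C.broken_orbit_subset_closure hY he heq het
  have horbit : ∀ᶠ t in atTop ⊔ atBot, F.φ t (x 0) ∈ connection f p r :=
    Eventually.of_forall (C.mem_connection hY h0)
  refine union_subset (union_subset (union_subset ?_ ?_) ?_) (iUnion₂_subset fun θ hθ => ?_)
  · rintro z (rfl | rfl | rfl)
    · exact mem_closure_of_tendsto (C.cross.tendsto_atBot (Ico_subset_Icc_self h0))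
        (horbit.filter_mono le_sup_right)
    · exact hbroken (Or.inl (Or.inr rfl))
    · exact mem_closure_of_tendsto (C.tendsto_trd 0 h0) (horbit.filter_mono le_sup_left)
  · exact fun z hz => hbroken (Or.inl (Or.inl hz))
  · exact fun z hz => hbroken (Or.inr hz)
  · rintro _ ⟨t, rfl⟩
    exact subset_closure (C.mem_connection hY hθ t)

theorem isDeltaClique (C : IsCliqueConfiguration F p q r i j k ρ μ x) (hY : IsACNetwork f Y) :
    IsDeltaClique f p q r (closure (connection f p r)) := by
  obtain ⟨e, he, heq, het⟩ := C.exists_tendsto_snd_atBot hY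
  have her := C.tendsto_trd_of_tendsto_snd hY he heq het
  have h1 : (1 : ℝ) ∈ Icc (0 : ℝ) 1 := right_mem_Icc.2 zero_le_one
  have hx1 := C.cross.mem 1 h1
  have htraj : ∀ y ∈ Y, trajectory f y = F.φ.orbit y :=
    fun y hy => F.trajectory_eq_orbit hY.contDiff_one hy
  have htraj_x : ∀ θ ∈ Ico (0 : ℝ) 1, trajectory f (x θ) = F.φ.orbit (x θ) :=
    fun θ hθ => htraj _ (C.cross.mem θ (Ico_subset_Icc_self hθ))
  refine ⟨C.fst_mem.2, C.snd_mem.2, C.trd_mem.2, C.fst_ne_snd, C.snd_ne_trd, C.fst_ne_trd,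
    F.φ.orbit (x 1), F.φ.orbit e, x,
    ⟨x 1, (hY.mem_connection_iff F hx1).2 ⟨C.cross.tendsto_atBot h1, C.tendsto_snd⟩,
      (htraj _ hx1).symm⟩,
    ⟨e, (hY.mem_connection_iff F he.1).2 ⟨het, her⟩, (htraj _ he.1).symm⟩,
    C.cross.continuousOn.mono Ico_subset_Icc_self, fun θ hθ => ?_,
    fun θ₁ h₁ θ₂ h₂ hne htraj_eq => hne ?_, ?_, ?_⟩
  · exact F.φ.map_zero_apply (x θ) ▸ C.mem_connection hY hθ 0
  · rw [htraj_x _ h₁, htraj_x _ h₂] at htraj_eq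
    obtain ⟨t, ht⟩ : x θ₂ ∈ F.φ.orbit (x θ₁) := htraj_eq ▸ F.φ.mem_orbit_self (x θ₂)
    exact C.cross.eq_of_flow_apply_eq (Ico_subset_Icc_self h₁) (Ico_subset_Icc_self h₂) ht
  · refine (C.tendsto_hausdorffEDist hY he heq het).congr' ?_
    filter_upwards [Ico_mem_nhdsLT (zero_lt_one (α := ℝ))] with θ hθ
    rw [htraj_x θ hθ]
  · rw [C.closure_connection_eq hY he heq het, iUnion₂_congr htraj_x]

end IsCliqueConfiguration

/-! ### From the cross section to the cliques -/

section Structure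

variable {n : ℕ} {f : Phase n → Phase n} {Y : Set (Phase n)}

theorem single_mem_of_mem_coordSubspace_insert {I : Finset (Fin n)} {c : Fin n}
    {P : Submodule ℝ (Phase n)} {v : Phase n} (hv : v ∈ P) (hvI : v ∈ coordSubspace (insert c I))
    (hI : ∀ l ∈ I, EuclideanSpace.single l (1 : ℝ) ∈ P) (hvc : v c ≠ 0) :
    EuclideanSpace.single c (1 : ℝ) ∈ P := by
  by_cases hc : c ∈ I
  · exact hI c hc
  have hsum : v c • EuclideanSpace.single c (1 : ℝ) =
      v - ∑ l ∈ I, v l • EuclideanSpace.single l (1 : ℝ) := by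
    ext m
    have hcoord :
        (∑ l ∈ I, v l • EuclideanSpace.single l (1 : ℝ)) m = if m ∈ I then v m else 0 := by
      simp [Pi.single_apply]
    rw [PiLp.sub_apply, hcoord]
    by_cases hmI : m ∈ I
    · simp [hmI, ne_of_mem_of_not_mem hmI hc]
    · by_cases hmc : m = c
      · simp [hmc, hc]
      · simp [hmI, hmc, hvI m (by simp [hmI, hmc])]
  rw [← P.smul_mem_iff hvc, hsum]
  exact P.sub_mem hv (P.sum_mem fun l hl => P.smul_mem _ (hI l hl))

theorem disjoint_unstableIdx_of_isSinkIn (hfs : IsZ2Equivariant f) {b : Phase n} {m : Fin n}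
    (hb : b ∈ coordAxis m) {P : Submodule ℝ (Phase n)} (hsink : IsSinkIn f P b)
    {I : Finset (Fin n)} (hI : ∀ l ∈ I, EuclideanSpace.single l (1 : ℝ) ∈ P) :
    Disjoint I (unstableIdx f b) :=
  Finset.disjoint_left.2 fun l hl hlU =>
    (mem_unstableIdx.1 hlU).not_gt (rate_neg_of_isSinkIn hfs hb hsink (hI l hl))

namespace IsCrossSection

variable {F : NetworkFlow f Y} {p b q r : Phase n} {i j k : Fin n} {ρ μ θ : ℝ} {x : ℝ → Phase n}

theorem apply_ne (S : IsCrossSection F p j k ρ μ x) (hθ : θ ∈ Icc (0 : ℝ) 1) : x θ ≠ p := by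
  intro hx
  have hsq := S.sqSum_apply_sub hθ
  rw [hx, sub_self, sqSum_eq_zero_of_forall fun _ _ => rfl] at hsq
  exact (pow_pos (div_pos S.ball.radius_pos four_pos) 2).ne hsq

theorem exists_tendsto_atTop (S : IsCrossSection F p j k ρ μ x) (hY : IsACNetwork f Y)
    (hθ : θ ∈ Icc (0 : ℝ) 1) :
    ∃ b ∈ equilibriaIn f Y, p ≠ b ∧ Tendsto (fun t => F.φ t (x θ)) atTop (𝓝 b) ∧
      ∃ P : Submodule ℝ (Phase n), x θ ∈ P ∧ p ∈ P ∧ IsSinkIn f P b := by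
  have hxp := S.tendsto_atBot hθ
  obtain ⟨b, hb, hpb, hxb, P, hP, hpP, hsink⟩ :=
    hY.exists_tendsto_atTop F (S.mem θ hθ) hxp (S.apply_ne hθ)
  exact ⟨b, hb, hpb, hxb, P, hP ((hY.mem_connection_iff F (S.mem θ hθ)).2 ⟨hxp, hxb⟩), hpP, hsink⟩

theorem apply_mem_coordSubspace (S : IsCrossSection F p j k ρ μ x) (hY : IsACNetwork f Y)
    (hp : p ∈ equilibriaIn f Y) (hi : p ∈ coordAxis i) (hU : unstableIdx f p = {j, k})
    (hθ : θ ∈ Icc (0 : ℝ) 1) : x θ ∈ coordSubspace {i, j, k} := by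
  have hmem := hY.mem_coordSubspace_of_tendsto_atBot F hp hi (S.tendsto_atBot hθ)
  rwa [hU] at hmem

theorem limit_mem_coordSubspace (S : IsCrossSection F p j k ρ μ x) (hY : IsACNetwork f Y)
    (hp : p ∈ equilibriaIn f Y) (hi : p ∈ coordAxis i) (hU : unstableIdx f p = {j, k})
    (hθ : θ ∈ Icc (0 : ℝ) 1) (hθb : Tendsto (fun t => F.φ t (x θ)) atTop (𝓝 b)) :
    b ∈ coordSubspace {i, j, k} :=
  mem_coordSubspace_of_tendsto_flow F.equivariant hθb (S.apply_mem_coordSubspace hY hp hi hU hθ)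

-- The robustness subspace of the connection contains `p`, `b` and the orbit. The orbit has
-- nonzero coordinates `j` and `k`, so the subspace contains the three coordinate directions.
theorem disjoint_unstableIdx_of_mem_Ioo (S : IsCrossSection F p j k ρ μ x)
    (hY : IsACNetwork f Y) (hp : p ∈ equilibriaIn f Y) (hi : p ∈ coordAxis i) (hpi : 0 < p i)
    (hU : unstableIdx f p = {j, k}) (hθ : θ ∈ Ioo (0 : ℝ) 1)
    (hθb : Tendsto (fun t => F.φ t (x θ)) atTop (𝓝 b)) : Disjoint {i, j, k} (unstableIdx f b) := by
  have hθ' := Ioo_subset_Icc_self hθ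
  have hρ : 0 < ρ / 4 := div_pos S.ball.radius_pos four_pos
  obtain ⟨b', hb, hpb, hxb, P, hxP, hpP, hsink⟩ := S.exists_tendsto_atTop hY hθ'
  obtain rfl := tendsto_nhds_unique hxb hθb
  have hxI := S.apply_mem_coordSubspace hY hp hi hU hθ'
  have hxj : x θ j ≠ 0 := by
    rw [S.coord_fst θ hθ']
    exact (mul_pos hρ (Real.sqrt_pos.2 hθ.1)).ne'
  have hxk : x θ k ≠ 0 := by
    rw [S.coord_snd θ hθ']
    exact (mul_pos hρ (Real.sqrt_pos.2 (sub_pos.2 hθ.2))).ne'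
  have hiP := single_mem_of_mem_coordAxis hi hpi.ne' hpP
  obtain ⟨m, hm, hbm, hbpos⟩ := hY.exists_mem_coordAxis_of_mem_coordSubspace hb
    (S.limit_mem_coordSubspace hY hp hi hU hθ' hθb)
  have hmP := single_mem_of_mem_coordAxis hbm hbpos.ne' hsink.1
  refine disjoint_unstableIdx_of_isSinkIn hY.equivariant hbm hsink ?_
  simp only [Finset.mem_insert, Finset.mem_singleton, forall_eq_or_imp, forall_eq] at hm ⊢
  rcases hm with rfl | rfl | rfl
  · exact absurd (hY.eq_of_mem_coordAxis hp hb hi hbm) hpb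
  · refine ⟨hiP, hmP, single_mem_of_mem_coordSubspace_insert (I := {i, m}) hxP ?_ ?_ hxk⟩
    · rwa [show ({k, i, m} : Finset (Fin n)) = {i, m, k} by grind]
    · simp [hiP, hmP]
  · refine ⟨hiP, single_mem_of_mem_coordSubspace_insert (I := {i, m}) hxP ?_ ?_ hxj, hmP⟩
    · rwa [Finset.insert_comm]
    · simp [hiP, hmP]

theorem exists_edge_limit (S : IsCrossSection F p j k ρ μ x) (hY : IsACNetwork f Y)
    (hp : p ∈ equilibriaIn f Y) (hi : p ∈ coordAxis i) (hpi : 0 < p i)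
    (hU : unstableIdx f p = {j, k}) :
    ∃ q ∈ equilibriaIn f Y, q ∈ coordAxis j ∧ 0 < q j ∧
      Tendsto (fun t => F.φ t (x 1)) atTop (𝓝 q) ∧ Disjoint {i, j} (unstableIdx f q) := by
  have h1 : (1 : ℝ) ∈ Icc (0 : ℝ) 1 := right_mem_Icc.2 zero_le_one
  have hxI : x 1 ∈ coordSubspace {i, j} := by
    intro l hl
    by_cases hlk : l = k
    · rw [hlk, S.coord_snd 1 h1, sub_self, Real.sqrt_zero, mul_zero]
    · exact S.apply_mem_coordSubspace hY hp hi hU h1 l (by grind)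
  obtain ⟨q, hq, hpq, hxq, P, -, hpP, hsink⟩ := S.exists_tendsto_atTop hY h1
  obtain ⟨m, hm, hqm, hqpos⟩ := hY.exists_mem_coordAxis_of_mem_coordSubspace hq
    (mem_coordSubspace_of_tendsto_flow F.equivariant hxq hxI)
  rw [Finset.mem_insert, Finset.mem_singleton] at hm
  rcases hm with rfl | rfl
  · exact absurd (hY.eq_of_mem_coordAxis hp hq hi hqm) hpq
  · refine ⟨q, hq, hqm, hqpos, hxq, disjoint_unstableIdx_of_isSinkIn hY.equivariant hqm hsink ?_⟩
    simp only [Finset.mem_insert, Finset.mem_singleton, forall_eq_or_imp, forall_eq]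
    exact ⟨single_mem_of_mem_coordAxis hi hpi.ne' hpP,
      single_mem_of_mem_coordAxis hqm hqpos.ne' hsink.1⟩

theorem eventually_tendsto_atTop_of_disjoint (S : IsCrossSection F p j k ρ μ x)
    (hY : IsACNetwork f Y) (hp : p ∈ equilibriaIn f Y) (hi : p ∈ coordAxis i)
    (hU : unstableIdx f p = {j, k}) (hθ : θ ∈ Icc (0 : ℝ) 1) (hb : b ∈ equilibriaIn f Y)
    (hbI : Disjoint {i, j, k} (unstableIdx f b))
    (hθb : Tendsto (fun t => F.φ t (x θ)) atTop (𝓝 b)) :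
    ∀ᶠ s in 𝓝[Icc 0 1] θ, Tendsto (fun t => F.φ t (x s)) atTop (𝓝 b) := by
  have hbasin := hY.eventually_tendsto_atTop_of_disjoint F hb hbI
    (S.limit_mem_coordSubspace hY hp hi hU hθ hθb) hθb
  filter_upwards [(S.continuousOn θ hθ).eventually hbasin, self_mem_nhdsWithin] with s hs hsI
  exact hs (S.mem s hsI) (S.apply_mem_coordSubspace hY hp hi hU hsI)

theorem isOpen_setOf_tendsto (S : IsCrossSection F p j k ρ μ x) (hY : IsACNetwork f Y)
    (hp : p ∈ equilibriaIn f Y) (hi : p ∈ coordAxis i) (hpi : 0 < p i)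
    (hU : unstableIdx f p = {j, k}) (hb : b ∈ equilibriaIn f Y) :
    IsOpen {θ | θ ∈ Ioo (0 : ℝ) 1 ∧ Tendsto (fun t => F.φ t (x θ)) atTop (𝓝 b)} := by
  rw [isOpen_iff_mem_nhds]
  rintro θ ⟨hθ, hθb⟩
  have hbI := S.disjoint_unstableIdx_of_mem_Ioo hY hp hi hpi hU hθ hθb
  have hev := S.eventually_tendsto_atTop_of_disjoint hY hp hi hU (Ioo_subset_Icc_self hθ) hb hbI hθb
  rw [nhdsWithin_eq_nhds.2 (Icc_mem_nhds hθ.1 hθ.2)] at hev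
  filter_upwards [Ioo_mem_nhds hθ.1 hθ.2, hev] with s hs hsb using ⟨hs, hsb⟩

theorem tendsto_or_tendsto (S : IsCrossSection F p j k ρ μ x) (hY : IsACNetwork f Y)
    (hp : p ∈ equilibriaIn f Y) (hi : p ∈ coordAxis i) (hU : unstableIdx f p = {j, k})
    (hq : q ∈ equilibriaIn f Y) (hqj : q ∈ coordAxis j) (hr : r ∈ equilibriaIn f Y)
    (hrk : r ∈ coordAxis k) (hθ : θ ∈ Icc (0 : ℝ) 1) :
    Tendsto (fun t => F.φ t (x θ)) atTop (𝓝 q) ∨ Tendsto (fun t => F.φ t (x θ)) atTop (𝓝 r) := by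
  obtain ⟨b, hb, hpb, hxb, -⟩ := S.exists_tendsto_atTop hY hθ
  obtain ⟨m, hm, hbm, -⟩ := hY.exists_mem_coordAxis_of_mem_coordSubspace hb
    (S.limit_mem_coordSubspace hY hp hi hU hθ hxb)
  simp only [Finset.mem_insert, Finset.mem_singleton] at hm
  rcases hm with rfl | rfl | rfl
  · exact absurd (hY.eq_of_mem_coordAxis hp hb hi hbm) hpb
  · exact Or.inl (hY.eq_of_mem_coordAxis hq hb hqj hbm ▸ hxb)
  · exact Or.inr (hY.eq_of_mem_coordAxis hr hb hrk hbm ▸ hxb)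

theorem forall_tendsto_or_forall_tendsto (S : IsCrossSection F p j k ρ μ x) (hY : IsACNetwork f Y)
    (hp : p ∈ equilibriaIn f Y) (hi : p ∈ coordAxis i) (hpi : 0 < p i)
    (hU : unstableIdx f p = {j, k}) (hq : q ∈ equilibriaIn f Y) (hqj : q ∈ coordAxis j)
    (hr : r ∈ equilibriaIn f Y) (hrk : r ∈ coordAxis k) (hqr : q ≠ r) :
    (∀ θ ∈ Ioo (0 : ℝ) 1, Tendsto (fun t => F.φ t (x θ)) atTop (𝓝 q)) ∨
      ∀ θ ∈ Ioo (0 : ℝ) 1, Tendsto (fun t => F.φ t (x θ)) atTop (𝓝 r) := by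
  refine (isPreconnected_Ioo.subset_or_subset (S.isOpen_setOf_tendsto hY hp hi hpi hU hq)
    (S.isOpen_setOf_tendsto hY hp hi hpi hU hr) ?_ ?_).imp
    (fun h θ hθ => (h hθ).2) fun h θ hθ => (h hθ).2
  · exact disjoint_left.2 fun θ hθq hθr => hqr (tendsto_nhds_unique hθq.2 hθr.2)
  · exact fun θ hθ => (S.tendsto_or_tendsto hY hp hi hU hq hqj hr hrk (Ioo_subset_Icc_self hθ)).imp
      (fun h => ⟨hθ, h⟩) fun h => ⟨hθ, h⟩

-- Otherwise `q` would attract a neighbourhood of `x 1` in the arc.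
theorem mem_unstableIdx_of_forall_tendsto (S : IsCrossSection F p j k ρ μ x) (hY : IsACNetwork f Y)
    (hp : p ∈ equilibriaIn f Y) (hi : p ∈ coordAxis i) (hU : unstableIdx f p = {j, k})
    (hq : q ∈ equilibriaIn f Y) (hqI : Disjoint {i, j} (unstableIdx f q)) (hqr : q ≠ r)
    (hxq : Tendsto (fun t => F.φ t (x 1)) atTop (𝓝 q))
    (hxr : ∀ θ ∈ Ico (0 : ℝ) 1, Tendsto (fun t => F.φ t (x θ)) atTop (𝓝 r)) :
    k ∈ unstableIdx f q := by
  by_contra hk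
  have hstable : Disjoint {i, j, k} (unstableIdx f q) := by
    rw [Finset.disjoint_left] at hqI ⊢
    grind
  have hev := S.eventually_tendsto_atTop_of_disjoint hY hp hi hU (right_mem_Icc.2 zero_le_one)
    hq hstable hxq
  have hIco : Ico (0 : ℝ) 1 ∈ 𝓝[<] 1 := Ico_mem_nhdsLT zero_lt_one
  have hle : 𝓝[<] (1 : ℝ) ≤ 𝓝[Icc 0 1] 1 :=
    nhdsWithin_le_iff.2 (mem_of_superset hIco Ico_subset_Icc_self)
  obtain ⟨θ, hθq, hθ⟩ := ((hev.filter_mono hle).and hIco).exists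
  exact hqr (tendsto_nhds_unique hθq (hxr θ hθ))

theorem exists_isCliqueConfiguration (S : IsCrossSection F p j k ρ μ x) (hY : IsACNetwork f Y)
    (hp : p ∈ equilibriaIn f Y) (hi : p ∈ coordAxis i) (hpi : 0 < p i)
    (hU : unstableIdx f p = {j, k}) (hr : r ∈ equilibriaIn f Y) (hrk : r ∈ coordAxis k)
    (hrpos : 0 < r k) (hxr : ∀ θ ∈ Ico (0 : ℝ) 1, Tendsto (fun t => F.φ t (x θ)) atTop (𝓝 r)) :
    ∃ q, IsCliqueConfiguration F p q r i j k ρ μ x := by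
  obtain ⟨q, hq, hqj, hqpos, hxq, hqI⟩ := S.exists_edge_limit hY hp hi hpi hU
  have hqr : q ≠ r := by
    rintro rfl
    exact hrpos.ne' (hqj k S.ne.symm)
  have hhalf : (1 / 2 : ℝ) ∈ Ioo (0 : ℝ) 1 := by norm_num
  have hrI := S.disjoint_unstableIdx_of_mem_Ioo hY hp hi hpi hU hhalf
    (hxr _ (Ioo_subset_Ico_self hhalf))
  have hqk := S.mem_unstableIdx_of_forall_tendsto hY hp hi hU hq hqI hqr hxq hxr
  refine ⟨q, S, hp, hq, hr, hi, hqj, hrk, hqpos, hrpos, hU, fun l hl => ?_, hrI, hxq, hxr⟩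
  rw [Finset.disjoint_left] at hqI
  grind

end IsCrossSection

theorem IsACNetwork.exists_isCliqueConfiguration (hY : IsACNetwork f Y) (F : NetworkFlow f Y)
    {p : Phase n} (hp : p ∈ equilibriaIn f Y) (hcard : (unstableIdx f p).card = 2) :
    ∃ q r i j k ρ μ x, IsCliqueConfiguration F p q r i j k ρ μ x := by
  obtain ⟨j, k, hjk, hU⟩ := Finset.card_eq_two.1 hcard
  obtain ⟨i, hi, hpi⟩ := hY.exists_mem_coordAxis hp
  have hU' : unstableIdx f p = {k, j} := hU.trans (Finset.pair_comm j k)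
  obtain ⟨ρ, μ, x, S⟩ := hY.exists_isCrossSection F hp hjk hU
  obtain ⟨q, hq, hqj, hqpos, hxq, -⟩ := S.exists_edge_limit hY hp hi hpi hU
  obtain ⟨r, hr, hrk, hrpos, hxr, -⟩ := S.swap.exists_edge_limit hY hp hi hpi hU'
  have hqr : q ≠ r := by
    rintro rfl
    exact hrpos.ne' (hqj k hjk.symm)
  rw [sub_self] at hxr
  rcases S.forall_tendsto_or_forall_tendsto hY hp hi hpi hU hq hqj hr hrk hqr with hall | hall
  · have hswap : ∀ θ ∈ Ico (0 : ℝ) 1, Tendsto (fun t => F.φ t (x (1 - θ))) atTop (𝓝 q) := by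
      intro θ hθ
      rcases hθ.1.eq_or_lt with rfl | hpos
      · rwa [sub_zero]
      · exact hall _ ⟨by linarith [hθ.2], by linarith⟩
    obtain ⟨e, C⟩ := S.swap.exists_isCliqueConfiguration hY hp hi hpi hU' hq hqj hqpos hswap
    exact ⟨e, q, i, k, j, ρ, μ, _, C⟩
  · have hIco : ∀ θ ∈ Ico (0 : ℝ) 1, Tendsto (fun t => F.φ t (x θ)) atTop (𝓝 r) := by
      intro θ hθ
      rcases hθ.1.eq_or_lt with rfl | hpos
      · exact hxr
      · exact hall θ ⟨hpos, hθ.2⟩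
    obtain ⟨e, C⟩ := S.exists_isCliqueConfiguration hY hp hi hpi hU hr hrk hrpos hIco
    exact ⟨e, r, i, j, k, ρ, μ, x, C⟩

end Structure

/-! ### The dimension of connections -/

namespace IsACNetwork

variable {n : ℕ} {f : Phase n → Phase n} {Y : Set (Phase n)} {a b y z : Phase n}

theorem connection_subset (hY : IsACNetwork f Y) (ha : a ∈ equilibriaIn f Y) (b : Phase n) :
    connection f a b ⊆ Y :=
  inter_subset_left.trans (hY.unstableSet_subset ha)

theorem tendsto_of_mem_connection (hY : IsACNetwork f Y) (F : NetworkFlow f Y)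
    (ha : a ∈ equilibriaIn f Y) (hy : y ∈ connection f a b) :
    Tendsto (fun t => F.φ t y) atBot (𝓝 a) ∧ Tendsto (fun t => F.φ t y) atTop (𝓝 b) :=
  (hY.mem_connection_iff F (hY.connection_subset ha b hy)).1 hy

theorem ne_of_mem_connection (hY : IsACNetwork f Y) (ha : a ∈ equilibriaIn f Y) (hab : a ≠ b)
    (hy : y ∈ connection f a b) : y ≠ a := by
  rintro rfl
  obtain ⟨F⟩ := hY.nonempty_networkFlow
  have htop := (hY.tendsto_of_mem_connection F ha hy).2
  simp only [hY.map_equilibrium F ha] at htop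
  exact hab (tendsto_nhds_unique tendsto_const_nhds htop)

theorem subsingleton_connection_self (hY : IsACNetwork f Y) (ha : a ∈ equilibriaIn f Y) :
    (connection f a a).Subsingleton := by
  suffices h : ∀ y ∈ connection f a a, y = a from fun y hy z hz => (h y hy).trans (h z hz).symm
  intro y hy
  by_contra hya
  obtain ⟨F⟩ := hY.nonempty_networkFlow
  obtain ⟨hbot, htop⟩ := hY.tendsto_of_mem_connection F ha hy
  obtain ⟨b, -, hab, hyb, -⟩ :=
    hY.exists_tendsto_atTop F (hY.connection_subset ha a hy) hbot hya
  exact hab (tendsto_nhds_unique htop hyb)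

theorem dimH_connection_eq_one (hY : IsACNetwork f Y) (F : NetworkFlow f Y)
    (ha : a ∈ equilibriaIn f Y) (hab : a ≠ b) (hz : z ∈ connection f a b)
    (hone : ∀ y ∈ connection f a b, ∃ t, F.φ t z = y) : dimH (connection f a b) = 1 := by
  have hzY := hY.connection_subset ha b hz
  obtain ⟨hbot, htop⟩ := hY.tendsto_of_mem_connection F ha hz
  have heq : connection f a b = F.φ.orbit z := by
    refine Subset.antisymm (fun y hy => F.φ.mem_orbit_iff.2 (hone y hy)) fun y hy => ?_
    obtain ⟨t, rfl⟩ := F.φ.mem_orbit_iff.1 hy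
    exact (hY.mem_connection_iff F (F.invariant z hzY t)).2
      ⟨tendsto_flow_apply_atBot hbot t, tendsto_flow_apply_atTop htop t⟩
  obtain ⟨t, ht⟩ : ∃ t, F.φ t z ≠ z := by
    by_contra! hfix
    simp only [hfix] at hbot htop
    exact hab ((tendsto_nhds_unique hbot tendsto_const_nhds).trans
      (tendsto_nhds_unique tendsto_const_nhds htop))
  rw [heq, F.dimH_orbit hY.contDiff_one.continuous hzY ht]

theorem dimH_connection_eq_one_of_card_eq_one (hY : IsACNetwork f Y) (ha : a ∈ equilibriaIn f Y)
    (hcard : (unstableIdx f a).card = 1) (hab : a ≠ b) (hne : (connection f a b).Nonempty) :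
    dimH (connection f a b) = 1 := by
  obtain ⟨F⟩ := hY.nonempty_networkFlow
  obtain ⟨k, hU⟩ := Finset.card_eq_one.1 hcard
  have honly : ∀ y : Phase n, ∀ l ∈ unstableIdx f a, l ≠ k → y l = 0 :=
    fun y l hl hlk => absurd (Finset.mem_singleton.1 (hU ▸ hl)) hlk
  obtain ⟨z, hz⟩ := hne
  refine hY.dimH_connection_eq_one F ha hab hz fun y hy => ?_
  exact hY.exists_map_eq_of_tendsto_atBot F ha (hU ▸ Finset.mem_singleton_self k)
    (hY.connection_subset ha b hz) (hY.connection_subset ha b hy)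
    (hY.ne_of_mem_connection ha hab hz) (hY.ne_of_mem_connection ha hab hy)
    (hY.tendsto_of_mem_connection F ha hz).1 (hY.tendsto_of_mem_connection F ha hy).1
    (honly z) (honly y)

end IsACNetwork

namespace IsCliqueConfiguration

variable {n : ℕ} {f : Phase n → Phase n} {Y : Set (Phase n)} {F : NetworkFlow f Y}
  {p q r b y : Phase n} {i j k : Fin n} {ρ μ : ℝ} {x : ℝ → Phase n}

theorem eq_or_exists_flow_apply_eq (C : IsCliqueConfiguration F p q r i j k ρ μ x)
    (hY : IsACNetwork f Y) (hpb : p ≠ b) (hy : y ∈ connection f p b) :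
    b = r ∨ b = q ∧ ∃ t, F.φ t (x 1) = y := by
  obtain ⟨hbot, htop⟩ := hY.tendsto_of_mem_connection F C.fst_mem hy
  obtain ⟨θ, hθ, t, rfl⟩ := C.cross.exists_flow_apply_eq hY C.fst_mem
    (hY.connection_subset C.fst_mem b hy) (hY.ne_of_mem_connection C.fst_mem hpb hy) hbot
  rcases hθ.2.lt_or_eq with hlt | rfl
  · exact Or.inl (tendsto_nhds_unique htop
      (tendsto_flow_apply_atTop (C.tendsto_trd θ ⟨hθ.1, hlt⟩) t))
  · exact Or.inr ⟨tendsto_nhds_unique htop (tendsto_flow_apply_atTop C.tendsto_snd t), t, rfl⟩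

theorem dimH_connection_eq_one (C : IsCliqueConfiguration F p q r i j k ρ μ x)
    (hY : IsACNetwork f Y) : dimH (connection f p q) = 1 := by
  have h1 : (1 : ℝ) ∈ Icc (0 : ℝ) 1 := right_mem_Icc.2 zero_le_one
  have hx : x 1 ∈ connection f p q :=
    (hY.mem_connection_iff F (C.cross.mem 1 h1)).2 ⟨C.cross.tendsto_atBot h1, C.tendsto_snd⟩
  exact hY.dimH_connection_eq_one F C.fst_mem C.fst_ne_snd hx fun y hy =>
    ((C.eq_or_exists_flow_apply_eq hY C.fst_ne_snd hy).resolve_left C.snd_ne_trd).2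

end IsCliqueConfiguration

namespace IsACNetwork

variable {n : ℕ} {f : Phase n → Phase n} {Y : Set (Phase n)} {a b : Phase n}

theorem dimH_eq_one_or_isDeltaClique (hY : IsACNetwork f Y) (ha : a ∈ equilibriaIn f Y)
    (hab : a ≠ b) (hne : (connection f a b).Nonempty) :
    dimH (connection f a b) = 1 ∨
      ∃ q ∈ equilibriaIn f Y, IsDeltaClique f a q b (closure (connection f a b)) := by
  obtain ⟨i, hi, -⟩ := hY.exists_mem_coordAxis ha
  have hdim := hY.unstable_dim a ha
  rw [← card_unstableIdx hY.equivariant hi] at hdim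
  rcases hdim with hcard | hcard
  · exact Or.inl (hY.dimH_connection_eq_one_of_card_eq_one ha hcard hab hne)
  · obtain ⟨F⟩ := hY.nonempty_networkFlow
    obtain ⟨q, r, i, j, k, ρ, μ, x, C⟩ := hY.exists_isCliqueConfiguration F ha hcard
    obtain ⟨y, hy⟩ := hne
    rcases C.eq_or_exists_flow_apply_eq hY hab hy with rfl | ⟨rfl, -⟩
    · exact Or.inr ⟨q, C.snd_mem, C.isDeltaClique hY⟩
    · exact Or.inl (C.dimH_connection_eq_one hY)

end IsACNetwork

/-- An ac-network is the union of its equilibria, its one-dimensional connections and the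
`Δ`-cliques it contains; and the closure of every two-dimensional connection `[p → r]` between its
equilibria is a `Δ`-clique beginning at `p` and ending at `r`. The dimension of a connection is its
Hausdorff dimension. -/
theorem mainTheorem5 {n : ℕ} (f : Phase n → Phase n) (Y : Set (Phase n))
    (hY : IsACNetwork f Y) :
    Y = equilibriaIn f Y
        ∪ ⋃₀ {C | C ⊆ Y ∧ dimH C = 1 ∧
            ∃ p ∈ equilibriaIn f Y, ∃ q ∈ equilibriaIn f Y, p ≠ q ∧ C = connection f p q}
        ∪ ⋃₀ {D | D ⊆ Y ∧ ∃ p ∈ equilibriaIn f Y, ∃ q ∈ equilibriaIn f Y,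
            ∃ r ∈ equilibriaIn f Y, IsDeltaClique f p q r D} ∧
    ∀ p ∈ equilibriaIn f Y, ∀ r ∈ equilibriaIn f Y, dimH (connection f p r) = 2 →
      ∃ q ∈ equilibriaIn f Y, IsDeltaClique f p q r (closure (connection f p r)) := by
  refine ⟨Subset.antisymm (fun x hx => ?_) ?_, fun p hp r _ hdim => ?_⟩
  · by_cases hfx : f x = 0
    · exact Or.inl (Or.inl ⟨hx, hfx⟩)
    obtain ⟨a, ha, b, hb, hab, hxc, -⟩ := hY.exists_mem_connection hx hfx
    have hsub := hY.connection_subset ha b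
    rcases hY.dimH_eq_one_or_isDeltaClique ha hab ⟨x, hxc⟩ with hdim | ⟨q, hq, hD⟩
    · exact Or.inl (Or.inr ⟨_, ⟨hsub, hdim, a, ha, b, hb, hab, rfl⟩, hxc⟩)
    · exact Or.inr ⟨_, ⟨closure_minimal hsub hY.isCompact.isClosed, a, ha, q, hq, b, hb, hD⟩,
        subset_closure hxc⟩
  · rintro x ((hx | ⟨C, hC, hx⟩) | ⟨D, hD, hx⟩)
    exacts [hx.1, hC.1 hx, hD.1 hx]
  · have hnotsub : ¬(connection f p r).Subsingleton := fun h => by simp [h.dimH_zero] at hdim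
    have hpr : p ≠ r := fun h => hnotsub (h ▸ hY.subsingleton_connection_self hp)
    have hne := (not_subsingleton_iff.1 hnotsub).nonempty
    refine (hY.dimH_eq_one_or_isDeltaClique hp hpr hne).resolve_left fun hone => ?_
    norm_num [hone] at hdim
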